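/- Let $K$ be a field of characteristic zero (for instance $K=\mathbb C$), let $\ell\ge 1$, and let $V=\{x\in K^\ell : x_1+\dots+x_\ell=0\}$ with $S=S(V^*)$. Let $\mathcal A$ be the Coxeter arrangement of type $A_{\ell-1}$ in $V$, consisting of the hyperplanes $\ker(x_i-x_j)$ for $1\le i<j\le \ell$. A multiarrangement $(\mathcal A,\nu)$ in a finite-dimensional space $V$ is a finite set $\mathcal A$ of linear hyperplanes $H=\ker\alpha_H$ with multiplicities $\nu(H)\in\mathbb Z_{\ge1}$. It is free if $D(\mathcal A,\nu)=\{\theta\in\operatorname{Der}(S) : \theta(\alpha_H)\in\alpha_H^{\nu(H)}S \text{ for all } H\in\mathcal A\}$ is a free $S$-module; the multiset of polynomial degrees of a homogeneous basis is then denoted $\exp(\mathcal A,\nu)$. For $H_0=\ker\alpha_0\in\mathcal A$, the deletion $(\mathcal A',\nu')$ is obtained by lowering the multiplicity of $H_0$ by one (removing $H_0$ if it becomes $0$). The restriction $(\mathcal A'',\nu^*)$ is the arrangement $\mathcal A''=\{H\cap H_0 : H\in\mathcal A\setminus\{H_0\}\}$ in $H_0$ with the Euler multiplicity: $\nu^*(Y)=\operatorname{pdeg}\theta_Y$,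 where the derivation module of the localization $\{H\in\mathcal A: Y\subseteq H\}$ (with the multiplicities $\nu$) has a homogeneous basis $\theta_Y,\psi_Y,D_3,\dots,D_{\dim V}$ with $\theta_Y\notin\alpha_0\operatorname{Der}(S)$, $\psi_Y\in\alpha_0\operatorname{Der}(S)$ and $D_3,\dots,D_{\dim V}$ constant derivations along $Y$. The class of inductively free multiarrangements is the smallest class that contains all empty arrangements and contains $(\mathcal A,\nu)$ whenever, for some $H_0\in\mathcal A$, both $(\mathcal A',\nu')$ and $(\mathcal A'',\nu^*)$ belong to the class and $\exp(\mathcal A'',\nu^*)\subseteq\exp(\mathcal A',\nu')$ as multisets. Then, for all integers $m,q\ge 1$, the multiarrangement $(\mathcal A;m,q)$ with defining polynomial \[ Q(\mathcal A;m,q)=\prod_{2\le j\le \ell}(x_1-x_j)^{m+q}\prod_{2\le i<j\le \ell}(x_i-x_j)^m \] is inductively free, and it is free with exponents \[ \exp(\mathcal A;m,q)=\left\{\tfrac{m\ell}{2}+q,\ldots,\tfrac{m\ell}{2}+q\right\}\quad(\ell-1\text{ entries}) \] when $m$ is even, and \[ \exp(\mathcal A;m,q)=\left\{\tfrac{(m-1)\ell}{2}+i+q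 : i=1,\ldots,\ell-1\right\} \] when $m$ is odd. -/

import Mathlib

open Module

noncomputable section

universe u v

/-- The symmetric algebra `S = S(V*)` of the dual of `V`: the ring of polynomial functions. -/
abbrev PolyRing (K : Type u) [Field K] (V : Type v) [AddCommGroup V] [Module K V] :=
  SymmetricAlgebra K (Dual K V)

/-- A linear form on `V`, viewed as an element of `S = S(V*)`. -/
abbrev linForm {K : Type u} [Field K] {V : Type v} [AddCommGroup V] [Module K V]
    (α : Dual K V) : PolyRing K V :=
  SymmetricAlgebra.ι K (Dual K V) α

/-- The `S`-module `Der(S)` of `K`-derivations of `S`. -/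
abbrev Der (K : Type u) [Field K] (V : Type v) [AddCommGroup V] [Module K V] :=
  Derivation K (PolyRing K V) (PolyRing K V)

/-- The homogeneous component `S_p` of `S = S(V*)`: the span of all products of `p` linear
forms. -/
def homogeneousPart (K : Type u) [Field K] (V : Type v) [AddCommGroup V] [Module K V] (p : ℕ) :
    Submodule K (PolyRing K V) :=
  LinearMap.range (SymmetricAlgebra.ι K (Dual K V)) ^ p

/-- `θ` is homogeneous of polynomial degree `p`: `θ` maps every linear form into `S_p`
(equivalently, all coefficients of `θ` with respect to the partial derivatives of a coordinate
system lie in `S_p`). -/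
def HasPdeg {K : Type u} [Field K] {V : Type v} [AddCommGroup V] [Module K V]
    (θ : Der K V) (p : ℕ) : Prop :=
  ∀ α : Dual K V, θ (linForm α) ∈ homogeneousPart K V p

/-- `θ` is the constant derivation `∂_v` in the direction `v`. -/
def IsDirectional {K : Type u} [Field K] {V : Type v} [AddCommGroup V] [Module K V]
    (θ : Der K V) (v : V) : Prop :=
  ∀ α : Dual K V, θ (linForm α) = algebraMap K (PolyRing K V) (α v)

/-- A (central) multiarrangement in `V`, i.e. a finite multiset of linear hyperplanes of `V`,
given by its finitely supported multiplicity function. The underlying simple arrangement is the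
set of hyperplanes of positive multiplicity. -/
structure MultiArrangement (K : Type u) [Field K] (V : Type v) [AddCommGroup V]
    [Module K V] where
  mult : Submodule K V →₀ ℕ
  isCoatom_of_mem : ∀ H ∈ mult.support, IsCoatom H

namespace MultiArrangement

variable {K : Type u} [Field K] {V : Type v} [AddCommGroup V] [Module K V]

/-- The underlying simple arrangement. -/
def hyperplanes (A : MultiArrangement K V) : Finset (Submodule K V) :=
  A.mult.support

/-- The empty arrangement in `V`. -/
def empty (K : Type u) [Field K] (V : Type v) [AddCommGroup V] [Module K V] :
    MultiArrangement K V where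
  mult := 0
  isCoatom_of_mem := by simp

/-- The kernel of a nonzero linear form is a hyperplane. -/
theorem isCoatom_ker {α : Dual K V} (hα : α ≠ 0) : IsCoatom (LinearMap.ker α) := by
  exact LinearMap.isCoatom_ker_of_surjective (LinearMap.surjective hα)

/-- The multiarrangement with defining polynomial `∏ i, (α i) ^ (n i)`, for nonzero linear
forms `α i`. -/
def ofForms {ι : Type*} [Fintype ι] (α : ι → Dual K V) (hα : ∀ i, α i ≠ 0) (n : ι → ℕ) :
    MultiArrangement K V where
  mult := ∑ i, Finsupp.single (LinearMap.ker (α i)) (n i)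
  isCoatom_of_mem := by
    intro H hH
    by_contra hc
    rw [Finsupp.mem_support_iff, Finsupp.finsetSum_apply] at hH
    refine hH (Finset.sum_eq_zero fun i _ => Finsupp.single_eq_of_ne ?_)
    rintro rfl
    exact hc (isCoatom_ker (hα i))

/-- The module of derivations
`D(A, ν) = {θ ∈ Der(S) | θ(α_H) ∈ α_H ^ ν(H) S for all H ∈ A}`; the condition does not depend
on the choice of the form `α_H` with kernel `H`. -/
def derivations (A : MultiArrangement K V) : Submodule (PolyRing K V) (Der K V) where
  carrier := {θ | ∀ H ∈ A.hyperplanes, ∀ α : Dual K V, LinearMap.ker α = H →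
    linForm α ^ A.mult H ∣ θ (linForm α)}
  zero_mem' := fun _ _ _ _ => dvd_zero _
  add_mem' := fun h₁ h₂ H hH α hα => dvd_add (h₁ H hH α hα) (h₂ H hH α hα)
  smul_mem' := fun c _ h H hH α hα => Dvd.dvd.mul_left (h H hH α hα) c

/-- `A` is free with multiset of exponents `e`: the `S`-module `D(A, ν)` has a basis of
homogeneous derivations, whose polynomial degrees form the multiset `e`. -/
def IsFreeWithExponents (A : MultiArrangement K V) (e : Multiset ℕ) : Prop :=
  ∃ (n : ℕ) (b : Basis (Fin n) (PolyRing K V) A.derivations) (d : Fin n → ℕ),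
    (∀ i, HasPdeg (b i : Der K V) (d i)) ∧ Finset.univ.val.map d = e

/-- The deletion of one copy of `H₀` from the multiset of hyperplanes; if `H₀` has
multiplicity one, it disappears from the underlying arrangement. -/
def deletion (A : MultiArrangement K V) (H₀ : Submodule K V) : MultiArrangement K V where
  mult := A.mult - Finsupp.single H₀ 1
  isCoatom_of_mem := by
    intro H hH
    refine A.isCoatom_of_mem H ?_
    rw [Finsupp.mem_support_iff] at hH ⊢
    intro h
    exact hH (by rw [Finsupp.tsub_apply, h, Nat.zero_sub])

open Classical in
/-- The localization at a subspace `X`: the hyperplanes of `A` that contain `X`, with their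
multiplicities. -/
def localization (A : MultiArrangement K V) (X : Submodule K V) : MultiArrangement K V where
  mult := A.mult.filter (X ≤ ·)
  isCoatom_of_mem := by
    intro H hH
    rw [Finsupp.support_filter, Finset.mem_filter] at hH
    exact A.isCoatom_of_mem H hH.1

/-- `d` is the Euler multiplicity of the codimension two subspace `Y` with respect to the
hyperplane `H₀ = ker α₀`: the module of derivations of the localization at `Y` has a homogeneous
basis `θ, ψ, D₃, …, D_ℓ` with `θ ∉ α₀ Der(S)`, `ψ ∈ α₀ Der(S)`, the `D_i` constant derivations
along `Y`, and `pdeg θ = d`. -/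
def IsEulerMultiplicity (A : MultiArrangement K V) (H₀ Y : Submodule K V) (d : ℕ) : Prop :=
  ∃ α₀ : Dual K V, LinearMap.ker α₀ = H₀ ∧
  ∃ (n : ℕ) (b : Basis (Fin (n + 2)) (PolyRing K V) (A.localization Y).derivations),
    (HasPdeg (b 0 : Der K V) d ∧ ¬ ∃ η : Der K V, (b 0 : Der K V) = linForm α₀ • η) ∧
    ((∃ p, HasPdeg (b 1 : Der K V) p) ∧ ∃ η : Der K V, (b 1 : Der K V) = linForm α₀ • η) ∧
    ∀ k : Fin n, ∃ v ∈ Y, IsDirectional (b k.succ.succ : Der K V) v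

/-- `R` is the restriction `(A'', ν*)` of `A` to `H₀`: its hyperplanes are the intersections
`H ∩ H₀` with `H ∈ A`, `H ≠ H₀` (as subspaces of `H₀`), and its multiplicity is the Euler
multiplicity. -/
def IsRestriction (A : MultiArrangement K V) (H₀ : Submodule K V)
    (R : MultiArrangement K H₀) : Prop :=
  (∀ Y : Submodule K H₀, Y ∈ R.hyperplanes ↔
    ∃ H ∈ A.hyperplanes, H ≠ H₀ ∧ Y = H.comap H₀.subtype) ∧
  ∀ Y ∈ R.hyperplanes, A.IsEulerMultiplicity H₀ (Y.map H₀.subtype) (R.mult Y)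

end MultiArrangement

/-- The class of inductively free multiarrangements: the smallest class that contains the empty
arrangement in every finite-dimensional space, and that contains `A` as soon as there is a
hyperplane `H₀ ∈ A` such that the deletion and the restriction of `A` with respect to `H₀` are
in the class and the exponents of the restriction form a submultiset of the exponents of the
deletion. -/
inductive IsInductivelyFree {K : Type u} [Field K] :
    ∀ {V : Type v} [AddCommGroup V] [Module K V], MultiArrangement K V → Prop
  | empty {V : Type v} [AddCommGroup V] [Module K V] [FiniteDimensional K V] :
      IsInductivelyFree (MultiArrangement.empty K V)
  | step {V : Type v} [AddCommGroup V] [Module K V] (A : MultiArrangement K V)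
      (H₀ : Submodule K V) (hH₀ : H₀ ∈ A.hyperplanes)
      (R : MultiArrangement K H₀) (hR : A.IsRestriction H₀ R)
      (hdel : IsInductivelyFree (A.deletion H₀)) (hres : IsInductivelyFree R)
      (e' e'' : Multiset ℕ) (he' : (A.deletion H₀).IsFreeWithExponents e')
      (he'' : R.IsFreeWithExponents e'') (hle : e'' ≤ e') :
      IsInductivelyFree A

/-- The reflection representation of type `A_{ℓ-1}`: vectors in `K^ℓ` with coordinate sum
zero. -/
def ReflSpace (K : Type u) [Field K] (ℓ : ℕ) : Submodule K (Fin ℓ → K) :=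
  LinearMap.ker (∑ i, LinearMap.proj i : (Fin ℓ → K) →ₗ[K] K)

/-- The linear form `x_i - x_j` on the reflection representation. -/
def rootForm (K : Type u) [Field K] {ℓ : ℕ} (i j : Fin ℓ) : Dual K (ReflSpace K ℓ) :=
  ((LinearMap.proj i : (Fin ℓ → K) →ₗ[K] K) - LinearMap.proj j) ∘ₗ (ReflSpace K ℓ).subtype

theorem rootForm_ne_zero (K : Type u) [Field K] [CharZero K] {ℓ : ℕ} {i j : Fin ℓ}
    (hij : i < j) : rootForm K i j ≠ 0 := by
  intro h
  have hv : (Pi.single i 1 - Pi.single j 1 : Fin ℓ → K) ∈ ReflSpace K ℓ := by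
    simp [ReflSpace]
  have h2 := LinearMap.congr_fun h ⟨_, hv⟩
  simp [rootForm, hij.ne, hij.ne'] at h2

/-- The multiarrangement `(A; m, q)` of type `A_{ℓ-1}` with defining polynomial
`∏_{2 ≤ j ≤ ℓ} (x_1 - x_j) ^ (m + q) * ∏_{2 ≤ i < j ≤ ℓ} (x_i - x_j) ^ m`.
The coordinate `x_1` has index `0` in `Fin ℓ`. -/
def mixedBraid (K : Type u) [Field K] [CharZero K] (ℓ m q : ℕ) :
    MultiArrangement K (ReflSpace K ℓ) :=
  MultiArrangement.ofForms (ι := {p : Fin ℓ × Fin ℓ // p.1 < p.2})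
    (fun p => rootForm K p.1.1 p.1.2) (fun p => rootForm_ne_zero K p.2)
    (fun p => if (p.1.1 : ℕ) = 0 then m + q else m)

end

/-! ### Polynomial functions, derivations and homogeneous components. -/

section PolynomialFunctions

variable {K : Type*} [Field K] {V : Type*} [AddCommGroup V] [Module K V]
  {W : Type*} [AddCommGroup W] [Module K W]

/-! The proof enlarges the class of multiplicities until it is stable under the deletions and
restrictions that occur. Given weights n i on the indices and a graph G, let the hyperplane x i = x
j carry the multiplicity n i + n j, plus one if ij is an edge (`graphMult`). For even m = 2k the
theorem concerns weight k on every index, increased by q on the first, and the edgeless graph; for m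
= 2k + 1 it concerns the same weights and the complete graph.

Deleting one copy of x a = x c removes the edge ac. Restricting to x a = x c merges c into a: the
weights add, and the merged vertex is joined to the neighbours of either (`IsMergeStep`). The Euler
multiplicities behind this are those of rank two localizations with at most three lines. Such a
localization has a basis of two plane derivations whose degrees add up to the sum of the orders, and
a Wronskian estimate bounds each degree from below; for the multiplicities at hand the bounds leave
only one possibility (`hasEulerPair_of_balanced`).

The exponents follow from an addition theorem (`MultiArrangement.addition`): if the restriction has
exponents e and the deletion has exponents e together with D, where D is the degree of a polynomial
dividing φ(γ) modulo higher order, then adding the hyperplane replaces D by D + 1. For graph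
multiplicities D is the total weight plus the number of common neighbours of a and c.

It remains to choose an order of the edges. A star grows leaf by leaf, each edge without common
neighbours, so that one exponent at a time rises from the total weight N to N + 1. A full star at b
has the same multiplicities as the edgeless graph with the weight of b raised by one, which gives an
induction on N. A clique grows by a cone vertex whose successive edges have 0, 1, 2, ... common
neighbours, so that a single exponent climbs step by step; this produces N + 1, N + 2, .... -/

theorem Der.ext_linForm {θ η : Der K V} (h : ∀ α, θ (linForm α) = η (linForm α)) : θ = η := by
  ext s
  induction s using SymmetricAlgebra.induction with
  | algebraMap r => simp
  | ι α => exact h α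
  | mul a b ha hb => simp [ha, hb]
  | add a b ha hb => simp [ha, hb]

/-- Every linear map from linear forms to polynomials extends to a derivation. -/
theorem Der.exists_of_linearMap (L : Dual K V →ₗ[K] PolyRing K V) :
    ∃ θ : Der K V, ∀ α, θ (linForm α) = L α := by
  let b := Basis.ofVectorSpace K (Dual K V)
  let e := SymmetricAlgebra.equivMvPolynomial b
  let D := MvPolynomial.mkDerivation K (fun i => e (L (b i)))
  let θ : Der K V := Derivation.mk'
    (e.symm.toLinearMap ∘ₗ (D : MvPolynomial _ K →ₗ[K] MvPolynomial _ K) ∘ₗ e.toLinearMap) (by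
      intro s t
      simp)
  refine ⟨θ, fun α => ?_⟩
  have h : (θ : PolyRing K V →ₗ[K] PolyRing K V) ∘ₗ SymmetricAlgebra.ι K (Dual K V) = L := by
    refine b.ext fun i => ?_
    change e.symm (D (e (linForm (b i)))) = L (b i)
    rw [SymmetricAlgebra.equivMvPolynomial_ι_apply, MvPolynomial.mkDerivation_X,
      e.symm_apply_apply]
  exact LinearMap.congr_fun h α

/-- The constant derivation along v recovers the value α v from the polynomial `linForm α`. -/
theorem linForm_injective [FiniteDimensional K V] :
    Function.Injective (linForm : Dual K V → PolyRing K V) := by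
  refine (injective_iff_map_eq_zero (SymmetricAlgebra.ι K (Dual K V))).2 fun α h => ?_
  ext v
  obtain ⟨θ, hθ⟩ := Der.exists_of_linearMap
    ((Algebra.linearMap K (PolyRing K V)) ∘ₗ Dual.eval K V v)
  have := hθ α
  rw [linForm, h, map_zero] at this
  simpa using this.symm

theorem linForm_eq_zero_iff [FiniteDimensional K V] {α : Dual K V} : linForm α = 0 ↔ α = 0 :=
  ⟨fun h => linForm_injective (h.trans (map_zero _).symm), fun h => h ▸ map_zero _⟩

theorem linForm_mem_homogeneousPart (α : Dual K V) : linForm α ∈ homogeneousPart K V 1 := by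
  rw [homogeneousPart, pow_one]
  exact ⟨α, rfl⟩

theorem mul_mem_homogeneousPart {p q : ℕ} {f g : PolyRing K V} (hf : f ∈ homogeneousPart K V p)
    (hg : g ∈ homogeneousPart K V q) : f * g ∈ homogeneousPart K V (p + q) := by
  rw [homogeneousPart, pow_add]
  exact Submodule.mul_mem_mul hf hg

theorem algebraMap_mem_homogeneousPart (c : K) :
    algebraMap K (PolyRing K V) c ∈ homogeneousPart K V 0 := by
  rw [homogeneousPart, pow_zero]
  exact Submodule.algebraMap_mem c

theorem pow_mem_homogeneousPart {p : ℕ} {f : PolyRing K V} (hf : f ∈ homogeneousPart K V p)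
    (k : ℕ) : f ^ k ∈ homogeneousPart K V (p * k) := by
  rw [homogeneousPart, pow_mul]
  exact Submodule.pow_mem_pow _ hf k

theorem linForm_pow_mem_homogeneousPart (α : Dual K V) (k : ℕ) :
    linForm α ^ k ∈ homogeneousPart K V k := by
  simpa using pow_mem_homogeneousPart (linForm_mem_homogeneousPart α) k

theorem prod_mem_homogeneousPart {ι : Type*} (s : Finset ι) (f : ι → PolyRing K V) (d : ι → ℕ)
    (h : ∀ i ∈ s, f i ∈ homogeneousPart K V (d i)) :
    ∏ i ∈ s, f i ∈ homogeneousPart K V (∑ i ∈ s, d i) := by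
  classical
  induction s using Finset.induction_on with
  | empty => simpa using algebraMap_mem_homogeneousPart (V := V) (1 : K)
  | insert i s hi ih =>
    rw [Finset.prod_insert hi, Finset.sum_insert hi]
    exact mul_mem_homogeneousPart (h i (by simp)) (ih fun j hj => h j (by simp [hj]))

theorem mem_homogeneousPart_iff {ι : Type*} (b : Basis ι K (Dual K V)) (p : ℕ) (s : PolyRing K V) :
    s ∈ homogeneousPart K V p ↔ (SymmetricAlgebra.equivMvPolynomial b s).IsHomogeneous p := by
  let e := SymmetricAlgebra.equivMvPolynomial b
  have h1 : (LinearMap.range (SymmetricAlgebra.ι K (Dual K V))).map e.toAlgHom.toLinearMap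
      = MvPolynomial.homogeneousSubmodule ι K 1 := by
    rw [MvPolynomial.homogeneousSubmodule_one_eq_span_X, LinearMap.range_eq_map, ← b.span_eq,
      Submodule.map_span, Submodule.map_span, ← Set.range_comp, ← Set.range_comp]
    congr 2
    ext1 i
    simp [e]
  have h2 : (homogeneousPart K V p).map e.toAlgHom.toLinearMap
      = MvPolynomial.homogeneousSubmodule ι K p := by
    rw [homogeneousPart, Submodule.map_pow, h1, MvPolynomial.homogeneousSubmodule_one_pow]
  rw [← MvPolynomial.mem_homogeneousSubmodule, ← h2, Submodule.mem_map]
  constructor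
  · exact fun h => ⟨s, h, rfl⟩
  · rintro ⟨t, ht, hts⟩
    rwa [← e.injective hts]

/-- The projections of `S` to its homogeneous components. -/
theorem exists_homogeneousComponent (K : Type*) [Field K] (V : Type*) [AddCommGroup V]
    [Module K V] :
    ∃ c : ℕ → PolyRing K V →ₗ[K] PolyRing K V,
      (∀ p s, c p s ∈ homogeneousPart K V p) ∧
      (∀ p, ∀ s ∈ homogeneousPart K V p, c p s = s) ∧
      (∀ p q f, ∀ g ∈ homogeneousPart K V q, c (p + q) (f * g) = c p f * g) ∧
      (∀ p q f, ∀ g ∈ homogeneousPart K V q, p < q → c p (f * g) = 0) := by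
  let b := Basis.ofVectorSpace K (Dual K V)
  let e := SymmetricAlgebra.equivMvPolynomial b
  let := MvPolynomial.gradedAlgebra (σ := Basis.ofVectorSpaceIndex K (Dual K V)) (R := K)
  have hc : ∀ (p : ℕ) (f : MvPolynomial (Basis.ofVectorSpaceIndex K (Dual K V)) K),
      MvPolynomial.homogeneousComponent p f =
      ((DirectSum.decompose (MvPolynomial.homogeneousSubmodule _ K) f p :
        MvPolynomial.homogeneousSubmodule _ K p) : MvPolynomial _ K) := fun p f =>
    (MvPolynomial.decomposition.decompose'_apply f p).symm
  refine ⟨fun p => e.symm.toLinearMap ∘ₗ MvPolynomial.homogeneousComponent p ∘ₗ e.toLinearMap,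
    fun p s => ?_, fun p s hs => ?_, fun p q f g hg => ?_, fun p q f g hg hpq => ?_⟩
  · rw [mem_homogeneousPart_iff b]
    simpa [e] using MvPolynomial.homogeneousComponent_isHomogeneous p (e s)
  · rw [mem_homogeneousPart_iff b] at hs
    simp only [LinearMap.comp_apply, AlgEquiv.toLinearMap_apply]
    rw [MvPolynomial.homogeneousComponent_eq_self hs, e.symm_apply_apply]
  · rw [mem_homogeneousPart_iff b] at hg
    simp only [LinearMap.comp_apply, AlgEquiv.toLinearMap_apply]
    apply e.injective
    simp only [map_mul, AlgEquiv.apply_symm_apply]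
    rw [hc, hc, DirectSum.coe_decompose_mul_add_of_right_mem _ hg]
  · rw [mem_homogeneousPart_iff b] at hg
    simp only [LinearMap.comp_apply, AlgEquiv.toLinearMap_apply]
    apply e.injective
    rw [map_mul, AlgEquiv.apply_symm_apply, map_zero, hc,
      DirectSum.coe_decompose_mul_of_right_mem_of_not_le _ hg (by omega)]

/-- A homogeneous multiple of a nonzero homogeneous polynomial has a homogeneous cofactor. -/
theorem mem_homogeneousPart_of_mul {n q : ℕ} {f g : PolyRing K V}
    (hfg : f * g ∈ homogeneousPart K V (n + q)) (hg : g ∈ homogeneousPart K V q) (hg0 : g ≠ 0) :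
    f ∈ homogeneousPart K V n := by
  obtain ⟨c, hc, hself, hmul, -⟩ := exists_homogeneousComponent K V
  have h := hmul n q f g hg
  rw [hself _ _ hfg] at h
  rw [mul_right_cancel₀ hg0 h]
  exact hc _ _

theorem eq_zero_of_mul_mem_homogeneousPart {n q : ℕ} {f g : PolyRing K V}
    (hfg : f * g ∈ homogeneousPart K V n) (hg : g ∈ homogeneousPart K V q) (hg0 : g ≠ 0)
    (hnq : n < q) : f = 0 := by
  obtain ⟨c, -, hself, -, hlt⟩ := exists_homogeneousComponent K V
  have h := hlt n q f g hg hnq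
  rw [hself _ _ hfg] at h
  exact (mul_eq_zero.1 h).resolve_right hg0

theorem mem_homogeneousPart_zero_iff {f : PolyRing K V} :
    f ∈ homogeneousPart K V 0 ↔ ∃ c, algebraMap K (PolyRing K V) c = f := by
  rw [homogeneousPart, pow_zero, Submodule.mem_one]

/-- The homomorphism of polynomial rings induced by a linear map of linear forms. -/
noncomputable def PolyRing.map (f : Dual K V →ₗ[K] Dual K W) : PolyRing K V →ₐ[K] PolyRing K W :=
  SymmetricAlgebra.lift (SymmetricAlgebra.ι K (Dual K W) ∘ₗ f)

theorem PolyRing.map_linForm (f : Dual K V →ₗ[K] Dual K W) (α : Dual K V) :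
    PolyRing.map f (linForm α) = linForm (f α) := by
  simp [PolyRing.map, linForm]

theorem PolyRing.map_mem_homogeneousPart (f : Dual K V →ₗ[K] Dual K W) {p : ℕ}
    {s : PolyRing K V} (hs : s ∈ homogeneousPart K V p) :
    PolyRing.map f s ∈ homogeneousPart K W p := by
  have h : (homogeneousPart K V p).map (PolyRing.map f).toLinearMap ≤ homogeneousPart K W p := by
    rw [homogeneousPart, Submodule.map_pow, homogeneousPart]
    refine pow_le_pow_left' ?_ p
    rintro _ ⟨_, ⟨α, rfl⟩, rfl⟩
    exact ⟨f α, (PolyRing.map_linForm f α).symm⟩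
  exact h ⟨s, hs, rfl⟩

theorem Dual.mem_span_singleton_of_ker_le {γ α : Dual K V} (h : LinearMap.ker γ ≤ LinearMap.ker α) :
    ∃ c : K, α = c • γ := by
  by_cases hγ : γ = 0
  · refine ⟨0, ?_⟩
    subst hγ
    ext v
    simpa using h (x := v) (by simp)
  · obtain ⟨v, hv⟩ : ∃ v, γ v ≠ 0 := by
      by_contra hc
      push Not at hc
      exact hγ (LinearMap.ext hc)
    refine ⟨α v / γ v, LinearMap.ext fun w => ?_⟩
    have hw : w - (γ w / γ v) • v ∈ LinearMap.ker γ := by simp [hv]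
    have := h hw
    simp only [LinearMap.mem_ker, map_sub, map_smul, smul_eq_mul, sub_eq_zero] at this
    rw [this]
    simp only [LinearMap.smul_apply, smul_eq_mul]
    ring

end PolynomialFunctions

/-! ### Restriction to a hyperplane. -/

section Restriction

variable {K : Type*} [Field K] {V : Type*} [AddCommGroup V] [Module K V]

/-- The restriction of polynomial functions to a subspace. -/
noncomputable def PolyRing.restrict (H : Submodule K V) : PolyRing K V →ₐ[K] PolyRing K H :=
  PolyRing.map H.dualRestrict

theorem PolyRing.restrict_linForm (H : Submodule K V) (α : Dual K V) :
    PolyRing.restrict H (linForm α) = linForm (H.dualRestrict α) :=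
  PolyRing.map_linForm _ _

/-- Extension of linear forms from a subspace to the whole space. -/
theorem Dual.exists_extension (H : Submodule K V) :
    ∃ σ : Dual K H →ₗ[K] Dual K V, ∀ α, H.dualRestrict (σ α) = α := by
  obtain ⟨g, hg⟩ := LinearMap.exists_rightInverse_of_surjective H.dualRestrict
    (LinearMap.range_eq_top.2 Subspace.dualRestrict_surjective)
  exact ⟨g, fun α => LinearMap.congr_fun hg α⟩

theorem PolyRing.exists_restrict_eq_of_mem (H : Submodule K V) {p : ℕ} {t : PolyRing K H}
    (ht : t ∈ homogeneousPart K H p) :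
    ∃ s ∈ homogeneousPart K V p, PolyRing.restrict H s = t := by
  obtain ⟨σ, hσ⟩ := Dual.exists_extension H
  refine ⟨PolyRing.map σ t, PolyRing.map_mem_homogeneousPart σ ht, ?_⟩
  clear ht
  induction t using SymmetricAlgebra.induction with
  | algebraMap r => simp
  | ι α => rw [PolyRing.map_linForm, PolyRing.restrict_linForm, hσ]
  | mul a b ha hb => simp [ha, hb]
  | add a b ha hb => simp [ha, hb]

theorem PolyRing.restrict_surjective (H : Submodule K V) :
    Function.Surjective (PolyRing.restrict H) := by
  obtain ⟨σ, hσ⟩ := Dual.exists_extension H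
  intro t
  refine ⟨PolyRing.map σ t, ?_⟩
  induction t using SymmetricAlgebra.induction with
  | algebraMap r => simp
  | ι α => rw [PolyRing.map_linForm, PolyRing.restrict_linForm, hσ]
  | mul a b ha hb => simp [ha, hb]
  | add a b ha hb => simp [ha, hb]

theorem Dual.exists_sub_eq_smul {H : Submodule K V} {γ : Dual K V} (hγ : LinearMap.ker γ = H)
    {α β : Dual K V} (h : H.dualRestrict α = H.dualRestrict β) : ∃ c : K, α - β = c • γ := by
  refine Dual.mem_span_singleton_of_ker_le ?_
  rw [hγ]
  intro v hv
  have := LinearMap.congr_fun h ⟨v, hv⟩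
  simpa [sub_eq_zero] using this

theorem PolyRing.restrict_eq_zero_iff {H : Submodule K V} {γ : Dual K V}
    (hγ : LinearMap.ker γ = H) {s : PolyRing K V} :
    PolyRing.restrict H s = 0 ↔ linForm γ ∣ s := by
  obtain ⟨σ, hσ⟩ := Dual.exists_extension H
  constructor
  · intro hs
    -- Restricting and then extending back changes s only by a multiple of γ; this holds on
    -- generators and is stable under sums and products.
    have key : ∀ s : PolyRing K V,
        linForm γ ∣ s - PolyRing.map σ (PolyRing.restrict H s) := by
      intro s
      induction s using SymmetricAlgebra.induction with
      | algebraMap r => simp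
      | ι α =>
        rw [PolyRing.restrict_linForm, PolyRing.map_linForm, ← map_sub]
        obtain ⟨c, hc⟩ := Dual.exists_sub_eq_smul hγ (hσ (H.dualRestrict α)).symm
        rw [hc, map_smul, Algebra.smul_def]
        exact Dvd.intro_left _ rfl
      | mul a b ha hb =>
        rw [map_mul, map_mul]
        have : a * b - PolyRing.map σ (PolyRing.restrict H a) * PolyRing.map σ
            (PolyRing.restrict H b) = (a - PolyRing.map σ (PolyRing.restrict H a)) * b +
            PolyRing.map σ (PolyRing.restrict H a) *
              (b - PolyRing.map σ (PolyRing.restrict H b)) := by ring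
        rw [this]
        exact dvd_add (ha.mul_right _) (hb.mul_left _)
      | add a b ha hb =>
        rw [map_add, map_add, add_sub_add_comm]
        exact dvd_add ha hb
    simpa [hs] using key s
  · rintro ⟨t, rfl⟩
    have : H.dualRestrict γ = 0 := by
      ext v
      have : (v : V) ∈ LinearMap.ker γ := hγ.symm ▸ v.2
      simpa using this
    rw [map_mul, PolyRing.restrict_linForm, this, linForm, map_zero, zero_mul]

/-- Restriction identifies the quotient by `linForm γ` with a subring of the polynomial ring of the
hyperplane, which is a domain. -/
theorem linForm_prime {γ : Dual K V} [FiniteDimensional K V] (hγ : γ ≠ 0) :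
    Prime (linForm γ) := by
  refine ⟨fun h => hγ (linForm_eq_zero_iff.1 h), fun h => ?_, fun a b hab => ?_⟩
  · have := (PolyRing.restrict_eq_zero_iff (s := 1) (rfl : LinearMap.ker γ = _)).2 h.dvd
    simp at this
  · rw [← PolyRing.restrict_eq_zero_iff rfl, map_mul, mul_eq_zero] at hab
    rwa [PolyRing.restrict_eq_zero_iff rfl, PolyRing.restrict_eq_zero_iff rfl] at hab

theorem linForm_dvd_linForm_iff [FiniteDimensional K V] {γ α : Dual K V} :
    linForm γ ∣ linForm α ↔ LinearMap.ker γ ≤ LinearMap.ker α := by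
  rw [← PolyRing.restrict_eq_zero_iff rfl, PolyRing.restrict_linForm, linForm_eq_zero_iff]
  constructor
  · intro h v hv
    simpa using LinearMap.congr_fun h ⟨v, hv⟩
  · intro h
    ext v
    simpa using h v.2

/-- A derivation that preserves the ideal of `H` restricts to `H`. -/
theorem Der.exists_restrict {H : Submodule K V} {γ : Dual K V} (hγ : LinearMap.ker γ = H)
    {φ : Der K V} (hφ : linForm γ ∣ φ (linForm γ)) :
    ∃ ρ : Der K H, ∀ α : Dual K V,
      ρ (linForm (H.dualRestrict α)) = PolyRing.restrict H (φ (linForm α)) := by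
  obtain ⟨σ, hσ⟩ := Dual.exists_extension H
  obtain ⟨ρ, hρ⟩ := Der.exists_of_linearMap ((PolyRing.restrict H).toLinearMap ∘ₗ
    (φ : PolyRing K V →ₗ[K] PolyRing K V) ∘ₗ SymmetricAlgebra.ι K (Dual K V) ∘ₗ σ)
  refine ⟨ρ, fun α => ?_⟩
  rw [hρ]
  -- Two extensions of a form on H differ by a multiple of γ, which φ sends into the ideal of H;
  -- hence the choice of σ does not matter.
  obtain ⟨c, hc⟩ := Dual.exists_sub_eq_smul hγ (hσ (H.dualRestrict α)).symm
  have h : PolyRing.restrict H (φ (linForm α - linForm (σ (H.dualRestrict α)))) = 0 := by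
    rw [PolyRing.restrict_eq_zero_iff hγ, ← map_sub, hc, map_smul, Derivation.map_smul,
      Algebra.smul_def]
    exact hφ.mul_left _
  rw [map_sub, map_sub, sub_eq_zero] at h
  exact h.symm

end Restriction

/-! ### Bases of submodules and the exchange of a basis element. -/

section FamiliesOfGenerators

variable {R M ι : Type*} [CommRing R] [AddCommGroup M] [Module R M]

theorem Submodule.exists_basis_of_family {N : Submodule R M} {φ : ι → M} (hmem : ∀ i, φ i ∈ N)
    (hli : LinearIndependent R φ) (hspan : N ≤ Submodule.span R (Set.range φ)) :
    ∃ b : Basis ι R N, ∀ i, (b i : M) = φ i := by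
  refine ⟨Basis.mk (v := fun i => ⟨φ i, hmem i⟩) (LinearIndependent.of_comp N.subtype hli) ?_,
    fun i => by rw [Basis.mk_apply]⟩
  rintro ⟨θ, hθ⟩ -
  have h := hspan hθ
  have hr : Set.range φ = N.subtype '' Set.range (fun i => (⟨φ i, hmem i⟩ : N)) := by
    rw [← Set.range_comp]
    rfl
  rw [hr, Submodule.span_image] at h
  obtain ⟨θ', hθ', heq⟩ := h
  rwa [Subtype.ext (a1 := θ') (a2 := ⟨θ, hθ⟩) heq] at hθ'

variable [Fintype ι]

theorem Submodule.family_of_basis {N : Submodule R M} (b : Basis ι R N) :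
    LinearIndependent R (fun i => (b i : M)) ∧
      ∀ θ ∈ N, ∃ c : ι → R, θ = ∑ i, c i • (b i : M) := by
  refine ⟨b.linearIndependent.map' N.subtype (Submodule.ker_subtype _),
    fun θ hθ => ⟨b.repr ⟨θ, hθ⟩, ?_⟩⟩
  have := congrArg N.subtype (b.sum_repr ⟨θ, hθ⟩)
  rw [map_sum] at this
  simpa using this.symm

theorem sum_subtype_smul_eq {p : ι → Prop} [DecidablePred p] (T : {i // p i} → R) (φ : ι → M) :
    ∑ i, T i • φ i = ∑ i, (if h : p i then T ⟨i, h⟩ else 0) • φ i := by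
  rw [← Finset.sum_subset (Finset.filter_subset p Finset.univ), Finset.sum_subtype _ (p := p)
    (by simp)]
  · exact Finset.sum_congr rfl fun i _ => by rw [dif_pos i.2]
  · intro i _ hi
    rw [dif_neg (by simpa using hi), zero_smul]

variable [DecidableEq ι] {φ ψ : ι → M} {j : ι} {F : ι → R} {g : R}

/-- The passage from φ to ψ is triangular, with diagonal entries 1 and g. -/
theorem linearIndependent_of_exchange [IsDomain R] (hψj : ψ j = g • φ j)
    (hψ : ∀ i, i ≠ j → ψ i = φ i - F i • φ j) (hg0 : g ≠ 0) (hli : LinearIndependent R φ) :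
    LinearIndependent R ψ := by
  rw [Fintype.linearIndependent_iff] at hli ⊢
  intro t ht
  have hsum : ∑ i, t i • ψ i = ∑ i, (if i = j then
      g * t j - ∑ k ∈ Finset.univ.erase j, t k * F k else t i) • φ i := by
    rw [← Finset.add_sum_erase _ _ (Finset.mem_univ j), ← Finset.add_sum_erase _ (fun i =>
      (if i = j then g * t j - ∑ k ∈ Finset.univ.erase j, t k * F k else t i) • φ i)
      (Finset.mem_univ j)]
    rw [if_pos rfl, hψj, sub_smul, Finset.sum_smul, sub_add_eq_add_sub, ← add_sub,
      ← Finset.sum_sub_distrib, smul_smul, mul_comm (t j)]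
    congr 1
    refine Finset.sum_congr rfl fun i hi => ?_
    rw [hψ i (Finset.ne_of_mem_erase hi), if_neg (Finset.ne_of_mem_erase hi), smul_sub, smul_smul]
  rw [hsum] at ht
  have h0 := hli _ ht
  have hne' : ∀ i, i ≠ j → t i = 0 := fun i hi => by simpa [hi] using h0 i
  intro i
  by_cases hi : i = j
  · subst hi
    have := h0 i
    rw [if_pos rfl, Finset.sum_eq_zero (fun k hk => by
      rw [hne' k (Finset.ne_of_mem_erase hk), zero_mul]), sub_zero] at this
    exact (mul_eq_zero.1 this).resolve_left hg0
  · exact hne' i hi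

/-- After subtraction of the ψ i with i ≠ j, a multiple of φ j in N remains; the divisibility by g
makes it a multiple of ψ j. -/
theorem mem_span_of_exchange {N : Submodule R M} (hmem : ∀ i, ψ i ∈ N) (hψj : ψ j = g • φ j)
    (hψ : ∀ i, i ≠ j → ψ i = φ i - F i • φ j) (hdvd : ∀ u, u • φ j ∈ N → g ∣ u)
    {θ : M} (hθ : θ ∈ N) {c : ι → R} (hc : θ = ∑ i, c i • φ i) :
    θ ∈ Submodule.span R (Set.range ψ) := by
  have hspan : ∀ i, ψ i ∈ Submodule.span R (Set.range ψ) := fun i => Submodule.subset_span ⟨i, rfl⟩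
  have hθ' : θ = (c j + ∑ i ∈ Finset.univ.erase j, c i * F i) • φ j +
      ∑ i ∈ Finset.univ.erase j, c i • ψ i := by
    rw [hc, ← Finset.add_sum_erase _ _ (Finset.mem_univ j), add_smul, Finset.sum_smul,
      add_assoc, ← Finset.sum_add_distrib]
    congr 1
    refine Finset.sum_congr rfl fun i hi => ?_
    rw [hψ i (Finset.ne_of_mem_erase hi), smul_sub, smul_smul]
    abel
  obtain ⟨w, hw⟩ := hdvd (c j + ∑ i ∈ Finset.univ.erase j, c i * F i) (by
    rw [eq_sub_of_add_eq hθ'.symm]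
    exact Submodule.sub_mem _ hθ (Submodule.sum_mem _ fun i _ => Submodule.smul_mem _ _ (hmem i)))
  rw [hθ', hw, mul_comm, mul_smul, ← hψj]
  exact Submodule.add_mem _ (Submodule.smul_mem _ _ (hspan j))
    (Submodule.sum_mem _ fun i _ => Submodule.smul_mem _ _ (hspan i))

end FamiliesOfGenerators

/-! ### The addition theorem. -/

section Addition

variable {K : Type*} [Field K] {V : Type*} [AddCommGroup V] [Module K V]

theorem Der.sum_smul_apply {ι : Type*} (s : Finset ι) (c : ι → PolyRing K V) (φ : ι → Der K V)
    (f : PolyRing K V) : (∑ i ∈ s, c i • φ i) f = ∑ i ∈ s, c i * φ i f := by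
  classical
  induction s using Finset.induction_on with
  | empty => simp
  | insert i s hi ih => simp [Finset.sum_insert hi, ih]

/-- Coefficients of a homogeneous derivation in terms of homogeneous derivations can be chosen
such that derivations of larger degree do not occur. -/
theorem HasPdeg.exists_coeff {ι : Type*} [Fintype ι] {χ : ι → Der K V} {e : ι → ℕ}
    (hχ : ∀ j, HasPdeg (χ j) (e j)) {θ : Der K V} {p : ℕ} (hθ : HasPdeg θ p)
    (c : ι → PolyRing K V) (hc : θ = ∑ j, c j • χ j) :
    ∃ c' : ι → PolyRing K V, θ = ∑ j, c' j • χ j ∧ ∀ j, p < e j → c' j = 0 := by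
  classical
  obtain ⟨C, -, hself, hmul, hlt⟩ := exists_homogeneousComponent K V
  -- Since θ and the χ j are homogeneous, each coefficient may be replaced by its component of
  -- degree p - e j, which is absent when e j > p.
  refine ⟨fun j => if e j ≤ p then C (p - e j) (c j) else 0, ?_, fun j hj => if_neg (by omega)⟩
  refine Der.ext_linForm fun α => ?_
  rw [← hself p _ (hθ α), hc, Der.sum_smul_apply, Der.sum_smul_apply, map_sum]
  refine Finset.sum_congr rfl fun j _ => ?_
  split_ifs with h
  · obtain ⟨k, rfl⟩ := Nat.exists_eq_add_of_le' h
    rw [hmul _ _ _ _ (hχ j α), Nat.add_sub_cancel]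
  · rw [hlt _ _ _ _ (hχ j α) (by omega), zero_mul]

/-- Quotients by `linForm γ` are unique, hence linear in α, so they define a derivation. -/
theorem Der.exists_eq_smul [FiniteDimensional K V] {γ : Dual K V} (hγ : γ ≠ 0) {θ : Der K V}
    (h : ∀ α, linForm γ ∣ θ (linForm α)) : ∃ η : Der K V, θ = linForm γ • η := by
  have hne : linForm γ ≠ 0 := (linForm_prime hγ).ne_zero
  choose q hq using h
  let L : Dual K V →ₗ[K] PolyRing K V :=
    { toFun := q
      map_add' := fun α β => by
        apply mul_left_cancel₀ hne
        rw [← hq, mul_add, ← hq, ← hq, linForm, map_add, map_add]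
      map_smul' := fun c α => by
        apply mul_left_cancel₀ hne
        rw [← hq, linForm, map_smul, Derivation.map_smul, hq]
        simp }
  obtain ⟨η, hη⟩ := Der.exists_of_linearMap L
  refine ⟨η, Der.ext_linForm fun α => ?_⟩
  rw [Derivation.smul_apply, smul_eq_mul, hη, hq]
  rfl

theorem MultiArrangement.isFreeWithExponents_of_family {ι : Type*} [Fintype ι]
    {A : MultiArrangement K V} (φ : ι → Der K V) (hmem : ∀ i, φ i ∈ A.derivations)
    (hli : LinearIndependent (PolyRing K V) φ)
    (hspan : A.derivations ≤ Submodule.span (PolyRing K V) (Set.range φ))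
    {d : ι → ℕ} (hd : ∀ i, HasPdeg (φ i) (d i)) {e : Multiset ℕ}
    (he : Finset.univ.val.map d = e) : A.IsFreeWithExponents e := by
  obtain ⟨b, hb⟩ := Submodule.exists_basis_of_family hmem hli hspan
  let ε := Fintype.equivFin ι
  refine ⟨Fintype.card ι, b.reindex ε, d ∘ ε.symm, fun i => ?_, ?_⟩
  · rw [Basis.reindex_apply, hb]
    exact hd (ε.symm i)
  · rw [← he, ← Multiset.map_map]
    congr 1
    simp

theorem MultiArrangement.IsFreeWithExponents.exists_family {A : MultiArrangement K V}
    {e : Multiset ℕ} (h : A.IsFreeWithExponents e) :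
    ∃ (n : ℕ) (φ : Fin n → Der K V) (d : Fin n → ℕ), (∀ i, φ i ∈ A.derivations) ∧
      LinearIndependent (PolyRing K V) φ ∧
      (∀ θ ∈ A.derivations, ∃ c : Fin n → PolyRing K V, θ = ∑ i, c i • φ i) ∧
      (∀ i, HasPdeg (φ i) (d i)) ∧ Finset.univ.val.map d = e := by
  obtain ⟨n, b, d, hd, he⟩ := h
  obtain ⟨hli, hspan⟩ := Submodule.family_of_basis b
  exact ⟨n, fun i => b i, d, fun i => (b i).2, hli, hspan, hd, he⟩

/-- The additional exponent D gives the deletion strictly more basis elements of degree at most D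
than the restriction has. This count forces the linear relation used in `false_of_low_degree_mem`.
-/
theorem card_filter_le_of_map_eq_cons {m n : ℕ} {d : Fin n → ℕ} {e : Fin m → ℕ} {D : ℕ}
    (h : Finset.univ.val.map d = D ::ₘ Finset.univ.val.map e) :
    Fintype.card {j // e j ≤ D} < Fintype.card {i // d i ≤ D} := by
  have h2 := congrArg (Multiset.countP (· ≤ D)) h
  rw [Multiset.countP_cons_of_pos (p := (· ≤ D)) _ (le_refl D), Multiset.countP_map, Multiset.countP_map,
    ← Finset.filter_val, ← Finset.filter_val] at h2
  rw [Fintype.card_subtype, Fintype.card_subtype]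
  simp only [Finset.card_def]
  omega

/-- If all derivations of small degree in a basis of the deletion are tangent to higher order,
their restrictions are too many to be independent. -/
theorem false_of_low_degree_mem [FiniteDimensional K V] {H : Submodule K V} {γ : Dual K V}
    (hγ0 : γ ≠ 0) (hγ : LinearMap.ker γ = H)
    {A A' : MultiArrangement K V} {R : MultiArrangement K H}
    (htan : ∀ φ ∈ A.derivations, linForm γ ∣ φ (linForm γ))
    (hsmul : ∀ η, linForm γ • η ∈ A.derivations → η ∈ A'.derivations)
    (hρ : ∀ φ ∈ A.derivations, ∀ ρ : Der K H, (∀ α : Dual K V,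
      ρ (linForm (H.dualRestrict α)) = PolyRing.restrict H (φ (linForm α))) → ρ ∈ R.derivations)
    {n m : ℕ} {φ : Fin n → Der K V} {d : Fin n → ℕ} {χ : Fin m → Der K H} {e : Fin m → ℕ} {D : ℕ}
    (hli : LinearIndependent (PolyRing K V) φ)
    (hspan : ∀ θ ∈ A'.derivations, ∃ c : Fin n → PolyRing K V, θ = ∑ i, c i • φ i)
    (hd : ∀ i, HasPdeg (φ i) (d i)) (he : ∀ j, HasPdeg (χ j) (e j))
    (hχspan : ∀ θ ∈ R.derivations, ∃ c : Fin m → PolyRing K H, θ = ∑ i, c i • χ i)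
    (hde : Finset.univ.val.map d = D ::ₘ Finset.univ.val.map e)
    (hlow : ∀ i, d i ≤ D → φ i ∈ A.derivations) : False := by
  classical
  -- The low-degree basis elements restrict to H, and for degree reasons only those χ j with e j ≤ D
  -- occur in their restrictions.
  have hex : ∀ i : {i // d i ≤ D}, ∃ (ρ : Der K H) (c : Fin m → PolyRing K H),
      (∀ α : Dual K V,
        ρ (linForm (H.dualRestrict α)) = PolyRing.restrict H (φ i (linForm α))) ∧
      ρ = ∑ j, c j • χ j ∧ ∀ j, D < e j → c j = 0 := by
    rintro ⟨i, hi⟩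
    obtain ⟨ρ, hρi⟩ := Der.exists_restrict hγ (htan _ (hlow i hi))
    obtain ⟨c, hc⟩ := hχspan ρ (hρ _ (hlow i hi) ρ hρi)
    have hdeg : HasPdeg ρ (d i) := by
      intro α
      obtain ⟨σ, hσ⟩ := Dual.exists_extension H
      rw [← hσ α, hρi]
      exact PolyRing.map_mem_homogeneousPart _ (hd i _)
    obtain ⟨c', hc', hz⟩ := HasPdeg.exists_coeff he hdeg c hc
    exact ⟨ρ, c', hρi, hc', fun j hj => hz j (by omega)⟩
  choose ρ c hρc hsum hzero using hex
  let C : Matrix {i // d i ≤ D} {j // e j ≤ D} (PolyRing K H) := fun i j => c i j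
  -- C has more rows than columns, so some nonzero t annihilates it from the left.
  have hninj : ¬ Function.Injective C.vecMulLinear := fun hinj =>
    absurd (card_le_of_injective (PolyRing K H) _ hinj)
      (not_le.2 (card_filter_le_of_map_eq_cons hde))
  rw [← LinearMap.ker_eq_bot, Submodule.eq_bot_iff] at hninj
  push Not at hninj
  obtain ⟨t, ht, ht0⟩ := hninj
  have htC : ∀ j, ∑ i, t i * c i j = 0 := by
    intro j
    by_cases hj : e j ≤ D
    · exact congrFun ht ⟨j, hj⟩
    · exact Finset.sum_eq_zero fun i _ => by rw [hzero i j (by omega), mul_zero]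
  have htρ : ∑ i, t i • ρ i = 0 := by
    have : ∀ i, t i • ρ i = ∑ j, (t i * c i j) • χ j := fun i => by
      conv_lhs => rw [hsum i]
      rw [Finset.smul_sum]
      exact Finset.sum_congr rfl fun j _ => by rw [smul_smul]
    simp_rw [this]
    rw [Finset.sum_comm]
    simp_rw [← Finset.sum_smul, htC]
    simp
  -- Lift t to V. The combination of the φ i vanishes on H, so it equals γ η with η in D(A').
  -- Expanding η in the basis φ shows that γ divides every T i, so t = 0.
  choose T hT using fun i => PolyRing.restrict_surjective H (t i)
  have hdvd : ∀ α, linForm γ ∣ (∑ i, T i • φ i) (linForm α) := by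
    intro α
    rw [← PolyRing.restrict_eq_zero_iff hγ, Der.sum_smul_apply, map_sum]
    have := congrArg (fun θ : Der K H => θ (linForm (H.dualRestrict α))) htρ
    simp only [Der.sum_smul_apply] at this
    simpa [hT, hρc] using this
  obtain ⟨η, hη⟩ := Der.exists_eq_smul hγ0 hdvd
  have hηA : η ∈ A'.derivations := by
    apply hsmul
    rw [← hη]
    exact Submodule.sum_mem _ fun i _ => Submodule.smul_mem _ _ (hlow i i.2)
  obtain ⟨u, hu⟩ := hspan η hηA
  have hT' : ∑ i, T i • φ i = ∑ i, (if h : d i ≤ D then T ⟨i, h⟩ else 0) • φ i := by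
    exact sum_subtype_smul_eq T φ
  rw [hT', hu, Finset.smul_sum] at hη
  simp_rw [smul_smul] at hη
  have hcoef := fun i => (Fintype.linearIndependent_iffₛ.1 hli _ _ hη) i
  apply ht0
  ext1 i
  have := hcoef i
  rw [dif_pos i.2] at this
  rw [← hT i, show T i = _ from this, Pi.zero_apply, PolyRing.restrict_eq_zero_iff hγ]
  exact Dvd.intro _ rfl

/-- The addition theorem. The hypotheses relate a multiarrangement `A`, its deletion `A'` and its
restriction `R` to the hyperplane `H = ker γ`. -/
theorem MultiArrangement.addition [FiniteDimensional K V] {H : Submodule K V} {γ : Dual K V}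
    (hγ0 : γ ≠ 0) (hγ : LinearMap.ker γ = H)
    {A A' : MultiArrangement K V} {R : MultiArrangement K H} {s : ℕ}
    (hA' : ∀ φ ∈ A'.derivations, linForm γ ^ s ∣ φ (linForm γ))
    (hA : ∀ φ, φ ∈ A.derivations ↔ φ ∈ A'.derivations ∧ linForm γ ^ (s + 1) ∣ φ (linForm γ))
    (hsmul : ∀ η, linForm γ • η ∈ A.derivations → η ∈ A'.derivations)
    (hρ : ∀ φ ∈ A.derivations, ∀ ρ : Der K H, (∀ α : Dual K V,
      ρ (linForm (H.dualRestrict α)) = PolyRing.restrict H (φ (linForm α))) → ρ ∈ R.derivations)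
    {B : PolyRing K H} {b : ℕ} (hB : B ∈ homogeneousPart K H b) (hB0 : B ≠ 0)
    (hBdvd : ∀ φ ∈ A'.derivations, ∀ h, φ (linForm γ) = linForm γ ^ s * h →
      B ∣ PolyRing.restrict H h)
    {e'' : Multiset ℕ} (he' : A'.IsFreeWithExponents ((s + b) ::ₘ e''))
    (he'' : R.IsFreeWithExponents e'') : A.IsFreeWithExponents ((s + b + 1) ::ₘ e'') := by
  classical
  have hne : linForm γ ≠ 0 := (linForm_prime hγ0).ne_zero
  obtain ⟨n, φ, d, hφ, hli, hspan, hd, hde⟩ := he'.exists_family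
  obtain ⟨m, χ, e, -, -, hχspan, he, hee⟩ := he''.exists_family
  choose h hh using fun i => hA' (φ i) (hφ i)
  -- The polynomial f i is the obstruction to φ i lying in D(A): writing φ i (γ) = γ ^ s * h i, one
  -- has B * f i for the restriction of h i to H.
  choose f hf using fun i => hBdvd (φ i) (hφ i) (h i) (hh i)
  have hmemA : ∀ i, f i = 0 → φ i ∈ A.derivations := by
    intro i hi
    refine (hA _).2 ⟨hφ i, ?_⟩
    have := hf i
    rw [hi, mul_zero, PolyRing.restrict_eq_zero_iff hγ] at this
    rw [hh, pow_succ]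
    exact mul_dvd_mul_left _ this
  -- The product B * f i would have degree d i - s < b, which is below the degree of B.
  have hflt : ∀ i, d i < s + b → f i = 0 := by
    intro i hi
    have h1 := hd i γ
    rw [hh, mul_comm] at h1
    by_cases hs : d i < s
    · have h0 := eq_zero_of_mul_mem_homogeneousPart h1 (linForm_pow_mem_homogeneousPart γ s)
        (pow_ne_zero _ hne) hs
      have := hf i
      rw [h0, map_zero] at this
      exact (mul_eq_zero.1 this.symm).resolve_left hB0
    · obtain ⟨k, hk⟩ := Nat.exists_eq_add_of_le' (not_lt.1 hs)
      rw [hk] at h1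
      have h2 := PolyRing.map_mem_homogeneousPart H.dualRestrict
        (mem_homogeneousPart_of_mul h1 (linForm_pow_mem_homogeneousPart γ s) (pow_ne_zero _ hne))
      change PolyRing.restrict H (h i) ∈ _ at h2
      rw [hf, mul_comm] at h2
      exact eq_zero_of_mul_mem_homogeneousPart h2 hB hB0 (by omega)
  have hfge : ∀ i k, d i = k + (s + b) → f i ∈ homogeneousPart K H k := by
    intro i k hk
    have h1 := hd i γ
    rw [hh, mul_comm, hk, ← add_assoc, add_right_comm] at h1
    have h2 := PolyRing.map_mem_homogeneousPart H.dualRestrict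
      (mem_homogeneousPart_of_mul h1 (linForm_pow_mem_homogeneousPart γ s) (pow_ne_zero _ hne))
    change PolyRing.restrict H (h i) ∈ _ at h2
    rw [hf, mul_comm] at h2
    exact mem_homogeneousPart_of_mul h2 hB hB0
  -- Otherwise every basis element of degree at most s + b would be unobstructed and lie in D(A).
  obtain ⟨j, hj, hfj⟩ : ∃ j, d j = s + b ∧ f j ≠ 0 := by
    by_contra hcon
    push Not at hcon
    refine false_of_low_degree_mem hγ0 hγ (A := A) (A' := A') (R := R) (fun φ hφ =>
      (dvd_pow_self _ (by omega)).trans ((hA φ).1 hφ).2) hsmul hρ hli hspan hd he hχspan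
      (D := s + b) (by rw [hde, hee]) fun i hi => hmemA i ?_
    rcases hi.lt_or_eq with hi | hi
    · exact hflt i hi
    · exact hcon i hi
  -- In degree exactly s + b the obstruction f j is a nonzero constant, so it can eliminate all the
  -- others: F i lifts f i / f j to V.
  obtain ⟨c, hc⟩ := mem_homogeneousPart_zero_iff.1 (hfge j 0 (by omega))
  have hc0 : c ≠ 0 := by
    rintro rfl
    exact hfj (by rw [← hc, map_zero])
  have hF : ∀ i, ∃ F : PolyRing K V, PolyRing.restrict H F * f j = f i ∧
      ∀ α, F * φ j (linForm α) ∈ homogeneousPart K V (d i) := by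
    intro i
    by_cases hi : d i < s + b
    · exact ⟨0, by rw [hflt i hi]; simp, fun α => by rw [zero_mul]; exact Submodule.zero_mem _⟩
    · obtain ⟨k, hk⟩ := Nat.exists_eq_add_of_le' (not_lt.1 hi)
      obtain ⟨F, hF, hF'⟩ := PolyRing.exists_restrict_eq_of_mem H
        (Submodule.smul_mem _ c⁻¹ (hfge i k hk))
      refine ⟨F, ?_, fun α => ?_⟩
      · rw [hF', ← hc, Algebra.smul_def, mul_right_comm, ← map_mul, inv_mul_cancel₀ hc0, map_one,
          one_mul]
      · rw [hk, ← hj]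
        exact mul_mem_homogeneousPart hF (hd j α)
  choose F hF hFdeg using hF
  let ψ : Fin n → Der K V := fun i => if i = j then linForm γ • φ j else φ i - F i • φ j
  have hψj : ψ j = linForm γ • φ j := if_pos rfl
  have hψ : ∀ i, i ≠ j → ψ i = φ i - F i • φ j := fun i hi => if_neg hi
  have hψmem : ∀ i, ψ i ∈ A.derivations := by
    intro i
    by_cases hi : i = j
    · subst hi
      rw [hψj, hA]
      refine ⟨Submodule.smul_mem _ _ (hφ i), ?_⟩
      rw [Derivation.smul_apply, smul_eq_mul, pow_succ, mul_comm]
      exact mul_dvd_mul_left _ (hA' _ (hφ i))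
    · rw [hψ i hi, hA]
      refine ⟨Submodule.sub_mem _ (hφ i) (Submodule.smul_mem _ _ (hφ j)), ?_⟩
      have : (φ i - F i • φ j) (linForm γ) = linForm γ ^ s * (h i - F i * h j) := by
        rw [Derivation.sub_apply, Derivation.smul_apply, smul_eq_mul, hh, hh]
        ring
      rw [this, pow_succ]
      refine mul_dvd_mul_left _ ?_
      rw [← PolyRing.restrict_eq_zero_iff hγ, map_sub, map_mul, hf, hf, ← hF i]
      ring
  refine isFreeWithExponents_of_family ψ (d := fun i => if i = j then s + b + 1 else d i)
    hψmem ?_ ?_ ?_ ?_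
  · exact linearIndependent_of_exchange hψj hψ hne hli
  · intro θ hθ
    obtain ⟨c', hc'⟩ := hspan θ ((hA θ).1 hθ).1
    -- If u • φ j lies in D(A), then u times the obstruction vanishes on H; as B and f j are
    -- nonzero, γ divides u.
    refine mem_span_of_exchange hψmem hψj hψ (fun u hu => ?_) hθ hc'
    have h1 := ((hA _).1 hu).2
    rw [Derivation.smul_apply, smul_eq_mul, hh, mul_left_comm, pow_succ,
      mul_dvd_mul_iff_left (pow_ne_zero _ hne), ← PolyRing.restrict_eq_zero_iff hγ, map_mul, hf,
      mul_eq_zero, mul_eq_zero] at h1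
    rw [← PolyRing.restrict_eq_zero_iff hγ]
    tauto
  · intro i
    by_cases hi : i = j
    · subst hi
      intro α
      rw [hψj, if_pos rfl, ← hj, add_comm]
      exact mul_mem_homogeneousPart (linForm_mem_homogeneousPart γ) (hd i α)
    · rw [hψ i hi, if_neg hi]
      exact fun α => Submodule.sub_mem _ (hd i α) (hFdeg i α)
  · have h1 : (Finset.univ : Finset (Fin n)).val = j ::ₘ (Finset.univ.erase j).val := by
      rw [Finset.erase_val, Multiset.cons_erase (Finset.mem_univ j)]
    rw [h1, Multiset.map_cons, hj] at hde
    rw [h1, Multiset.map_cons, if_pos rfl, ← Multiset.cons_inj_right (s + b) |>.1 hde]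
    congr 1
    refine Multiset.map_congr rfl fun i hi => ?_
    rw [if_neg (Finset.ne_of_mem_erase (s := Finset.univ) hi)]

end Addition

/-! ### Derivations of the plane tangent to three lines. -/

section BinaryForms

open MvPolynomial

theorem MvPolynomial.IsHomogeneous.of_mul_right {σ R : Type*} [CommRing R] [IsDomain R]
    {f g : MvPolynomial σ R} {n q : ℕ} (hfg : (f * g).IsHomogeneous (n + q))
    (hg : g.IsHomogeneous q) (hg0 : g ≠ 0) : f.IsHomogeneous n := by
  let := MvPolynomial.gradedAlgebra (σ := σ) (R := R)
  have h := DirectSum.coe_decompose_mul_add_of_right_mem (homogeneousSubmodule σ R) (i := n)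
    (a := f) (b := g) hg
  rw [DirectSum.decompose_of_mem_same _ (show f * g ∈ homogeneousSubmodule σ R (n + q) from hfg)]
    at h
  rw [mul_right_cancel₀ hg0 h]
  exact (DirectSum.decompose (homogeneousSubmodule σ R) f n).2

theorem MvPolynomial.IsHomogeneous.eq_zero_of_mul_right {σ R : Type*} [CommRing R] [IsDomain R]
    {f g : MvPolynomial σ R} {n q : ℕ} (hfg : (f * g).IsHomogeneous n)
    (hg : g.IsHomogeneous q) (hg0 : g ≠ 0) (hnq : n < q) : f = 0 := by
  let := MvPolynomial.gradedAlgebra (σ := σ) (R := R)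
  have h := DirectSum.coe_decompose_mul_of_right_mem_of_not_le (homogeneousSubmodule σ R)
    (a := f) hg (n := n) (by omega)
  rw [DirectSum.decompose_of_mem_same _ (show f * g ∈ homogeneousSubmodule σ R n from hfg)] at h
  exact (mul_eq_zero.1 h).resolve_right hg0

theorem MvPolynomial.IsHomogeneous.eq_add_of_mem_support {R : Type*} [CommRing R]
    {f : MvPolynomial (Fin 2) R} {k : ℕ} (hf : f.IsHomogeneous k) {m : Fin 2 →₀ ℕ}
    (hm : m ∈ f.support) : k = m 0 + m 1 := by
  have h : k = m.degree := hf.degree_eq_sum_deg_support hm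
  rwa [Finsupp.degree_eq_sum, Fin.sum_univ_two] at h

variable {K : Type*} [Field K]

/-- The sum of the two coordinates of the plane. -/
noncomputable abbrev coordSum (K : Type*) [Field K] : MvPolynomial (Fin 2) K := X 0 + X 1

theorem coordSum_isHomogeneous : (coordSum K).IsHomogeneous 1 :=
  (isHomogeneous_X K 0).add (isHomogeneous_X K 1)

theorem coordSum_ne_zero : coordSum K ≠ 0 := by
  intro h
  have := congrArg (eval ![1, 0]) h
  simp at this

/-- Modulo `x + y`, a binary form is a multiple of a power of `x`. -/
theorem exists_coordSum_dvd_sub {h : MvPolynomial (Fin 2) K} {k : ℕ} (hh : h.IsHomogeneous k) :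
    ∃ c : K, coordSum K ∣ h - C c * X 0 ^ k := by
  -- Modulo x + y one has y = -x, whence the scalar (-1) ^ j.
  have key : ∀ j : ℕ, ∃ c : K, coordSum K ∣ X 1 ^ j - C c * X 0 ^ j := fun j => by
    refine ⟨(-1) ^ j, ?_⟩
    have : (C ((-1) ^ j) * X 0 ^ j : MvPolynomial (Fin 2) K) = (- X 0) ^ j := by
      rw [neg_pow (X 0 : MvPolynomial (Fin 2) K), map_pow, map_neg, map_one]
    rw [this]
    have h2 := sub_dvd_pow_sub_pow (X 1 : MvPolynomial (Fin 2) K) (- X 0) j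
    rwa [sub_neg_eq_add, add_comm] at h2
  choose c hc using key
  refine ⟨∑ m ∈ h.support, coeff m h * c (m 1), ?_⟩
  have hsum : h - C (∑ m ∈ h.support, coeff m h * c (m 1)) * X 0 ^ k =
      ∑ m ∈ h.support, C (coeff m h) * X 0 ^ m 0 * (X 1 ^ m 1 - C (c (m 1)) * X 0 ^ m 1) := by
    nth_rewrite 1 [h.as_sum]
    rw [map_sum, Finset.sum_mul, ← Finset.sum_sub_distrib]
    · refine Finset.sum_congr rfl fun m hm => ?_
      have hk : m 0 + m 1 = k := by
        exact (hh.eq_add_of_mem_support hm).symm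
      rw [monomial_eq, Finsupp.prod_fintype _ _ (by simp), Fin.prod_univ_two, ← hk, map_mul]
      ring
  rw [hsum]
  exact Finset.dvd_sum fun m _ => (hc _).mul_left _

/-- A homogeneous derivation `f ∂_x + g ∂_y` of the plane with prescribed orders of tangency along
the lines `x = 0`, `y = 0` and `x + y = 0`. -/
structure IsPlaneDerivation (p q r d : ℕ) (f g : MvPolynomial (Fin 2) K) : Prop where
  homogeneous_left : f.IsHomogeneous d
  homogeneous_right : g.IsHomogeneous d
  dvd_left : X 0 ^ p ∣ f
  dvd_right : X 1 ^ q ∣ g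
  dvd_add : coordSum K ^ r ∣ f + g

theorem IsPlaneDerivation.mono {p q r d p' q' r' : ℕ} {f g : MvPolynomial (Fin 2) K}
    (h : IsPlaneDerivation p q r d f g) (hp : p' ≤ p) (hq : q' ≤ q) (hr : r' ≤ r) :
    IsPlaneDerivation p' q' r' d f g :=
  ⟨h.1, h.2, (pow_dvd_pow _ hp).trans h.3, (pow_dvd_pow _ hq).trans h.4,
    (pow_dvd_pow _ hr).trans h.5⟩

theorem IsPlaneDerivation.coordSum_smul {p q r d : ℕ} {f g : MvPolynomial (Fin 2) K}
    (h : IsPlaneDerivation p q r d f g) :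
    IsPlaneDerivation p q (r + 1) (1 + d) (coordSum K * f) (coordSum K * g) :=
  ⟨coordSum_isHomogeneous.mul h.1, coordSum_isHomogeneous.mul h.2, h.3.mul_left _, h.4.mul_left _,
    by rw [← mul_add, pow_succ']; exact mul_dvd_mul_left _ h.5⟩

/-- Modulo x + y, the cofactor of (x + y) ^ r in f + g is a form of degree d - r, hence a scalar
times x ^ (d - r). For d < r it is zero, and c = 0 makes the truncated exponent harmless. -/
theorem IsPlaneDerivation.exists_coeff {p q r d : ℕ} {f g : MvPolynomial (Fin 2) K}
    (h : IsPlaneDerivation p q r d f g) :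
    ∃ c : K, coordSum K ^ (r + 1) ∣ f + g - coordSum K ^ r * (C c * X 0 ^ (d - r)) ∧
      (c ≠ 0 → r ≤ d) := by
  obtain ⟨t, ht⟩ := h.dvd_add
  have hfg := h.homogeneous_left.add h.homogeneous_right
  have hz : (coordSum K ^ r).IsHomogeneous r := by simpa using coordSum_isHomogeneous.pow r
  rw [ht, mul_comm] at hfg
  rcases lt_or_ge d r with hd | hd
  · refine ⟨0, ?_, by simp⟩
    rw [ht, hfg.eq_zero_of_mul_right hz (pow_ne_zero _ coordSum_ne_zero) hd]
    simp
  · obtain ⟨k, rfl⟩ := Nat.exists_eq_add_of_le' hd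
    obtain ⟨c, hc⟩ := exists_coordSum_dvd_sub
      (hfg.of_mul_right hz (pow_ne_zero _ coordSum_ne_zero))
    refine ⟨c, ?_, fun _ => hd⟩
    rw [ht, ← mul_sub, pow_succ, Nat.add_sub_cancel]
    exact mul_dvd_mul_left _ hc

/-- A basis of the plane derivations with orders of tangency `p`, `q`, `s` such that the first
basis element, of degree `d`, has order of tangency `s + 1` along `x + y = 0`. -/
def HasEulerPair (K : Type*) [Field K] (p q s d : ℕ) : Prop :=
  ∃ (e : ℕ) (f₁ g₁ f₂ g₂ : MvPolynomial (Fin 2) K) (c : K), c ≠ 0 ∧ d + e = p + q + s ∧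
    IsPlaneDerivation p q (s + 1) d f₁ g₁ ∧ IsPlaneDerivation p q s e f₂ g₂ ∧
    f₁ * g₂ - f₂ * g₁ = C c * (X 0 ^ p * X 1 ^ q * coordSum K ^ s)

/-- A homogeneous basis of the plane derivations with orders of tangency `p`, `q`, `r`. -/
def HasFreePair (K : Type*) [Field K] (p q r : ℕ) : Prop :=
  ∃ (d e : ℕ) (f₁ g₁ f₂ g₂ : MvPolynomial (Fin 2) K) (c : K), c ≠ 0 ∧ d + e = p + q + r ∧
    IsPlaneDerivation p q r d f₁ g₁ ∧ IsPlaneDerivation p q r e f₂ g₂ ∧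
    f₁ * g₂ - f₂ * g₁ = C c * (X 0 ^ p * X 1 ^ q * coordSum K ^ r)

theorem HasEulerPair.hasFreePair {p q s d : ℕ} (h : HasEulerPair K p q s d) :
    HasFreePair K p q (s + 1) := by
  obtain ⟨e, f₁, g₁, f₂, g₂, c, hc, hde, h₁, h₂, hdet⟩ := h
  refine ⟨d, 1 + e, f₁, g₁, _, _, c, hc, by omega, h₁, h₂.coordSum_smul, ?_⟩
  linear_combination coordSum K * hdet

theorem hasFreePair_zero (p q : ℕ) : HasFreePair K p q 0 := by
  refine ⟨p, q, X 0 ^ p, 0, 0, X 1 ^ q, 1, one_ne_zero, rfl, ⟨?_, ?_, ?_, ?_, ?_⟩,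
    ⟨?_, ?_, ?_, ?_, ?_⟩, ?_⟩ <;> simp [isHomogeneous_X_pow, isHomogeneous_zero]

/-- The scalar of `IsPlaneDerivation.exists_coeff` obstructs a higher order of tangency along x + y
= 0. If the pair of smaller degree is obstructed, a multiple of it by a power of x removes the
obstruction of the other pair; if not, it can be used as it stands. -/
theorem HasFreePair.exists_hasEulerPair {p q s : ℕ} (h : HasFreePair K p q s) :
    ∃ d, HasEulerPair K p q s d := by
  obtain ⟨d, e, f₁, g₁, f₂, g₂, c, hc, hde, h₁, h₂, hdet⟩ := h
  wlog hle : d ≤ e generalizing d e f₁ g₁ f₂ g₂ c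
  · refine this e d f₂ g₂ f₁ g₁ (-c) (neg_ne_zero.2 hc) (by omega) h₂ h₁ ?_ (by omega)
    rw [map_neg]
    linear_combination -hdet
  obtain ⟨c₁, hc₁, hd⟩ := h₁.exists_coeff
  obtain ⟨c₂, hc₂, -⟩ := h₂.exists_coeff
  by_cases hc0 : c₁ = 0
  · subst hc0
    refine ⟨d, e, f₁, g₁, f₂, g₂, c, hc, hde, ⟨h₁.1, h₁.2, h₁.3, h₁.4, ?_⟩, h₂, hdet⟩
    simpa using hc₁
  · have hsd := hd hc0
    have hX : (C (c₂ / c₁) * X 0 ^ (e - d) : MvPolynomial (Fin 2) K).IsHomogeneous (e - d) :=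
      isHomogeneous_C_mul_X_pow _ _ _
    have hed : e - d + d = e := by omega
    refine ⟨e, d, f₂ - C (c₂ / c₁) * X 0 ^ (e - d) * f₁, g₂ - C (c₂ / c₁) * X 0 ^ (e - d) * g₁,
      f₁, g₁, -c, neg_ne_zero.2 hc, by omega,
      ⟨h₂.1.sub (hed ▸ hX.mul h₁.1), h₂.2.sub (hed ▸ hX.mul h₁.2), dvd_sub h₂.3 (h₁.3.mul_left _),
        dvd_sub h₂.4 (h₁.4.mul_left _), ?_⟩, h₁, ?_⟩
    · have hsplit : e - s = (e - d) + (d - s) := by omega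
      have hcc : (C c₂ : MvPolynomial (Fin 2) K) = C (c₂ / c₁) * C c₁ := by
        rw [← C_mul, div_mul_cancel₀ _ hc0]
      have : f₂ - C (c₂ / c₁) * X 0 ^ (e - d) * f₁ + (g₂ - C (c₂ / c₁) * X 0 ^ (e - d) * g₁) =
          (f₂ + g₂ - coordSum K ^ s * (C c₂ * X 0 ^ (e - s))) - C (c₂ / c₁) * X 0 ^ (e - d) *
            (f₁ + g₁ - coordSum K ^ s * (C c₁ * X 0 ^ (d - s))) := by
        rw [hsplit, pow_add, hcc]
        ring
      rw [this]
      exact dvd_sub hc₂ (hc₁.mul_left _)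
    · rw [map_neg]
      linear_combination -hdet

theorem hasFreePair (p q r : ℕ) : HasFreePair K p q r := by
  induction r with
  | zero => exact hasFreePair_zero p q
  | succ r ih => exact ih.exists_hasEulerPair.choose_spec.hasFreePair

theorem exists_hasEulerPair (p q s : ℕ) : ∃ d, HasEulerPair K p q s d :=
  (hasFreePair p q s).exists_hasEulerPair

/-- The pair (x ^ p, -x ^ p) has sum zero, so it is tangent to x + y = 0 to every order. This is the
case of a localization with only two lines. -/
theorem hasEulerPair_zero_right (p s : ℕ) : HasEulerPair K p 0 s p := by
  have hz : (coordSum K ^ s).IsHomogeneous s := by simpa using coordSum_isHomogeneous.pow s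
  refine ⟨s, X 0 ^ p, - X 0 ^ p, 0, coordSum K ^ s, 1, one_ne_zero, rfl, ⟨?_, ?_, ?_, ?_, ?_⟩,
    ⟨?_, hz, ?_, ?_, ?_⟩, ?_⟩ <;>
    simp [isHomogeneous_X_pow, isHomogeneous_zero, IsHomogeneous.neg]

end BinaryForms

/-! ### The Wronskian bound for polynomials in one variable. -/

section Wronskian

open Polynomial

variable {K : Type*} [Field K] [CharZero K]

/-- After division by the gcd, the vanishing Wronskian forces both coprime cofactors to have zero
derivative; in characteristic zero they are constants. -/
theorem Polynomial.exists_smul_add_eq_zero_of_wronskian_eq_zero {F G : K[X]}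
    (h : wronskian F G = 0) : ∃ a b : K, (a ≠ 0 ∨ b ≠ 0) ∧ C a * F + C b * G = 0 := by
  classical
  by_cases hFG : F = 0 ∧ G = 0
  · exact ⟨1, 0, by simp, by simp [hFG.1]⟩
  · have hD : EuclideanDomain.gcd F G ≠ 0 := by
      rw [Ne, EuclideanDomain.gcd_eq_zero_iff]
      exact hFG
    obtain ⟨a, ha⟩ := EuclideanDomain.gcd_dvd_left F G
    obtain ⟨b, hb⟩ := EuclideanDomain.gcd_dvd_right F G
    set D := EuclideanDomain.gcd F G with hDdef
    have hab : IsCoprime a b := by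
      refine ⟨EuclideanDomain.gcdA F G, EuclideanDomain.gcdB F G, ?_⟩
      apply mul_left_cancel₀ hD
      have := EuclideanDomain.gcd_eq_gcd_ab F G
      rw [← hDdef] at this
      linear_combination -this - EuclideanDomain.gcdA F G * ha - EuclideanDomain.gcdB F G * hb
    have hw : wronskian a b = 0 := by
      have : wronskian F G = D * D * wronskian a b := by
        rw [ha, hb]
        simp only [wronskian, derivative_mul]
        ring
      rw [this, mul_eq_zero, mul_self_eq_zero] at h
      exact h.resolve_left hD
    obtain ⟨ha', hb'⟩ := hab.wronskian_eq_zero_iff.1 hw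
    have hca := eq_C_of_derivative_eq_zero ha'
    have hcb := eq_C_of_derivative_eq_zero hb'
    refine ⟨b.coeff 0, - a.coeff 0, ?_, ?_⟩
    · by_contra hcon
      push Not at hcon
      rw [neg_eq_zero] at hcon
      rw [hca, hcb, hcon.1, hcon.2, C_0] at hab
      exact not_isCoprime_zero_zero hab
    · rw [map_neg, ← hca, ← hcb]
      linear_combination b * ha - a * hb

/-- Balanced triples of orders of contact force large degree. -/
theorem Polynomial.eq_zero_of_balanced {p q r N d : ℕ} (hsum : p + q + r = 2 * N) (hp : p ≤ N)
    (hq : q ≤ N) (hr : r ≤ N) (hd : d < N) {F G : K[X]} (hFp : X ^ p ∣ F)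
    (hFd : F.natDegree ≤ d) (hGd : G ≠ 0 → G.natDegree + q ≤ d) (hr' : (X + C 1) ^ r ∣ F + G) :
    F = 0 ∧ G = 0 := by
  have hcop : IsCoprime (X : K[X]) (X + C 1) := ⟨-1, 1, by simp⟩
  have hdegp : ∀ k, ((X : K[X]) ^ k).natDegree = k := fun k => by simp
  have hdegr : ∀ k, ((X + C (1 : K)) ^ k).natDegree = k := fun k => by
    rw [natDegree_pow, natDegree_X_add_C, mul_one]
  -- The Wronskian vanishes to order p - 1 at 0 and, being also the Wronskian of F and F + G, to
  -- order r - 1 at -1. Its degree is less than 2d - q. With p + q + r = 2N, a nonzero Wronskian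
  -- would give N ≤ d.
  have hW : wronskian F G = 0 := by
    by_contra hW
    have hG : G ≠ 0 := by
      rintro rfl
      exact hW (wronskian_zero_right _)
    have h1 : X ^ (p - 1) ∣ wronskian F G :=
      dvd_sub (((pow_dvd_pow _ (Nat.sub_le _ _)).trans hFp).mul_right _)
        ((pow_sub_one_dvd_derivative_of_pow_dvd hFp).mul_right _)
    have h2 : (X + C 1) ^ (r - 1) ∣ wronskian F G := by
      have : wronskian F G = wronskian F (F + G) := by
        rw [wronskian_add_right, wronskian_self_eq_zero, zero_add]
      rw [this]
      exact dvd_sub ((pow_sub_one_dvd_derivative_of_pow_dvd hr').mul_left _)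
        (((pow_dvd_pow _ (Nat.sub_le _ _)).trans hr').mul_left _)
    have h3 := natDegree_le_of_dvd (hcop.pow.mul_dvd h1 h2) hW
    rw [(monic_X_pow _).natDegree_mul ((monic_X_add_C _).pow _), hdegp, hdegr] at h3
    have h4 := natDegree_wronskian_lt_add hW
    have h5 := hGd hG
    omega
  -- For proportional F and G, every nonzero case would make two of p, q, r add up to at most d < N,
  -- while p, q, r ≤ N forces any two of them to add up to at least N.
  obtain ⟨a, b, hab, hrel⟩ := exists_smul_add_eq_zero_of_wronskian_eq_zero hW
  have hG : G = 0 := by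
    by_contra hG
    have h5 := hGd hG
    by_cases hb : b = 0
    · have ha : a ≠ 0 := hab.resolve_right (by simpa using hb)
      have hF : F = 0 := by simpa [hb, ha] using hrel
      rw [hF, zero_add] at hr'
      have := natDegree_le_of_dvd hr' hG
      rw [hdegr] at this
      omega
    · have hXG : X ^ p ∣ G := by
        have h6 : X ^ p ∣ C b * G := by
          rw [eq_neg_of_add_eq_zero_right hrel, dvd_neg]
          exact hFp.mul_left _
        have h7 := h6.mul_left (C b⁻¹)
        rwa [← mul_assoc, ← C_mul, inv_mul_cancel₀ hb, C_1, one_mul] at h7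
      have := natDegree_le_of_dvd hXG hG
      rw [hdegp] at this
      omega
  refine ⟨?_, hG⟩
  by_contra hF
  rw [hG, add_zero] at hr'
  have h3 := natDegree_le_of_dvd (hcop.pow.mul_dvd hFp hr') hF
  rw [(monic_X_pow _).natDegree_mul ((monic_X_add_C _).pow _), hdegp, hdegr] at h3
  omega

end Wronskian

/-! ### Degrees of plane derivations and the Euler multiplicity in type A₂. -/

section PlaneDegrees

open MvPolynomial

variable {K : Type*} [Field K]

/-- Dehomogenization of binary forms. -/
noncomputable def dehomogenize (K : Type*) [Field K] :
    MvPolynomial (Fin 2) K →ₐ[K] Polynomial K :=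
  aeval ![Polynomial.X, 1]

theorem natDegree_dehomogenize_le (f : MvPolynomial (Fin 2) K) :
    (dehomogenize K f).natDegree ≤ f.totalDegree := by
  have := aeval_natDegree_le (m := f.totalDegree) (n := 1) f le_rfl ![Polynomial.X, 1]
    (fun i => by fin_cases i <;> simp)
  simpa [dehomogenize] using this

variable [CharZero K]

/-- Away from y = 0 the values of a binary form are determined by its dehomogenization, so f * y
vanishes as a function on an infinite field. -/
theorem eq_zero_of_dehomogenize_eq_zero {f : MvPolynomial (Fin 2) K} {d : ℕ}
    (hf : f.IsHomogeneous d) (h : dehomogenize K f = 0) : f = 0 := by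
  have h1 : f * X 1 = 0 := by
    refine MvPolynomial.funext fun v => ?_
    rw [map_mul, eval_X, map_zero, mul_eq_zero, or_iff_not_imp_right]
    intro hv
    have h2 : eval ![v 0 / v 1, 1] f = 0 := by
      have h3 := congrArg (Polynomial.evalRingHom (v 0 / v 1)) h
      have h4 : ∀ g : MvPolynomial (Fin 2) K,
          Polynomial.evalRingHom (v 0 / v 1) (dehomogenize K g) = eval ![v 0 / v 1, 1] g := by
        intro g
        induction g using MvPolynomial.induction_on with
        | C a => simp [dehomogenize]
        | add p q hp hq => simp only [map_add, hp, hq]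
        | mul_X p i hp =>
          simp only [map_mul, hp]
          fin_cases i <;> simp [dehomogenize]
      rwa [h4, map_zero] at h3
    have h3 : eval v f = v 1 ^ d * eval ![v 0 / v 1, 1] f := by
      rw [eval_eq', eval_eq', Finset.mul_sum]
      refine Finset.sum_congr rfl fun m hm => ?_
      have hk := hf.eq_add_of_mem_support hm
      rw [Fin.prod_univ_two, Fin.prod_univ_two, hk, pow_add]
      simp only [Matrix.cons_val_zero, Matrix.cons_val_one, one_pow, mul_one, div_pow]
      field_simp
    rw [h3, h2, mul_zero]
  exact (mul_eq_zero.1 h1).resolve_right (X_ne_zero 1)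

theorem IsPlaneDerivation.eq_zero_of_balanced {p q r N d : ℕ} (hsum : p + q + r = 2 * N)
    (hp : p ≤ N) (hq : q ≤ N) (hr : r ≤ N) (hd : d < N) {f g : MvPolynomial (Fin 2) K}
    (h : IsPlaneDerivation p q r d f g) : f = 0 ∧ g = 0 := by
  obtain ⟨hF, hG⟩ := Polynomial.eq_zero_of_balanced (F := dehomogenize K f)
    (G := dehomogenize K g) hsum hp hq hr hd
    (by simpa [dehomogenize] using map_dvd (dehomogenize K) h.dvd_left)
    ((natDegree_dehomogenize_le f).trans h.homogeneous_left.totalDegree_le)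
    (by
      -- The factor y ^ q of g becomes 1, which lowers the degree bound to d - q.
      intro hG0
      obtain ⟨v, hv⟩ := h.dvd_right
      have hg0 : g ≠ 0 := by
        rintro rfl
        exact hG0 (map_zero _)
      have hv0 : v ≠ 0 := by
        rintro rfl
        exact hg0 (by rw [hv, mul_zero])
      have h1 := h.homogeneous_right.totalDegree hg0
      rw [hv, totalDegree_mul_of_isDomain (pow_ne_zero _ (X_ne_zero 1)) hv0, totalDegree_X_pow]
        at h1
      have h2 : dehomogenize K g = dehomogenize K v := by
        rw [hv]
        simp [dehomogenize]
      have := natDegree_dehomogenize_le v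
      rw [h2]
      omega)
    (by simpa [dehomogenize] using map_dvd (dehomogenize K) h.dvd_add)
  exact ⟨eq_zero_of_dehomogenize_eq_zero h.1 hF, eq_zero_of_dehomogenize_eq_zero h.2 hG⟩

/-- The Euler multiplicity of a localization of type `A₂`. -/
theorem hasEulerPair_of_balanced (n₁ n₂ n₃ : ℕ) {g₁ g₂ : ℕ} (hg₁ : g₁ ≤ 1) (hg₂ : g₂ ≤ 1) :
    HasEulerPair K (n₁ + n₃ + g₁) (n₂ + n₃ + g₂) (n₁ + n₂) (n₁ + n₂ + n₃ + max g₁ g₂) := by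
  obtain ⟨d, h⟩ := exists_hasEulerPair (K := K) (n₁ + n₃ + g₁) (n₂ + n₃ + g₂) (n₁ + n₂)
  have h' := h
  obtain ⟨e, f₁, g₁', f₂, g₂', c, hc, hde, h₁, h₂, hdet⟩ := h
  have hdet0 : f₁ * g₂' - f₂ * g₁' ≠ 0 := by
    rw [hdet]
    exact mul_ne_zero (by simpa using hc) (mul_ne_zero (mul_ne_zero (pow_ne_zero _ (X_ne_zero 0))
      (pow_ne_zero _ (X_ne_zero 1))) (pow_ne_zero _ coordSum_ne_zero))
  -- The determinant is nonzero, so neither pair vanishes, and each degree is bounded below by any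
  -- balanced triple of orders below the actual ones. The first pair may use s + 1 along x + y = 0,
  -- the second only s.
  have hd : ∀ p q r N, p + q + r = 2 * N → p ≤ N → q ≤ N → r ≤ N → p ≤ n₁ + n₃ + g₁ →
      q ≤ n₂ + n₃ + g₂ → r ≤ n₁ + n₂ + 1 → N ≤ d := by
    intro p q r N hs hp hq hr hp' hq' hr'
    by_contra hlt
    obtain ⟨h3, h4⟩ := (h₁.mono hp' hq' hr').eq_zero_of_balanced hs hp hq hr (not_le.1 hlt)
    rw [h3, h4] at hdet0
    simp at hdet0
  have he : ∀ p q r N, p + q + r = 2 * N → p ≤ N → q ≤ N → r ≤ N → p ≤ n₁ + n₃ + g₁ →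
      q ≤ n₂ + n₃ + g₂ → r ≤ n₁ + n₂ → N ≤ e := by
    intro p q r N hs hp hq hr hp' hq' hr'
    by_contra hlt
    obtain ⟨h3, h4⟩ := (h₂.mono hp' hq' hr').eq_zero_of_balanced hs hp hq hr (not_le.1 hlt)
    rw [h3, h4] at hdet0
    simp at hdet0
  -- For each choice of g₁ and g₂ the two lower bounds add up to p + q + s = d + e, so both are
  -- attained.
  have hval : d = n₁ + n₂ + n₃ + max g₁ g₂ := by
    interval_cases g₁ <;> interval_cases g₂
    · have := hd (n₁ + n₃) (n₂ + n₃) (n₁ + n₂) (n₁ + n₂ + n₃)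
      have := he (n₁ + n₃) (n₂ + n₃) (n₁ + n₂) (n₁ + n₂ + n₃)
      simp only [max_self]
      omega
    · have := hd (n₁ + n₃) (n₂ + n₃ + 1) (n₁ + n₂ + 1) (n₁ + n₂ + n₃ + 1)
      have := he (n₁ + n₃) (n₂ + n₃) (n₁ + n₂) (n₁ + n₂ + n₃)
      simp only [zero_le, max_eq_right]
      omega
    · have := hd (n₁ + n₃ + 1) (n₂ + n₃) (n₁ + n₂ + 1) (n₁ + n₂ + n₃ + 1)
      have := he (n₁ + n₃) (n₂ + n₃) (n₁ + n₂) (n₁ + n₂ + n₃)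
      simp only [zero_le, max_eq_left]
      omega
    · have := hd (n₁ + n₃ + 1) (n₂ + n₃ + 1) (n₁ + n₂) (n₁ + n₂ + n₃ + 1)
      have := he (n₁ + n₃ + 1) (n₂ + n₃ + 1) (n₁ + n₂) (n₁ + n₂ + n₃ + 1)
      simp only [max_self]
      omega
  exact hval ▸ h'

end PlaneDegrees

/-! ### Cramer's rule under divisibility conditions. -/

section PrimePowers

variable {R : Type*} [CommRing R] [IsDomain R]

theorem Prime.pow_mul_pow_dvd {x y N : R} (hx : Prime x) (hxy : ¬ x ∣ y) {m n : ℕ}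
    (h₁ : x ^ m ∣ N) (h₂ : y ^ n ∣ N) : x ^ m * y ^ n ∣ N := by
  obtain ⟨t, rfl⟩ := h₂
  rw [mul_comm]
  exact mul_dvd_mul_left _ (hx.pow_dvd_of_dvd_mul_left m (fun h => hxy (hx.dvd_of_dvd_pow h)) h₁)

/-- Cramer's rule for pairs with prescribed divisibility. -/
theorem exists_eq_mul_add_mul_of_dvd {x y z c P Q F₁ G₁ F₂ G₂ : R} {p q s : ℕ} (hx : Prime x)
    (hy : Prime y) (hz : Prime z) (hxy : ¬ x ∣ y) (hxz : ¬ x ∣ z) (hyz : ¬ y ∣ z)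
    (hc : IsUnit c) (hdet : F₁ * G₂ - F₂ * G₁ = c * (x ^ p * y ^ q * z ^ s))
    (hF₁ : x ^ p ∣ F₁) (hF₂ : x ^ p ∣ F₂) (hP : x ^ p ∣ P)
    (hG₁ : y ^ q ∣ G₁) (hG₂ : y ^ q ∣ G₂) (hQ : y ^ q ∣ Q)
    (hS₁ : z ^ s ∣ F₁ + G₁) (hS₂ : z ^ s ∣ F₂ + G₂) (hS : z ^ s ∣ P + Q) :
    ∃ a b : R, P = a * F₁ + b * F₂ ∧ Q = a * G₁ + b * G₂ := by
  -- The numerators in Cramer's rule are divisible by the determinant, one prime at a time; for z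
  -- this is visible from P G - Q F = (P + Q) G - Q (F + G).
  have key : ∀ {P Q F G : R}, x ^ p ∣ P → y ^ q ∣ Q → z ^ s ∣ P + Q → x ^ p ∣ F → y ^ q ∣ G →
      z ^ s ∣ F + G → c * (x ^ p * y ^ q * z ^ s) ∣ P * G - Q * F := by
    intro P Q F G hP hQ hS hF hG hT
    rw [hc.mul_left_dvd, mul_assoc]
    refine hx.pow_mul_pow_dvd (n := 1) (y := y ^ q * z ^ s) ?_ ?_ ?_ |> (by simpa using ·)
    · intro h
      rcases hx.dvd_or_dvd h with h | h
      · exact hxy (hx.dvd_of_dvd_pow h)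
      · exact hxz (hx.dvd_of_dvd_pow h)
    · exact dvd_sub (hP.mul_right _) (hF.mul_left _)
    · rw [pow_one]
      refine hy.pow_mul_pow_dvd hyz (dvd_sub (hG.mul_left _) (hQ.mul_right _)) ?_
      have : P * G - Q * F = (P + Q) * G - Q * (F + G) := by ring
      rw [this]
      exact dvd_sub (hS.mul_right _) (hT.mul_left _)
  obtain ⟨a, ha⟩ := key hP hQ hS hF₂ hG₂ hS₂
  obtain ⟨b, hb⟩ := key hF₁ hG₁ hS₁ hP hQ hS
  have hne : F₁ * G₂ - F₂ * G₁ ≠ 0 := by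
    rw [hdet]
    exact mul_ne_zero hc.ne_zero (mul_ne_zero (mul_ne_zero (pow_ne_zero _ hx.ne_zero)
      (pow_ne_zero _ hy.ne_zero)) (pow_ne_zero _ hz.ne_zero))
  rw [← hdet] at ha hb
  refine ⟨a, b, mul_left_cancel₀ hne ?_, mul_left_cancel₀ hne ?_⟩
  · linear_combination F₁ * ha + F₂ * hb
  · linear_combination G₁ * ha + G₂ * hb

end PrimePowers

/-! ### Rank two localizations in terms of plane derivations. -/

section RankTwo

variable {K : Type*} [Field K] {V : Type*} [AddCommGroup V] [Module K V]

theorem linForm_pow_dvd_of_ker_eq {α β : Dual K V} (h : LinearMap.ker α = LinearMap.ker β)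
    {θ : Der K V} {k : ℕ} (hθ : linForm α ^ k ∣ θ (linForm α)) :
    linForm β ^ k ∣ θ (linForm β) := by
  obtain ⟨c, rfl⟩ := Dual.mem_span_singleton_of_ker_le h.le
  by_cases hc : c = 0
  · subst hc
    simp [linForm]
  · rw [linForm, map_smul, Derivation.map_smul, smul_pow]
    rw [Algebra.smul_def, Algebra.smul_def]
    exact mul_dvd_mul (IsUnit.dvd ((IsUnit.mk0 _ (pow_ne_zero _ hc)).map _)) hθ

theorem MultiArrangement.mem_derivations_iff {ι : Type*} {A : MultiArrangement K V}
    {α : ι → Dual K V} (h : ∀ H ∈ A.hyperplanes, ∃ i, LinearMap.ker (α i) = H) {θ : Der K V} :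
    θ ∈ A.derivations ↔
      ∀ i, linForm (α i) ^ A.mult (LinearMap.ker (α i)) ∣ θ (linForm (α i)) := by
  constructor
  · intro hθ i
    by_cases hi : A.mult (LinearMap.ker (α i)) = 0
    · simp [hi]
    · exact hθ _ (Finsupp.mem_support_iff.2 hi) _ rfl
  · intro hθ H hH β hβ
    obtain ⟨i, rfl⟩ := h H hH
    exact linForm_pow_dvd_of_ker_eq hβ.symm (hθ i)

/-- Evaluation of binary forms at the pair of linear forms `α`, `γ - α`. -/
noncomputable def planeEval (α γ : Dual K V) : MvPolynomial (Fin 2) K →ₐ[K] PolyRing K V :=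
  MvPolynomial.aeval ![linForm α, linForm (γ - α)]

theorem planeEval_X_zero (α γ : Dual K V) : planeEval α γ (MvPolynomial.X 0) = linForm α := by
  simp [planeEval]

theorem planeEval_X_one (α γ : Dual K V) :
    planeEval α γ (MvPolynomial.X 1) = linForm (γ - α) := by
  simp [planeEval]

theorem planeEval_coordSum (α γ : Dual K V) : planeEval α γ (coordSum K) = linForm γ := by
  rw [map_add, planeEval_X_zero, planeEval_X_one, ← map_add, add_sub_cancel]

theorem planeEval_C (α γ : Dual K V) (c : K) :
    planeEval α γ (MvPolynomial.C c) = algebraMap K _ c := by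
  simp [planeEval]

theorem planeEval_mem_homogeneousPart (α γ : Dual K V) {f : MvPolynomial (Fin 2) K} {k : ℕ}
    (hf : f.IsHomogeneous k) : planeEval α γ f ∈ homogeneousPart K V k := by
  rw [f.as_sum, map_sum]
  refine Submodule.sum_mem _ fun m hm => ?_
  rw [MvPolynomial.monomial_eq, Finsupp.prod_fintype _ _ (by simp), Fin.prod_univ_two, map_mul,
    map_mul, map_pow, map_pow, planeEval_X_zero, planeEval_X_one, planeEval_C,
    hf.eq_add_of_mem_support hm, ← Algebra.smul_def]
  exact Submodule.smul_mem _ _ (mul_mem_homogeneousPart (linForm_pow_mem_homogeneousPart _ _)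
    (linForm_pow_mem_homogeneousPart _ _))

variable {α γ : Dual K V}

theorem LinearIndependent.pair_sub (h : LinearIndependent K ![α, γ]) :
    LinearIndependent K ![α, γ - α] ∧ LinearIndependent K ![γ - α, γ] := by
  simp only [LinearIndependent.pair_iff] at h ⊢
  constructor <;> intro s t hst
  · have := h (s - t) t (by rw [← hst]; module)
    grind
  · have := h (-s) (s + t) (by rw [← hst]; module)
    grind

theorem restrict_planeEval_coordSum_mul {H : Submodule K V} (hH : LinearMap.ker γ = H)
    {f : MvPolynomial (Fin 2) K} (hf : coordSum K ∣ f) :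
    PolyRing.restrict H (planeEval α γ f) = 0 := by
  rw [PolyRing.restrict_eq_zero_iff hH, ← planeEval_coordSum α γ]
  exact map_dvd _ hf

variable [FiniteDimensional K V]

theorem not_linForm_dvd_linForm {δ ε : Dual K V} (h : LinearIndependent K ![δ, ε]) :
    ¬ linForm δ ∣ linForm ε := by
  rw [linForm_dvd_linForm_iff]
  intro hle
  obtain ⟨c, rfl⟩ := Dual.mem_span_singleton_of_ker_le hle
  rw [LinearIndependent.pair_iff] at h
  have := h c (-1) (by simp)
  simp at this

/-- Derivations with prescribed orders of tangency along `α`, `γ - α` and `γ` in terms of a pair of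
plane derivations. -/
theorem exists_eq_planeEval (hind : LinearIndependent K ![α, γ]) {p q s d e : ℕ}
    {f₁ g₁ f₂ g₂ : MvPolynomial (Fin 2) K} {c : K} (hc : c ≠ 0)
    (h₁ : IsPlaneDerivation p q s d f₁ g₁) (h₂ : IsPlaneDerivation p q s e f₂ g₂)
    (hdet : f₁ * g₂ - f₂ * g₁ =
      MvPolynomial.C c * (MvPolynomial.X 0 ^ p * MvPolynomial.X 1 ^ q * coordSum K ^ s))
    {φ : Der K V} (hα : linForm α ^ p ∣ φ (linForm α))
    (hβ : linForm (γ - α) ^ q ∣ φ (linForm (γ - α))) (hγ : linForm γ ^ s ∣ φ (linForm γ)) :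
    ∃ a b, φ (linForm α) = a * planeEval α γ f₁ + b * planeEval α γ f₂ ∧
      φ (linForm (γ - α)) = a * planeEval α γ g₁ + b * planeEval α γ g₂ := by
  obtain ⟨h2, h3⟩ := hind.pair_sub
  have hx := fun {f g : MvPolynomial (Fin 2) K} (h : f ∣ g) => map_dvd (planeEval α γ) h
  refine exists_eq_mul_add_mul_of_dvd (x := linForm α) (y := linForm (γ - α)) (z := linForm γ)
    (c := algebraMap K _ c) (p := p) (q := q) (s := s) (linForm_prime (hind.ne_zero 0))
    (linForm_prime (h3.ne_zero 0)) (linForm_prime (hind.ne_zero 1)) (not_linForm_dvd_linForm h2)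
    (not_linForm_dvd_linForm hind) (not_linForm_dvd_linForm h3) ((IsUnit.mk0 c hc).map _)
    ?_ ?_ ?_ hα ?_ ?_ hβ ?_ ?_ ?_
  · have := congrArg (planeEval α γ) hdet
    simpa only [map_sub, map_mul, map_pow, planeEval_X_zero, planeEval_X_one, planeEval_C,
      planeEval_coordSum] using this
  · simpa only [map_pow, planeEval_X_zero] using hx h₁.3
  · simpa only [map_pow, planeEval_X_zero] using hx h₂.3
  · simpa only [map_pow, planeEval_X_one] using hx h₁.4
  · simpa only [map_pow, planeEval_X_one] using hx h₂.4
  · rw [← map_add, ← planeEval_coordSum α γ, ← map_pow]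
    exact hx h₁.5
  · rw [← map_add, ← planeEval_coordSum α γ, ← map_pow]
    exact hx h₂.5
  · rw [← map_add, ← map_add, add_sub_cancel]
    exact hγ

/-- The second basis element of the localization carries a factor γ and vanishes on H, while modulo
γ the form f₁ of degree d is a scalar times α ^ d. -/
theorem HasEulerPair.pow_dvd_restrict {p q s d : ℕ} (h : HasEulerPair K p q s d)
    (hind : LinearIndependent K ![α, γ]) {H : Submodule K V} (hH : LinearMap.ker γ = H)
    {φ : Der K V} (hα : linForm α ^ p ∣ φ (linForm α))
    (hβ : linForm (γ - α) ^ q ∣ φ (linForm (γ - α)))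
    (hγ : linForm γ ^ (s + 1) ∣ φ (linForm γ)) :
    linForm (H.dualRestrict α) ^ d ∣ PolyRing.restrict H (φ (linForm α)) := by
  obtain ⟨e, f₁, g₁, f₂, g₂, c, hc, hde, h₁, h₂, hdet⟩ := h
  obtain ⟨a, b, hab, -⟩ := exists_eq_planeEval hind hc h₁ h₂.coordSum_smul
    (by linear_combination coordSum K * hdet) hα hβ hγ
  obtain ⟨c', hc'⟩ := exists_coordSum_dvd_sub h₁.homogeneous_left
  have h3 := restrict_planeEval_coordSum_mul (α := α) hH hc'
  rw [map_sub, map_mul, map_pow, planeEval_X_zero, planeEval_C, map_sub, sub_eq_zero, map_mul,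
    map_pow, PolyRing.restrict_linForm] at h3
  rw [hab, map_add, map_mul, h3, map_mul, restrict_planeEval_coordSum_mul hH (Dvd.intro _ rfl),
    mul_zero, add_zero]
  exact (Dvd.intro_left _ rfl).mul_left _

/-- The first pair is tangent to order s + 1, so on H only the second one contributes to the
cofactor of γ ^ s; its contribution is a multiple of α ^ (e - s), and e - s = p + q - d. -/
theorem HasEulerPair.pow_dvd_restrict_cofactor {p q s d : ℕ} (h : HasEulerPair K p q s d)
    (hind : LinearIndependent K ![α, γ]) {H : Submodule K V} (hH : LinearMap.ker γ = H)
    {φ : Der K V} (hα : linForm α ^ p ∣ φ (linForm α))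
    (hβ : linForm (γ - α) ^ q ∣ φ (linForm (γ - α))) {t : PolyRing K V}
    (hγ : φ (linForm γ) = linForm γ ^ s * t) :
    linForm (H.dualRestrict α) ^ (p + q - d) ∣ PolyRing.restrict H t := by
  obtain ⟨e, f₁, g₁, f₂, g₂, c, hc, hde, h₁, h₂, hdet⟩ := h
  obtain ⟨a, b, hab, hab'⟩ := exists_eq_planeEval hind hc (h₁.mono le_rfl le_rfl (Nat.le_succ s)) h₂
    hdet hα hβ (Dvd.intro _ hγ.symm)
  obtain ⟨c', ⟨u, hu⟩, -⟩ := h₂.exists_coeff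
  obtain ⟨w, hw⟩ := h₁.dvd_add
  have hne : linForm γ ^ s ≠ 0 := pow_ne_zero _ (linForm_prime (hind.ne_zero 1)).ne_zero
  have hfg₁ : planeEval α γ f₁ + planeEval α γ g₁ =
      linForm γ ^ s * (linForm γ * planeEval α γ w) := by
    rw [← map_add, hw, map_mul, map_pow, planeEval_coordSum, pow_succ]
    ring
  have hfg₂ : planeEval α γ f₂ + planeEval α γ g₂ =
      linForm γ ^ s * (algebraMap K _ c' * linForm α ^ (p + q - d) +
        linForm γ * planeEval α γ u) := by
    rw [← map_add, eq_add_of_sub_eq hu]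
    rw [map_add, map_mul, map_mul, map_mul, map_pow, map_pow, map_pow, planeEval_coordSum,
      planeEval_C, planeEval_X_zero, show e - s = p + q - d by omega, pow_succ]
    ring
  have ht : t = a * (linForm γ * planeEval α γ w) +
      b * (algebraMap K _ c' * linForm α ^ (p + q - d) + linForm γ * planeEval α γ u) := by
    apply mul_left_cancel₀ hne
    have hsum : φ (linForm γ) = φ (linForm α) + φ (linForm (γ - α)) := by
      rw [← map_add, ← map_add, add_sub_cancel]
    rw [← hγ, hsum, hab, hab']
    linear_combination a * hfg₁ + b * hfg₂
  have hγ0 : PolyRing.restrict H (linForm γ) = 0 := by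
    rw [PolyRing.restrict_eq_zero_iff hH]
  rw [ht]
  simp only [map_add, map_mul, hγ0, map_pow, PolyRing.restrict_linForm, zero_mul, mul_zero,
    zero_add, add_zero]
  exact (Dvd.intro_left _ rfl).mul_left _

end RankTwo

/-! ### Euler multiplicities from plane derivations. -/

section EulerMultiplicity

variable {K : Type*} [Field K] {V : Type*} [AddCommGroup V] [Module K V]

theorem Der.ext_basis {ι : Type*} [Fintype ι] (v : Basis ι K V) {θ η : Der K V}
    (h : ∀ i, θ (linForm (v.coord i)) = η (linForm (v.coord i))) : θ = η := by
  refine Der.ext_linForm fun δ => ?_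
  rw [← Basis.sum_dual_apply_smul_coord v δ, linForm, map_sum, map_sum, map_sum]
  refine Finset.sum_congr rfl fun i _ => ?_
  rw [map_smul, Derivation.map_smul, Derivation.map_smul]
  exact congrArg _ (h i)

variable [FiniteDimensional K V]

/-- Two independent linear forms are part of a coordinate system. -/
theorem exists_basis_coord {α γ : Dual K V} (hind : LinearIndependent K ![α, γ]) :
    ∃ (n : ℕ) (v : Basis (Fin (n + 2)) K V), v.coord 0 = α ∧ v.coord 1 = γ := by
  classical
  let b := Basis.sumExtend hind
  have : Finite (Basis.sumExtendIndex hind) :=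
    have := Module.Finite.finite_basis b
    Finite.of_injective (Sum.inr : _ → Fin 2 ⊕ Basis.sumExtendIndex hind) Sum.inr_injective
  have := Fintype.ofFinite (Basis.sumExtendIndex hind)
  let ε : Fin 2 ⊕ Basis.sumExtendIndex hind ≃ Fin (Fintype.card (Basis.sumExtendIndex hind) + 2) :=
    ((Equiv.refl _).sumCongr (Fintype.equivFin _)).trans
      (finSumFinEquiv.trans (finCongr (add_comm _ _)))
  let v := b.dualBasis.map (evalEquiv K V).symm
  have hv : ∀ i j, b j (v i) = if j = i then 1 else 0 := by
    intro i j
    have : b j (v i) = b.dualBasis i (b j) := by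
      rw [← Dual.eval_apply]
      simp [v]
    rw [this, b.dualBasis_apply_self]
  have hcoord : ∀ j, v.coord j = b j := by
    intro j
    refine v.ext fun i => ?_
    rw [hv, Basis.coord_apply, Basis.repr_self, Finsupp.single_apply]
    simp [eq_comm]
  refine ⟨_, v.reindex ε, ?_, ?_⟩
  · have h0 : ε.symm 0 = Sum.inl 0 := by
      rw [Equiv.symm_apply_eq]
      rfl
    have h1 : (v.reindex ε).coord 0 = v.coord (ε.symm 0) := by
      ext w
      simp
    rw [h1, h0, hcoord]
    simp only [b, Basis.sumExtend, Basis.reindex_apply, Basis.extend_apply_self]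
    rfl
  · have h0 : ε.symm 1 = Sum.inl 1 := by
      rw [Equiv.symm_apply_eq]
      rfl
    have h1 : (v.reindex ε).coord 1 = v.coord (ε.symm 1) := by
      ext w
      simp
    rw [h1, h0, hcoord]
    simp only [b, Basis.sumExtend, Basis.reindex_apply, Basis.extend_apply_self]
    rfl

theorem MultiArrangement.isEulerMultiplicity_of_hasEulerPair {A : MultiArrangement K V}
    {α γ : Dual K V} (hind : LinearIndependent K ![α, γ]) {p q s d : ℕ}
    (h : HasEulerPair K p q s d) (hp : A.mult (LinearMap.ker α) = p)
    (hq : A.mult (LinearMap.ker (γ - α)) = q) (hs : A.mult (LinearMap.ker γ) = s + 1)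
    (hA : ∀ H ∈ A.hyperplanes, LinearMap.ker α ⊓ LinearMap.ker γ ≤ H →
      H = LinearMap.ker α ∨ H = LinearMap.ker (γ - α) ∨ H = LinearMap.ker γ) :
    A.IsEulerMultiplicity (LinearMap.ker γ) (LinearMap.ker α ⊓ LinearMap.ker γ) d := by
  classical
  have hmem : ∀ φ : Der K V,
      φ ∈ (A.localization (LinearMap.ker α ⊓ LinearMap.ker γ)).derivations ↔
      linForm α ^ p ∣ φ (linForm α) ∧ linForm (γ - α) ^ q ∣ φ (linForm (γ - α)) ∧
        linForm γ ^ (s + 1) ∣ φ (linForm γ) := by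
    intro φ
    rw [mem_derivations_iff (α := ![α, γ - α, γ])]
    · have h1 : LinearMap.ker α ⊓ LinearMap.ker γ ≤ LinearMap.ker α := inf_le_left
      have h2 : LinearMap.ker α ⊓ LinearMap.ker γ ≤ LinearMap.ker γ := inf_le_right
      have h3 : LinearMap.ker α ⊓ LinearMap.ker γ ≤ LinearMap.ker (γ - α) := by
        rintro v ⟨hv, hv'⟩
        simp_all
      simp only [localization, Fin.forall_fin_succ, Matrix.cons_val_zero, Matrix.cons_val_succ,
        Finsupp.filter_apply_pos (LinearMap.ker α ⊓ LinearMap.ker γ ≤ ·) _ h1,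
        Finsupp.filter_apply_pos (LinearMap.ker α ⊓ LinearMap.ker γ ≤ ·) _ h2,
        Finsupp.filter_apply_pos (LinearMap.ker α ⊓ LinearMap.ker γ ≤ ·) _ h3, hp, hq, hs]
      simp
    · intro H hH
      rw [hyperplanes, localization, Finsupp.support_filter, Finset.mem_filter] at hH
      rcases hA H hH.1 hH.2 with rfl | rfl | rfl
      · exact ⟨0, rfl⟩
      · exact ⟨1, rfl⟩
      · exact ⟨2, rfl⟩
  obtain ⟨hind2, hind3⟩ := hind.pair_sub
  have hγ := linForm_prime (hind.ne_zero 1 : γ ≠ 0)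
  obtain ⟨e, f₁, g₁, f₂, g₂, c, hc, hde, h₁, h₂, hdet⟩ := h
  obtain ⟨n, v, rfl, rfl⟩ := exists_basis_coord hind
  set α := v.coord 0
  set γ := v.coord 1
  let E := planeEval α γ
  have hdetE : E f₁ * E g₂ - E f₂ * E g₁ ≠ 0 := by
    rw [← map_mul, ← map_mul, ← map_sub, hdet]
    simp only [E, map_mul, map_pow, planeEval_C, planeEval_X_zero, planeEval_X_one]
    rw [planeEval_coordSum]
    refine mul_ne_zero ?_ (mul_ne_zero (mul_ne_zero (pow_ne_zero _ ?_) (pow_ne_zero _ ?_))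
      (pow_ne_zero _ hγ.ne_zero))
    · simpa using hc
    · exact (linForm_prime (hind.ne_zero 0)).ne_zero
    · exact (linForm_prime (hind3.ne_zero 0)).ne_zero
  have hdir : ∀ w : V, ∃ θ : Der K V, IsDirectional θ w := fun w =>
    Der.exists_of_linearMap ((Algebra.linearMap K (PolyRing K V)) ∘ₗ Dual.eval K V w)
  choose D hD using hdir
  -- In coordinates beginning with α and γ, the derivation with values a on α and b on γ - α has
  -- components a and a + b.
  have hval : ∀ a b : PolyRing K V, ∃ θ : Der K V, θ = a • D (v 0) + (a + b) • D (v 1) ∧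
      θ (linForm α) = a ∧ θ (linForm (γ - α)) = b ∧ θ (linForm γ) = a + b ∧
      (∀ k : Fin n, θ (linForm (v.coord k.succ.succ)) = 0) ∧
      (∀ m, a ∈ homogeneousPart K V m → b ∈ homogeneousPart K V m → HasPdeg θ m) := by
    intro a b
    have hα : (a • D (v 0) + (a + b) • D (v 1)) (linForm α) = a := by
      simp [hD _ _, α]
    have hγ : (a • D (v 0) + (a + b) • D (v 1)) (linForm γ) = a + b := by
      simp [hD _ _, γ]
    refine ⟨_, rfl, hα, ?_, hγ, fun k => ?_, fun m ha hb δ => ?_⟩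
    · rw [linForm, map_sub, map_sub, hα, hγ, add_sub_cancel_left]
    · have h0 : (v.coord k.succ.succ) (v 0) = 0 := by simp
      have h1 : (v.coord k.succ.succ) (v 1) = 0 := by
        rw [Basis.coord_apply, Basis.repr_self]
        exact Finsupp.single_eq_of_ne (by simp [Fin.ext_iff])
      simp only [Derivation.add_apply, Derivation.smul_apply, hD _ _, h0, h1, map_zero, smul_zero,
        add_zero]
    · simp only [Derivation.add_apply, Derivation.smul_apply, hD _ _, smul_eq_mul]
      rw [mul_comm, mul_comm (a + b), ← Algebra.smul_def, ← Algebra.smul_def]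
      exact Submodule.add_mem _ (Submodule.smul_mem _ _ ha)
        (Submodule.smul_mem _ _ (Submodule.add_mem _ ha hb))
  obtain ⟨θ, -, hθα, hθβ, hθγ, hθ0, hθdeg⟩ := hval (E f₁) (E g₁)
  obtain ⟨ψ', -, hψα, hψβ, hψγ, hψ0, hψdeg⟩ := hval (E f₂) (E g₂)
  -- The factor γ raises the order of the second pair from s to s + 1 and places it in α₀ Der(S), as
  -- the definition of the Euler multiplicity demands.
  let φ : Fin (n + 2) → Der K V :=
    Fin.cons θ (Fin.cons (linForm γ • ψ') fun k => D (v k.succ.succ))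
  have hDk : ∀ (k : Fin n), D (v k.succ.succ) (linForm α) = 0 ∧
      D (v k.succ.succ) (linForm γ) = 0 := by
    intro k
    simp only [hD _ _, α, γ, Basis.coord_apply, Basis.repr_self]
    rw [Finsupp.single_eq_of_ne (by simp [Fin.ext_iff]),
      Finsupp.single_eq_of_ne (by simp [Fin.ext_iff])]
    simp
  have hsum : ∀ (a : Fin (n + 2) → PolyRing K V) (f : PolyRing K V), (∑ i, a i • φ i) f =
      a 0 * θ f + a 1 * (linForm γ * ψ' f) + ∑ k : Fin n, a k.succ.succ * D (v k.succ.succ) f := by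
    intro a f
    rw [Der.sum_smul_apply, Fin.sum_univ_succ, Fin.sum_univ_succ, ← add_assoc]
    rfl
  have hθmem : linForm α ^ p ∣ θ (linForm α) ∧ linForm (γ - α) ^ q ∣ θ (linForm (γ - α)) ∧
      linForm γ ^ (s + 1) ∣ θ (linForm γ) := by
    rw [hθα, hθβ, hθγ, ← map_add, ← planeEval_coordSum α γ, ← planeEval_X_zero α γ,
      ← planeEval_X_one α γ, ← map_pow, ← map_pow, ← map_pow]
    exact ⟨map_dvd _ h₁.3, map_dvd _ h₁.4, map_dvd _ h₁.5⟩
  have hψmem : linForm α ^ p ∣ ψ' (linForm α) ∧ linForm (γ - α) ^ q ∣ ψ' (linForm (γ - α)) ∧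
      linForm γ ^ s ∣ ψ' (linForm γ) := by
    rw [hψα, hψβ, hψγ, ← map_add, ← planeEval_coordSum α γ, ← planeEval_X_zero α γ,
      ← planeEval_X_one α γ, ← map_pow, ← map_pow, ← map_pow]
    exact ⟨map_dvd _ h₂.3, map_dvd _ h₂.4, map_dvd _ h₂.5⟩
  have hφmem : ∀ i, φ i ∈ (A.localization (LinearMap.ker α ⊓ LinearMap.ker γ)).derivations := by
    intro i
    rw [hmem]
    refine Fin.cases ?_ (Fin.cases ?_ fun k => ?_) i
    · exact hθmem
    · change _ ∣ linForm γ * _ ∧ _ ∣ linForm γ * _ ∧ _ ∣ linForm γ * _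
      refine ⟨hψmem.1.mul_left _, hψmem.2.1.mul_left _, ?_⟩
      rw [pow_succ']
      exact mul_dvd_mul_left _ hψmem.2.2
    · change _ ∣ D (v k.succ.succ) _ ∧ _ ∣ D (v k.succ.succ) _ ∧ _ ∣ D (v k.succ.succ) _
      have hβ : D (v k.succ.succ) (linForm (γ - α)) = 0 := by
        rw [linForm, map_sub, map_sub, (hDk k).1, (hDk k).2, sub_zero]
      rw [(hDk k).1, (hDk k).2, hβ]
      simp
  have hDkl : ∀ k l : Fin n, D (v k.succ.succ) (linForm (v.coord l.succ.succ)) =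
      if k = l then 1 else 0 := by
    intro k l
    rw [hD _ _, Basis.coord_apply, Basis.repr_self, Finsupp.single_apply]
    simp [apply_ite]
  have hγ1 : linForm γ = linForm α + linForm (γ - α) := by rw [← map_add, add_sub_cancel]
  have hli : LinearIndependent (PolyRing K V) φ := by
    rw [Fintype.linearIndependent_iff]
    intro a ha
    have hev : ∀ f, a 0 * θ f + a 1 * (linForm γ * ψ' f) +
        ∑ k : Fin n, a k.succ.succ * D (v k.succ.succ) f = 0 := fun f => by
      rw [← hsum, ha]
      rfl
    have hα0 := hev (linForm α)
    have hγ0 := hev (linForm γ)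
    simp only [(hDk _).1, (hDk _).2, mul_zero, Finset.sum_const_zero, add_zero, hθα, hψα, hθγ,
      hψγ] at hα0 hγ0
    have h0 : a 0 = 0 := by
      have : a 0 * (E f₁ * E g₂ - E f₂ * E g₁) = 0 := by
        linear_combination (E g₂ + E f₂) * hα0 - E f₂ * hγ0
      exact (mul_eq_zero.1 this).resolve_right hdetE
    have h1 : a 1 = 0 := by
      have : a 1 * (linForm γ * (E f₁ * E g₂ - E f₂ * E g₁)) = 0 := by
        linear_combination E f₁ * hγ0 - (E f₁ + E g₁) * hα0
      exact (mul_eq_zero.1 this).resolve_right (mul_ne_zero hγ.ne_zero hdetE)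
    intro i
    refine Fin.cases h0 (Fin.cases h1 fun l => ?_) i
    have := hev (linForm (v.coord l.succ.succ))
    simpa [hθ0, hψ0, hDkl] using this
  have hspan : (A.localization (LinearMap.ker α ⊓ LinearMap.ker γ)).derivations ≤
      Submodule.span (PolyRing K V) (Set.range φ) := by
    intro η hη
    rw [hmem] at hη
    obtain ⟨a, b, ha, hb⟩ := exists_eq_planeEval hind hc h₁ h₂.coordSum_smul
      (by linear_combination coordSum K * hdet) hη.1 hη.2.1 hη.2.2
    rw [map_mul, planeEval_coordSum] at ha hb
    let t : Fin (n + 2) → PolyRing K V :=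
      Fin.cons a (Fin.cons b fun k => η (linForm (v.coord k.succ.succ)))
    have ht : η = ∑ i, t i • φ i := by
      refine Der.ext_basis v fun i => ?_
      rw [hsum]
      change _ = a * _ + b * _ + ∑ k : Fin n, η (linForm (v.coord k.succ.succ)) * _
      refine Fin.cases ?_ (Fin.cases ?_ fun l => ?_) i
      · change η (linForm α) = a * θ (linForm α) + b * (linForm γ * ψ' (linForm α)) +
          ∑ k : Fin n, η (linForm (v.coord k.succ.succ)) * D (v k.succ.succ) (linForm α)
        simp only [(hDk _).1, mul_zero, Finset.sum_const_zero, add_zero, hθα, hψα]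
        exact ha
      · change η (linForm γ) = a * θ (linForm γ) + b * (linForm γ * ψ' (linForm γ)) +
          ∑ k : Fin n, η (linForm (v.coord k.succ.succ)) * D (v k.succ.succ) (linForm γ)
        simp only [(hDk _).2, mul_zero, Finset.sum_const_zero, add_zero, hθγ, hψγ]
        have : η (linForm γ) = η (linForm α) + η (linForm (γ - α)) := by rw [hγ1, map_add]
        rw [this, ha, hb]
        ring
      · simp [hθ0, hψ0, hDkl]
    rw [ht]
    exact Submodule.sum_mem _ fun i _ => Submodule.smul_mem _ _ (Submodule.subset_span ⟨i, rfl⟩)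
  obtain ⟨B, hB⟩ := Submodule.exists_basis_of_family hφmem hli hspan
  have hB0 : (B 0 : Der K V) = θ := hB 0
  have hB1 : (B 1 : Der K V) = linForm γ • ψ' := hB 1
  refine ⟨γ, rfl, n, B, ⟨?_, ?_⟩, ⟨⟨1 + e, ?_⟩, ψ', hB1⟩, fun k => ⟨v k.succ.succ, ?_, ?_⟩⟩
  · rw [hB0]
    exact hθdeg d (planeEval_mem_homogeneousPart α γ h₁.1)
      (planeEval_mem_homogeneousPart α γ h₁.2)
  -- If θ = γ η, then η has orders p, q, s, so its values are combinations of those of the two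
  -- pairs. Comparing coefficients of the first pair gives 1 = γ a, which is impossible for the
  -- prime γ.
  · rintro ⟨η, hη⟩
    rw [hB0] at hη
    have hηf : ∀ f, θ f = linForm γ * η f := fun f => by rw [hη]; rfl
    have hcop : ∀ {δ : Dual K V} {m : ℕ}, LinearIndependent K ![δ, γ] →
        linForm δ ^ m ∣ θ (linForm δ) → linForm δ ^ m ∣ η (linForm δ) := by
      intro δ m hδ hdvd
      rw [hηf] at hdvd
      exact (linForm_prime (hδ.ne_zero 0 : δ ≠ 0)).pow_dvd_of_dvd_mul_left m
        (not_linForm_dvd_linForm hδ) hdvd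
    obtain ⟨a, b, ha, hb⟩ := exists_eq_planeEval hind hc
      (h₁.mono le_rfl le_rfl (Nat.le_succ s)) h₂ hdet (hcop hind hθmem.1)
      (hcop hind3 hθmem.2.1) (by
        have := hθmem.2.2
        rw [hηf, pow_succ'] at this
        exact (mul_dvd_mul_iff_left hγ.ne_zero).1 this)
    have h1 : E f₁ = linForm γ * (a * E f₁ + b * E f₂) := by rw [← ha, ← hηf, hθα]
    have h2 : E g₁ = linForm γ * (a * E g₁ + b * E g₂) := by rw [← hb, ← hηf, hθβ]
    have h3 : (1 - linForm γ * a) * (E f₁ * E g₂ - E f₂ * E g₁) = 0 := by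
      linear_combination E g₂ * h1 - E f₂ * h2
    have h4 := (mul_eq_zero.1 h3).resolve_right hdetE
    exact hγ.not_isUnit (IsUnit.of_mul_eq_one a (sub_eq_zero.1 h4).symm)
  · rw [hB1]
    exact fun δ => mul_mem_homogeneousPart (linForm_mem_homogeneousPart γ)
      (hψdeg e (planeEval_mem_homogeneousPart α γ h₂.1)
        (planeEval_mem_homogeneousPart α γ h₂.2) δ)
  · constructor
    · simp [α]
    · change v.coord 1 _ = 0
      rw [Basis.coord_apply, Basis.repr_self]
      exact Finsupp.single_eq_of_ne (by simp [Fin.ext_iff])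
  · rw [hB]
    exact hD _

end EulerMultiplicity

/-! ### Frames and arrangements of hyperplanes x i = x j. -/

section Frames

variable {K : Type*} [Field K] {V : Type*} [AddCommGroup V] [Module K V] {ι : Type*}

/-- The linear forms `x i`, taken up to a common summand, are coordinates that identify `V` with
the space of functions on `ι` modulo constant functions. -/
structure IsBraidFrame (x : ι → Dual K V) : Prop where
  exists_vector : ∀ c : ι → K, ∃ v, ∀ i j, (x i - x j) v = c i - c j
  eq_zero : ∀ v, (∀ i j, (x i - x j) v = 0) → v = 0

namespace IsBraidFrame

variable {x : ι → Dual K V}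

open Classical in
theorem exists_indicator (hx : IsBraidFrame x) (P : ι → Prop) :
    ∃ v, ∀ i j, (x i - x j) v = (if P i then 1 else 0) - (if P j then 1 else 0) :=
  hx.exists_vector fun i => if P i then 1 else 0

/-- The coordinates `x i - x i₀`. -/
noncomputable def basis (hx : IsBraidFrame x) [Fintype ι] (i₀ : ι) :
    Basis {i // i ≠ i₀} K V :=
  Basis.ofEquivFun (LinearEquiv.ofBijective
    (LinearMap.pi fun i : {i // i ≠ i₀} => (x i - x i₀ : V →ₗ[K] K)) (by
      classical
      constructor
      · refine (injective_iff_map_eq_zero _).2 fun v hv => hx.eq_zero v ?_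
        have h : ∀ i, (x i - x i₀) v = 0 := fun i => by
          by_cases hi : i = i₀
          · simp [hi]
          · exact congrFun hv ⟨i, hi⟩
        intro i j
        have : x i - x j = (x i - x i₀) - (x j - x i₀) := by abel
        rw [this, LinearMap.sub_apply, h, h, sub_zero]
      · intro c
        obtain ⟨v, hv⟩ := hx.exists_vector fun i => if h : i ≠ i₀ then c ⟨i, h⟩ else 0
        refine ⟨v, funext fun i => ?_⟩
        have := hv i i₀
        rw [dif_pos i.2, dif_neg (by simp), sub_zero] at this
        exact this))

theorem finiteDimensional (hx : IsBraidFrame x) [Fintype ι] [Nonempty ι] :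
    FiniteDimensional K V := by
  classical
  exact (hx.basis (Classical.arbitrary ι)).finiteDimensional_of_finite

theorem pair_subset_of_ker_le (hx : IsBraidFrame x) {i j s t : ι} (hst : s ≠ t)
    (h : LinearMap.ker (x i - x j) ≤ LinearMap.ker (x s - x t)) :
    (s = i ∧ t = j) ∨ (s = j ∧ t = i) := by
  classical
  have key : ∀ P : ι → Prop, (P i ↔ P j) → (P s ↔ P t) := by
    intro P hP
    obtain ⟨v, hv⟩ := hx.exists_indicator P
    have h1 : v ∈ LinearMap.ker (x i - x j) := by
      rw [LinearMap.mem_ker, hv]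
      simp [hP]
    have h2 := h h1
    rw [LinearMap.mem_ker, hv, sub_eq_zero] at h2
    by_cases h3 : P s <;> by_cases h4 : P t <;> simp_all
  have h1 := key (· = s)
  have h2 := key (· = t)
  grind

theorem iff_of_inf_le (hx : IsBraidFrame x) {i j a c s t : ι}
    (h : LinearMap.ker (x i - x j) ⊓ LinearMap.ker (x a - x c) ≤ LinearMap.ker (x s - x t)) :
    ∀ P : ι → Prop, (P i ↔ P j) → (P a ↔ P c) → (P s ↔ P t) := by
  classical
  intro P hP hP'
  obtain ⟨v, hv⟩ := hx.exists_indicator P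
  have h1 : v ∈ LinearMap.ker (x i - x j) ⊓ LinearMap.ker (x a - x c) := by
    rw [Submodule.mem_inf, LinearMap.mem_ker, LinearMap.mem_ker, hv, hv]
    simp [hP, hP']
  have h2 := h h1
  rw [LinearMap.mem_ker, hv, sub_eq_zero] at h2
  by_cases h3 : P s <;> by_cases h4 : P t <;> simp_all

theorem sub_ne_zero (hx : IsBraidFrame x) {i j : ι} (hij : i ≠ j) : x i - x j ≠ 0 := by
  intro h0
  obtain ⟨v, hv⟩ := hx.exists_indicator (· = i)
  have := hv i j
  simp [h0, hij.symm] at this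

theorem linearIndependent_pair (hx : IsBraidFrame x) {i j a c : ι} (hij : i ≠ j) (hac : a ≠ c)
    (h : ¬ ((i = a ∧ j = c) ∨ (i = c ∧ j = a))) :
    LinearIndependent K ![x i - x j, x a - x c] := by
  rw [LinearIndependent.pair_iff' (hx.sub_ne_zero hij)]
  intro b hb
  have hle : LinearMap.ker (x i - x j) ≤ LinearMap.ker (x a - x c) := by
    rw [← hb]
    intro v hv
    rw [LinearMap.mem_ker] at hv ⊢
    rw [LinearMap.smul_apply, hv, smul_zero]
  have := hx.pair_subset_of_ker_le hac hle
  grind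

/-- On the hyperplane `x a = x c`, the coordinates other than `x c` form a frame. -/
theorem restrict (hx : IsBraidFrame x) {a c : ι} (hac : a ≠ c) :
    IsBraidFrame (fun i : {i // i ≠ c} =>
      (LinearMap.ker (x a - x c)).dualRestrict (x i)) := by
  classical
  constructor
  · intro f
    obtain ⟨v, hv⟩ := hx.exists_vector fun i => if h : i ≠ c then f ⟨i, h⟩ else f ⟨a, hac⟩
    refine ⟨⟨v, ?_⟩, fun i j => ?_⟩
    · rw [LinearMap.mem_ker, hv]
      simp [hac]
    · have := hv i j
      rw [dif_pos i.2, dif_pos j.2] at this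
      exact this
  · rintro ⟨v, hv⟩ h
    have h1 : ∀ i j, i ≠ c → j ≠ c → x i v = x j v := fun i j hi hj =>
      sub_eq_zero.1 (h ⟨i, hi⟩ ⟨j, hj⟩)
    have h2 : x a v = x c v := sub_eq_zero.1 hv
    refine Subtype.ext (hx.eq_zero v fun i j => sub_eq_zero.2 ?_)
    change x i v = x j v
    by_cases hi : i = c <;> by_cases hj : j = c
    · rw [hi, hj]
    · rw [hi, ← h2]
      exact h1 _ _ hac hj
    · rw [hj, ← h2]
      exact h1 _ _ hi hac
    · exact h1 _ _ hi hj

end IsBraidFrame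

namespace MultiArrangement

/-- `A` consists of the hyperplanes `x i = x j`, with multiplicities `w i j`. -/
structure IsGraphic (A : MultiArrangement K V) (x : ι → Dual K V) (w : ι → ι → ℕ) : Prop where
  mult_eq : ∀ i j, i ≠ j → A.mult (LinearMap.ker (x i - x j)) = w i j
  exists_pair : ∀ H ∈ A.hyperplanes, ∃ i j, i ≠ j ∧ LinearMap.ker (x i - x j) = H

theorem ker_sub_comm (x : ι → Dual K V) (i j : ι) :
    LinearMap.ker (x i - x j) = LinearMap.ker (x j - x i) := by
  rw [← neg_sub, LinearMap.ker_neg]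

theorem IsGraphic.congr {A : MultiArrangement K V} {x : ι → Dual K V} {w w' : ι → ι → ℕ}
    (h : A.IsGraphic x w) (hw : ∀ i j, i ≠ j → w i j = w' i j) : A.IsGraphic x w' :=
  ⟨fun i j hij => (h.1 i j hij).trans (hw i j hij), h.2⟩

/-- A hyperplane determines its pair of indices up to order, so a symmetric w is well defined on
hyperplanes. -/
theorem exists_isGraphic [Finite ι] {x : ι → Dual K V} (hx : IsBraidFrame x) {w : ι → ι → ℕ}
    (hw : ∀ i j, w i j = w j i) : ∃ A : MultiArrangement K V, A.IsGraphic x w := by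
  classical
  have := Fintype.ofFinite ι
  let P : Submodule K V → ι × ι → Prop := fun H p => p.1 ≠ p.2 ∧ LinearMap.ker (x p.1 - x p.2) = H
  let f : Submodule K V → ℕ := fun H => if h : ∃ p, P H p then w h.choose.1 h.choose.2 else 0
  have hf : ∀ H, f H ≠ 0 → ∃ p, P H p := by
    intro H hH
    by_contra hc
    exact hH (dif_neg hc)
  let m : Submodule K V →₀ ℕ := Finsupp.onFinset
    (Finset.univ.image fun p : ι × ι => LinearMap.ker (x p.1 - x p.2)) f (by
      intro H hH
      obtain ⟨p, -, hp⟩ := hf H hH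
      exact Finset.mem_image.2 ⟨p, Finset.mem_univ _, hp⟩)
  have hm : ∀ H, m H = f H := fun H => rfl
  refine ⟨⟨m, fun H hH => ?_⟩, fun i j hij => ?_, fun H hH => ?_⟩
  · rw [Finsupp.mem_support_iff, hm] at hH
    obtain ⟨p, hp, rfl⟩ := hf H hH
    exact isCoatom_ker (hx.sub_ne_zero hp)
  · have hex : ∃ p, P (LinearMap.ker (x i - x j)) p := ⟨(i, j), hij, rfl⟩
    change f _ = _
    simp only [f]
    rw [dif_pos hex]
    obtain ⟨h1, h2⟩ := hex.choose_spec
    rcases hx.pair_subset_of_ker_le hij h2.le with ⟨h3, h4⟩ | ⟨h3, h4⟩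
    · rw [← h3, ← h4]
    · rw [← h3, ← h4, hw]
  · rw [hyperplanes, Finsupp.mem_support_iff] at hH
    obtain ⟨p, hp, hpH⟩ := hf H hH
    exact ⟨p.1, p.2, hp, hpH⟩

theorem IsGraphic.mem_derivations_iff {A : MultiArrangement K V} {x : ι → Dual K V}
    {w : ι → ι → ℕ} (h : A.IsGraphic x w) {θ : Der K V} : θ ∈ A.derivations ↔
      ∀ i j, i ≠ j → linForm (x i - x j) ^ w i j ∣ θ (linForm (x i - x j)) := by
  rw [MultiArrangement.mem_derivations_iff
    (α := fun p : {p : ι × ι // p.1 ≠ p.2} => x p.1.1 - x p.1.2)]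
  · constructor
    · intro hθ i j hij
      have := hθ ⟨(i, j), hij⟩
      rwa [h.mult_eq _ _ hij] at this
    · rintro hθ ⟨⟨i, j⟩, hij⟩
      rw [h.mult_eq _ _ hij]
      exact hθ i j hij
  · intro H hH
    obtain ⟨i, j, hij, hH'⟩ := h.exists_pair H hH
    exact ⟨⟨(i, j), hij⟩, hH'⟩

theorem IsGraphic.deletion {A : MultiArrangement K V} {x : ι → Dual K V} {w w' : ι → ι → ℕ}
    (h : A.IsGraphic x w) (hx : IsBraidFrame x) {a c : ι} (hac : a ≠ c)
    (hw₁ : w a c = w' a c + 1) (hw₂ : w c a = w' c a + 1)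
    (hw : ∀ i j, i ≠ j → ¬ ((i = a ∧ j = c) ∨ (i = c ∧ j = a)) → w i j = w' i j) :
    (A.deletion (LinearMap.ker (x a - x c))).IsGraphic x w' := by
  classical
  refine ⟨fun i j hij => ?_, fun H hH => h.exists_pair H ?_⟩
  · change (A.mult - Finsupp.single (LinearMap.ker (x a - x c)) 1 : Submodule K V →₀ ℕ) _ = _
    rw [Finsupp.tsub_apply, h.mult_eq i j hij]
    by_cases hp : (i = a ∧ j = c) ∨ (i = c ∧ j = a)
    · rcases hp with ⟨rfl, rfl⟩ | ⟨rfl, rfl⟩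
      · rw [Finsupp.single_eq_same, hw₁, Nat.add_sub_cancel]
      · rw [ker_sub_comm x j i, Finsupp.single_eq_same, hw₂, Nat.add_sub_cancel]
    · rw [Finsupp.single_eq_of_ne, hw i j hij hp, Nat.sub_zero]
      intro heq
      have := hx.pair_subset_of_ker_le hac heq.le
      grind
  · rw [hyperplanes, Finsupp.mem_support_iff] at hH ⊢
    intro h0
    apply hH
    change (A.mult - Finsupp.single (LinearMap.ker (x a - x c)) 1 : Submodule K V →₀ ℕ) H = 0
    rw [Finsupp.tsub_apply, h0, Nat.zero_sub]

end MultiArrangement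

end Frames

/-! ### Graph multiplicities and their localizations. -/

section GraphMultiplicities

variable {K : Type*} [Field K] {V : Type*} [AddCommGroup V] [Module K V] {ι : Type*}

open Classical in
/-- The multiplicity `n i + n j`, increased by one on the edges of the graph `G`. -/
noncomputable def graphMult (n : ι → ℕ) (G : SimpleGraph ι) (i j : ι) : ℕ :=
  n i + n j + if G.Adj i j then 1 else 0

theorem graphMult_congr {ι' : Type*} {n : ι → ℕ} {n' : ι' → ℕ} {G : SimpleGraph ι}
    {G' : SimpleGraph ι'} {i j : ι} {i' j' : ι'} (hi : n i = n' i') (hj : n j = n' j')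
    (h : G.Adj i j ↔ G'.Adj i' j') : graphMult n G i j = graphMult n' G' i' j' := by
  by_cases hG : G.Adj i j <;> simp [graphMult, hi, hj, ← h, hG]

theorem graphMult_comm (n : ι → ℕ) (G : SimpleGraph ι) (i j : ι) :
    graphMult n G i j = graphMult n G j i := by
  rw [graphMult, graphMult, add_comm (n i), G.adj_comm]

/-- The graph multiplicity on `G` obtained by adding the edge `ac` restricts to the hyperplane
`x a = x c` as the graph multiplicity on the graph obtained by merging `c` into `a`. -/
structure IsMergeStep (n : ι → ℕ) (G G' : SimpleGraph ι) (a c : ι) (n'' : {i // i ≠ c} → ℕ)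
    (G'' : SimpleGraph {i // i ≠ c}) : Prop where
  ne : a ≠ c
  not_adj : ¬ G.Adj a c
  adj_iff : ∀ i j, G'.Adj i j ↔ G.Adj i j ∨ (i = a ∧ j = c) ∨ (i = c ∧ j = a)
  merge_self : n'' ⟨a, ne⟩ = n a + n c
  merge_of_ne : ∀ i : {i // i ≠ c}, (i : ι) ≠ a → n'' i = n i
  merge_adj_self : ∀ j : {i // i ≠ c}, (j : ι) ≠ a → (G''.Adj ⟨a, ne⟩ j ↔ G.Adj a j ∨ G.Adj c j)
  merge_adj_of_ne : ∀ i j : {i // i ≠ c}, (i : ι) ≠ a → (j : ι) ≠ a → (G''.Adj i j ↔ G.Adj i j)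

namespace IsMergeStep

variable {n : ι → ℕ} {G G' : SimpleGraph ι} {a c : ι} {n'' : {i // i ≠ c} → ℕ}
  {G'' : SimpleGraph {i // i ≠ c}} (h : IsMergeStep n G G' a c n'' G'')
include h

theorem graphMult_self : graphMult n G' a c = graphMult n G a c + 1 := by
  rw [graphMult, graphMult, if_pos ((h.adj_iff a c).2 (by simp)), if_neg h.not_adj]

theorem graphMult_eq : graphMult n G a c = n a + n c := by
  rw [graphMult, if_neg h.not_adj, add_zero]

theorem graphMult_of_ne {i j : ι} (hij : ¬ ((i = a ∧ j = c) ∨ (i = c ∧ j = a))) :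
    graphMult n G' i j = graphMult n G i j := by
  exact graphMult_congr rfl rfl (by rw [h.adj_iff]; tauto)

theorem deletion {A : MultiArrangement K V} {x : ι → Dual K V} (hx : IsBraidFrame x)
    (hA : A.IsGraphic x (graphMult n G')) :
    (A.deletion (LinearMap.ker (x a - x c))).IsGraphic x (graphMult n G) :=
  hA.deletion hx h.ne h.graphMult_self
    (by rw [graphMult_comm, h.graphMult_self, graphMult_comm]) fun _ _ _ => h.graphMult_of_ne

open Classical in
/-- The localization of a graphic arrangement at a codimension two subspace of `x a = x c`. -/
theorem exists_local [CharZero K] {A : MultiArrangement K V} {x : ι → Dual K V}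
    (hx : IsBraidFrame x) (hA : A.IsGraphic x (graphMult n G')) {i j : {i // i ≠ c}} (hij : i ≠ j)
    (hj : (j : ι) ≠ a) :
    ∃ p q, HasEulerPair K p q (n a + n c) (graphMult n'' G'' i j) ∧
      A.mult (LinearMap.ker (x i - x j)) = p ∧
      A.mult (LinearMap.ker (x a - x c - (x i - x j))) = q ∧
      (∀ H ∈ A.hyperplanes, LinearMap.ker (x i - x j : V →ₗ[K] K) ⊓ LinearMap.ker (x a - x c) ≤ H →
        H = LinearMap.ker (x i - x j) ∨ H = LinearMap.ker (x a - x c - (x i - x j)) ∨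
          H = LinearMap.ker (x a - x c)) ∧
      ((i : ι) = a → p + q - graphMult n'' G'' i j =
        n j + if G.Adj a j ∧ G.Adj c j then 1 else 0) := by
  obtain ⟨i, hi⟩ := i
  obtain ⟨j, hjc⟩ := j
  simp only at hj ⊢
  have hij' : i ≠ j := fun h => hij (Subtype.ext h)
  have hac := h.ne
  by_cases hia : i = a
  · subst hia
    -- Here the localization is the A₂ arrangement on a, c, j, with n a, n c, n j in the roles of
    -- n₁, n₂, n₃. The Euler multiplicity takes the maximum of the two edge indicators, which is the
    -- edge of the merged graph; p + q - d keeps the minimum, which detects a common neighbour.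
    have hsub : x i - x c - (x i - x j) = x j - x c := by abel
    have hw₁ : graphMult n G' i j = n i + n j + if G.Adj i j then 1 else 0 := by
      rw [h.graphMult_of_ne (by tauto)]
      rfl
    have hw₂ : graphMult n G' j c = n c + n j + if G.Adj c j then 1 else 0 := by
      rw [h.graphMult_of_ne (by tauto), graphMult_comm]
      rfl
    have hw₃ : graphMult n'' G'' ⟨i, hi⟩ ⟨j, hjc⟩ = n i + n c + n j +
        max (if G.Adj i j then 1 else 0) (if G.Adj c j then 1 else 0) := by
      rw [graphMult, h.merge_self, h.merge_of_ne _ hj]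
      simp only [h.merge_adj_self ⟨j, hjc⟩ hj]
      congr 1
      by_cases h1 : G.Adj i j <;> by_cases h2 : G.Adj c j <;> simp [h1, h2]
    refine ⟨graphMult n G' i j, graphMult n G' j c, ?_, hA.mult_eq i j hij',
      by rw [hsub, hA.mult_eq j c hjc], ?_, ?_⟩
    · rw [hw₁, hw₂, hw₃]
      exact hasEulerPair_of_balanced _ _ _ (by split_ifs <;> simp) (by split_ifs <;> simp)
    · intro H hH hle
      obtain ⟨s, t, hst, rfl⟩ := hA.exists_pair H hH
      have h1 : s = i ∨ s = j ∨ s = c := by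
        by_contra! hs
        exact hst ((hx.iff_of_inf_le hle (· = s) (iff_of_false hs.1.symm hs.2.1.symm)
          (iff_of_false hs.1.symm hs.2.2.symm)).1 rfl).symm
      have h2 : t = i ∨ t = j ∨ t = c := by
        by_contra! ht
        exact hst ((hx.iff_of_inf_le hle (· = t) (iff_of_false ht.1.symm ht.2.1.symm)
          (iff_of_false ht.1.symm ht.2.2.symm)).2 rfl)
      rw [hsub]
      have h3 := MultiArrangement.ker_sub_comm x s t
      rcases h1 with rfl | rfl | rfl <;> rcases h2 with rfl | rfl | rfl <;> simp_all
    · intro _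
      rw [hw₁, hw₂, hw₃]
      by_cases h1 : G.Adj i j <;> by_cases h2 : G.Adj c j <;> simp [h1, h2] <;> omega
  -- The pairs ij and ac are disjoint, so the localization has no third hyperplane and q = 0.
  · have hcl : ∀ H ∈ A.hyperplanes,
        LinearMap.ker (x i - x j : V →ₗ[K] K) ⊓ LinearMap.ker (x a - x c) ≤ H →
        H = LinearMap.ker (x i - x j) ∨ H = LinearMap.ker (x a - x c) := by
      intro H hH hle
      obtain ⟨s, t, hst, rfl⟩ := hA.exists_pair H hH
      have h1 := hx.iff_of_inf_le hle (· = s)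
      have h2 := hx.iff_of_inf_le hle (· = t)
      have h4 := hx.iff_of_inf_le hle (fun u => u = i ∨ u = j)
      have h5 := hx.iff_of_inf_le hle (fun u => u = a ∨ u = c)
      have h3 := MultiArrangement.ker_sub_comm x s t
      grind
    refine ⟨_, 0, ?_, hA.mult_eq i j hij', ?_, fun H hH hle => ?_, fun hh => absurd hh hia⟩
    · have : graphMult n'' G'' ⟨i, hi⟩ ⟨j, hjc⟩ = graphMult n G' i j := by
        rw [h.graphMult_of_ne (by tauto)]
        exact graphMult_congr (h.merge_of_ne _ hia) (h.merge_of_ne _ hj)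
          (h.merge_adj_of_ne ⟨i, hi⟩ ⟨j, hjc⟩ hia hj)
      rw [this]
      exact hasEulerPair_zero_right _ _
    -- If the kernel of x a - x c - (x i - x j) belonged to A, it would be one of the two
    -- hyperplanes of the localization; indicator vectors of a and of i exclude both.
    · by_contra hne
      have hmem : LinearMap.ker (x a - x c - (x i - x j)) ∈ A.hyperplanes :=
        Finsupp.mem_support_iff.2 hne
      obtain ⟨v, hv⟩ := hx.exists_indicator (· = i)
      obtain ⟨u, hu⟩ := hx.exists_indicator (· = a)
      rcases hcl _ hmem (by
        rintro w ⟨hw, hw'⟩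
        rw [SetLike.mem_coe, LinearMap.mem_ker] at hw hw'
        rw [LinearMap.mem_ker, LinearMap.sub_apply, hw, hw', sub_zero]) with heq | heq
      · have h1 : u ∈ LinearMap.ker (x i - x j) := by
          rw [LinearMap.mem_ker, hu, if_neg hia, if_neg hj, sub_zero]
        have h2 := h1
        rw [← heq, LinearMap.mem_ker, LinearMap.sub_apply, LinearMap.mem_ker.1 h1, hu,
          if_pos rfl, if_neg hac.symm] at h2
        simp at h2
      · have h1 : v ∈ LinearMap.ker (x a - x c) := by
          rw [LinearMap.mem_ker, hv, if_neg (Ne.symm hia), if_neg (Ne.symm hi), sub_zero]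
        have h2 := h1
        rw [← heq, LinearMap.mem_ker, LinearMap.sub_apply, LinearMap.mem_ker.1 h1, hv,
          if_pos rfl, if_neg hij'.symm] at h2
        simp at h2
    · rcases hcl H hH hle with h | h
      · exact Or.inl h
      · exact Or.inr (Or.inr h)

end IsMergeStep

end GraphMultiplicities

/-! ### The restriction of a graph multiplicity. -/

section MergeStep

variable {K : Type*} [Field K] {V : Type*} [AddCommGroup V] [Module K V] {ι : Type*}

namespace IsMergeStep

variable {n : ι → ℕ} {G G' : SimpleGraph ι} {a c : ι} {n'' : {i // i ≠ c} → ℕ}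
  {G'' : SimpleGraph {i // i ≠ c}}

theorem graphMult_merge_self (h : IsMergeStep n G G' a c n'' G'') {j : {i // i ≠ c}}
    (hj : (j : ι) ≠ a) : graphMult n'' G'' ⟨a, h.ne⟩ j ≠ 0 ↔
      graphMult n G' a j ≠ 0 ∨ graphMult n G' c j ≠ 0 := by
  classical
  have hac := h.ne
  have hjc := j.2
  rw [h.graphMult_of_ne (i := a) (by tauto), h.graphMult_of_ne (i := c) (by tauto), graphMult,
    graphMult, graphMult, h.merge_self, h.merge_of_ne _ hj]
  have h1 := h.merge_adj_self j hj
  by_cases h2 : G.Adj a j <;> by_cases h3 : G.Adj c j <;> simp [h1, h2, h3]; omega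

theorem graphMult_merge_of_ne (h : IsMergeStep n G G' a c n'' G'') {i j : {i // i ≠ c}}
    (hi : (i : ι) ≠ a) (hj : (j : ι) ≠ a) : graphMult n'' G'' i j = graphMult n G' i j := by
  rw [h.graphMult_of_ne (by tauto)]
  exact graphMult_congr (h.merge_of_ne _ hi) (h.merge_of_ne _ hj) (h.merge_adj_of_ne i j hi hj)

/-- The hyperplanes of the restriction. -/
theorem mem_hyperplanes_iff (h : IsMergeStep n G G' a c n'' G'') {x : ι → Dual K V}
    (hx : IsBraidFrame x) {A : MultiArrangement K V} (hA : A.IsGraphic x (graphMult n G'))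
    {H₀ : Submodule K V} (hH₀ : LinearMap.ker (x a - x c) = H₀) {R : MultiArrangement K H₀}
    (hR : R.IsGraphic (fun i : {i // i ≠ c} => H₀.dualRestrict (x i)) (graphMult n'' G''))
    (Y : Submodule K H₀) :
    Y ∈ R.hyperplanes ↔ ∃ H ∈ A.hyperplanes, H ≠ H₀ ∧ Y = H.comap H₀.subtype := by
  classical
  have hac := h.ne
  set y : {i // i ≠ c} → Dual K H₀ := fun i => H₀.dualRestrict (x i)
  have hcomap : ∀ i j, (LinearMap.ker (x i - x j)).comap H₀.subtype =
      LinearMap.ker (H₀.dualRestrict (x i) - H₀.dualRestrict (x j)) := fun i j => rfl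
  have hxac : H₀.dualRestrict (x c) = H₀.dualRestrict (x a) := by
    ext v
    have hv : (v : V) ∈ LinearMap.ker (x a - x c) := hH₀.symm ▸ v.2
    exact (sub_eq_zero.1 hv).symm
  have hmemA : ∀ i j, i ≠ j →
      (LinearMap.ker (x i - x j) ∈ A.hyperplanes ↔ graphMult n G' i j ≠ 0) := fun i j hij => by
    rw [MultiArrangement.hyperplanes, Finsupp.mem_support_iff, hA.mult_eq i j hij]
  have hmemR : ∀ i j, i ≠ j →
      (LinearMap.ker (y i - y j) ∈ R.hyperplanes ↔ graphMult n'' G'' i j ≠ 0) := fun i j hij => by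
    rw [MultiArrangement.hyperplanes, Finsupp.mem_support_iff, hR.mult_eq i j hij]
  have hneH : ∀ i j, i ≠ j → ¬ ((i = a ∧ j = c) ∨ (i = c ∧ j = a)) →
      LinearMap.ker (x i - x j) ≠ H₀ := by
    intro i j hij hp heq
    have := hx.pair_subset_of_ker_le hac (heq.trans hH₀.symm).le
    tauto
  constructor
  · intro hY
    obtain ⟨i, j, hij, rfl⟩ := hR.exists_pair Y hY
    wlog hj : (j : ι) ≠ a generalizing i j
    · rw [MultiArrangement.ker_sub_comm y] at hY ⊢
      refine this j i hij.symm hY fun hi => hij (Subtype.ext ?_)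
      rw [hi]
      exact (not_not.1 hj).symm
    rw [hmemR i j hij] at hY
    by_cases hi : (i : ι) = a
    · obtain rfl : i = ⟨a, hac⟩ := Subtype.ext hi
      rw [h.graphMult_merge_self hj] at hY
      have hjc := j.2
      rcases hY with hY | hY
      · exact ⟨_, (hmemA a j hj.symm).2 hY, hneH _ _ hj.symm (by tauto), (hcomap a j).symm⟩
      · refine ⟨_, (hmemA c j hjc.symm).2 hY, hneH _ _ hjc.symm (by tauto), ?_⟩
        rw [hcomap, hxac]
    · have hij' : (i : ι) ≠ j := fun h => hij (Subtype.ext h)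
      rw [h.graphMult_merge_of_ne hi hj] at hY
      exact ⟨_, (hmemA i j hij').2 hY, hneH _ _ hij' (by tauto), (hcomap i j).symm⟩
  · rintro ⟨H, hH, hne, rfl⟩
    obtain ⟨s, t, hst, rfl⟩ := hA.exists_pair H hH
    have hself : ∀ j : {i // i ≠ c}, (j : ι) ≠ a →
        (graphMult n G' a j ≠ 0 ∨ graphMult n G' c j ≠ 0) →
        LinearMap.ker (H₀.dualRestrict (x a) - H₀.dualRestrict (x j)) ∈ R.hyperplanes := by
      intro j hj hw
      exact (hmemR ⟨a, hac⟩ j (fun hh => hj (congrArg Subtype.val hh).symm)).2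
        ((h.graphMult_merge_self hj).2 hw)
    wlog hlt : t ≠ c ∧ t ≠ a generalizing s t
    · by_cases hs : s ≠ c ∧ s ≠ a
      · rw [MultiArrangement.ker_sub_comm x] at hH hne ⊢
        exact this t s hst.symm hH hne hs
      · exfalso
        apply hne
        rcases (show (s = a ∧ t = c) ∨ (s = c ∧ t = a) by grind) with ⟨rfl, rfl⟩ | ⟨rfl, rfl⟩
        · exact hH₀
        · exact (MultiArrangement.ker_sub_comm x _ _).trans hH₀
    obtain ⟨htc, hta⟩ := hlt
    rw [hmemA s t hst] at hH
    rw [hcomap]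
    by_cases hsc : s = c
    · subst hsc
      rw [hxac]
      exact hself ⟨t, htc⟩ hta (Or.inr hH)
    · by_cases hsa : s = a
      · subst hsa
        exact hself ⟨t, htc⟩ hta (Or.inl hH)
      · refine (hmemR ⟨s, hsc⟩ ⟨t, htc⟩ (fun hh => hst (congrArg Subtype.val hh))).2 ?_
        rwa [h.graphMult_merge_of_ne hsa hta]

theorem isRestriction [CharZero K] [FiniteDimensional K V] (h : IsMergeStep n G G' a c n'' G'')
    {x : ι → Dual K V} (hx : IsBraidFrame x) {A : MultiArrangement K V}
    (hA : A.IsGraphic x (graphMult n G')) {H₀ : Submodule K V}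
    (hH₀ : LinearMap.ker (x a - x c) = H₀) {R : MultiArrangement K H₀}
    (hR : R.IsGraphic (fun i : {i // i ≠ c} => H₀.dualRestrict (x i)) (graphMult n'' G'')) :
    A.IsRestriction H₀ R := by
  refine ⟨h.mem_hyperplanes_iff hx hA hH₀ hR, fun Y hY => ?_⟩
  obtain ⟨i, j, hij, rfl⟩ := hR.exists_pair Y hY
  wlog hj : (j : ι) ≠ a generalizing i j
  · rw [MultiArrangement.ker_sub_comm (fun i : {i // i ≠ c} => H₀.dualRestrict (x i))] at hY ⊢
    refine this j i hij.symm hY fun hi => hij (Subtype.ext ?_)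
    rw [hi]
    exact (not_not.1 hj).symm
  rw [hR.mult_eq i j hij]
  have hij' : (i : ι) ≠ j := fun h => hij (Subtype.ext h)
  have hjc := j.2
  have hmap : (LinearMap.ker (H₀.dualRestrict (x i) - H₀.dualRestrict (x j))).map H₀.subtype =
      LinearMap.ker (x i - x j : V →ₗ[K] K) ⊓ LinearMap.ker (x a - x c) := by
    rw [inf_comm, hH₀, ← Submodule.map_comap_subtype]
    rfl
  rw [hmap, ← hH₀]
  obtain ⟨p, q, hpair, hp, hq, hcl, -⟩ := h.exists_local hx hA hij hj
  refine MultiArrangement.isEulerMultiplicity_of_hasEulerPair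
    (hx.linearIndependent_pair hij' h.ne (by tauto)) hpair hp hq ?_ hcl
  rw [hA.mult_eq a c h.ne, h.graphMult_self, h.graphMult_eq]

end IsMergeStep

end MergeStep

/-! ### The addition theorem for one edge. -/

section MergeAddition

theorem prod_pow_dvd_of_prime {R σ : Type*} [CommRing R] [IsDomain R] (t : Finset σ) {f : σ → R}
    {m : σ → ℕ} {N : R} (hp : ∀ i ∈ t, Prime (f i))
    (hne : ∀ i ∈ t, ∀ j ∈ t, i ≠ j → ¬ f i ∣ f j) (hd : ∀ i ∈ t, f i ^ m i ∣ N) :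
    ∏ i ∈ t, f i ^ m i ∣ N := by
  classical
  induction t using Finset.induction_on with
  | empty => simp
  | insert i t hi ih =>
    have hpi := hp i (Finset.mem_insert_self _ _)
    rw [Finset.prod_insert hi, ← pow_one (∏ i ∈ t, f i ^ m i)]
    refine hpi.pow_mul_pow_dvd (fun h => ?_) (hd i (Finset.mem_insert_self _ _)) ?_
    · obtain ⟨j, hj, hij⟩ := hpi.exists_mem_finset_dvd h
      exact hne i (Finset.mem_insert_self _ _) j (Finset.mem_insert_of_mem hj)
        (fun h => hi (h ▸ hj)) (hpi.dvd_of_dvd_pow hij)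
    · rw [pow_one]
      exact ih (fun j hj => hp j (Finset.mem_insert_of_mem hj))
        (fun j hj k hk => hne j (Finset.mem_insert_of_mem hj) k (Finset.mem_insert_of_mem hk))
        (fun j hj => hd j (Finset.mem_insert_of_mem hj))

variable {K : Type*} [Field K] {V : Type*} [AddCommGroup V] [Module K V] {ι : Type*}

namespace IsMergeStep

variable {n : ι → ℕ} {G G' : SimpleGraph ι} {a c : ι} {n'' : {i // i ≠ c} → ℕ}
  {G'' : SimpleGraph {i // i ≠ c}} (h : IsMergeStep n G G' a c n'' G'')
  {x : ι → Dual K V} (hx : IsBraidFrame x) {A : MultiArrangement K V}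
  (hA : A.IsGraphic x (graphMult n G')) {H₀ : Submodule K V}
  (hH₀ : LinearMap.ker (x a - x c) = H₀)
include h hx hA hH₀

/-- Each condition on H concerns a single codimension two subspace, so the rank two statement
`HasEulerPair.pow_dvd_restrict` suffices. -/
theorem mem_derivations_restriction [CharZero K] [FiniteDimensional K V]
    {R : MultiArrangement K H₀}
    (hR : R.IsGraphic (fun i : {i // i ≠ c} => H₀.dualRestrict (x i)) (graphMult n'' G''))
    {φ : Der K V} (hφ : φ ∈ A.derivations) {ρ : Der K H₀} (hρ : ∀ α : Dual K V,
      ρ (linForm (H₀.dualRestrict α)) = PolyRing.restrict H₀ (φ (linForm α))) :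
    ρ ∈ R.derivations := by
  rw [hR.mem_derivations_iff]
  intro i j hij
  wlog hj : (j : ι) ≠ a generalizing i j
  · rw [graphMult_comm]
    refine linForm_pow_dvd_of_ker_eq (MultiArrangement.ker_sub_comm
      (fun i : {i // i ≠ c} => H₀.dualRestrict (x i)) _ _) (this j i hij.symm fun hi =>
        hij (Subtype.ext ?_))
    rw [hi]
    exact (not_not.1 hj).symm
  have hij' : (i : ι) ≠ j := fun h => hij (Subtype.ext h)
  have hjc := j.2
  obtain ⟨p, q, hpair, hp, hq, hcl, -⟩ := h.exists_local hx hA hij hj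
  have hmem : ∀ α : Dual K V, linForm α ^ A.mult (LinearMap.ker α) ∣ φ (linForm α) := by
    intro α
    by_cases hα : A.mult (LinearMap.ker α) = 0
    · simp [hα]
    · exact hφ _ (Finsupp.mem_support_iff.2 hα) _ rfl
  have := hpair.pow_dvd_restrict (hx.linearIndependent_pair hij' h.ne (by tauto)) hH₀ (φ := φ)
    (by rw [← hp]; exact hmem _) (by rw [← hq]; exact hmem _)
    (by rw [← h.graphMult_eq, ← h.graphMult_self, ← hA.mult_eq a c h.ne]; exact hmem _)
  rw [← map_sub, hρ]
  exact this

theorem mem_derivations_iff {φ : Der K V} : φ ∈ A.derivations ↔ φ ∈ (A.deletion H₀).derivations ∧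
    linForm (x a - x c) ^ (n a + n c + 1) ∣ φ (linForm (x a - x c)) := by
  subst hH₀
  have hac := h.ne
  rw [hA.mem_derivations_iff, (h.deletion hx hA).mem_derivations_iff]
  constructor
  · refine fun hφ => ⟨fun i j hij => (pow_dvd_pow _ ?_).trans (hφ i j hij), ?_⟩
    · by_cases hp : (i = a ∧ j = c) ∨ (i = c ∧ j = a)
      · rcases hp with ⟨rfl, rfl⟩ | ⟨rfl, rfl⟩
        · rw [h.graphMult_self]
          exact Nat.le_succ _
        · rw [graphMult_comm, graphMult_comm n G', h.graphMult_self]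
          exact Nat.le_succ _
      · rw [h.graphMult_of_ne hp]
    · have := hφ a c hac
      rwa [h.graphMult_self, h.graphMult_eq] at this
  · rintro ⟨hφ, hac'⟩ i j hij
    rw [← h.graphMult_eq, ← h.graphMult_self] at hac'
    by_cases hp : (i = a ∧ j = c) ∨ (i = c ∧ j = a)
    · rcases hp with ⟨rfl, rfl⟩ | ⟨rfl, rfl⟩
      · exact hac'
      · rw [graphMult_comm]
        exact linForm_pow_dvd_of_ker_eq (MultiArrangement.ker_sub_comm x _ _) hac'
    · rw [h.graphMult_of_ne hp]
      exact hφ i j hij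

/-- The forms of the other hyperplanes are coprime to γ, so cancelling γ lowers the order only along
its own hyperplane. -/
theorem mem_derivations_of_smul_mem [FiniteDimensional K V] {η : Der K V}
    (hη : linForm (x a - x c) • η ∈ A.derivations) : η ∈ (A.deletion H₀).derivations := by
  subst hH₀
  have hac := h.ne
  rw [hA.mem_derivations_iff] at hη
  rw [(h.deletion hx hA).mem_derivations_iff]
  have hself : linForm (x a - x c) ^ graphMult n G a c ∣ η (linForm (x a - x c)) := by
    have h1 := hη a c hac
    rw [h.graphMult_self, pow_succ', Derivation.smul_apply, smul_eq_mul] at h1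
    exact (mul_dvd_mul_iff_left (linForm_prime (hx.sub_ne_zero hac)).ne_zero).1 h1
  intro i j hij
  by_cases hp : (i = a ∧ j = c) ∨ (i = c ∧ j = a)
  · rcases hp with ⟨rfl, rfl⟩ | ⟨rfl, rfl⟩
    · exact hself
    · rw [graphMult_comm]
      exact linForm_pow_dvd_of_ker_eq (MultiArrangement.ker_sub_comm x _ _) hself
  · have h1 := hη i j hij
    rw [h.graphMult_of_ne hp, Derivation.smul_apply, smul_eq_mul] at h1
    exact (linForm_prime (hx.sub_ne_zero hij)).pow_dvd_of_dvd_mul_left _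
      (not_linForm_dvd_linForm (hx.linearIndependent_pair hij hac hp)) h1

open Classical in
/-- The addition theorem for adding an edge to a graph multiplicity. -/
theorem isFreeWithExponents [CharZero K] [FiniteDimensional K V] [Fintype ι]
    {R : MultiArrangement K H₀}
    (hR : R.IsGraphic (fun i : {i // i ≠ c} => H₀.dualRestrict (x i)) (graphMult n'' G''))
    {D : ℕ} (hD : D = ∑ i, n i + (Finset.univ.filter fun j => G.Adj a j ∧ G.Adj c j).card)
    {e : Multiset ℕ} (he' : (A.deletion H₀).IsFreeWithExponents (D ::ₘ e))
    (he'' : R.IsFreeWithExponents e) : A.IsFreeWithExponents ((D + 1) ::ₘ e) := by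
  have hac := h.ne
  have hy : IsBraidFrame fun i : {i // i ≠ c} => H₀.dualRestrict (x i) := by
    subst hH₀
    exact hx.restrict hac
  let t : Finset {i // i ≠ c} := Finset.univ.erase ⟨a, hac⟩
  -- These are the exponents p + q - d of the localizations at x a = x c = x j. The product B of the
  -- corresponding powers divides every restricted cofactor, and D is s = n a + n c plus the degree
  -- of B.
  let b : {i // i ≠ c} → ℕ := fun j => n j + if G.Adj a j ∧ G.Adj c j then 1 else 0
  have hta : ∀ j ∈ t, (⟨a, hac⟩ : {i // i ≠ c}) ≠ j := fun j hj => (Finset.ne_of_mem_erase hj).symm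
  have hta' : ∀ j ∈ t, (j : ι) ≠ a := fun j hj hja => hta j hj (Subtype.ext hja.symm)
  let ℓ : {i // i ≠ c} → PolyRing K H₀ := fun j => linForm (H₀.dualRestrict (x a - x j))
  have hℓ : ∀ j ∈ t, Prime (ℓ j) := by
    intro j hj
    refine linForm_prime ?_
    rw [map_sub]
    exact hy.sub_ne_zero (hta j hj)
  have hD' : D = n a + n c + ∑ j ∈ t, b j := by
    have hsum : ∀ f : ι → ℕ, ∑ i, f i = f a + f c + ∑ j ∈ t, f j := by
      intro f
      rw [← Finset.add_sum_erase _ _ (Finset.mem_univ c), ← Finset.sum_subtype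
        (Finset.univ.erase c) (p := fun i => i ≠ c) (by simp) f |>.symm,
        ← Finset.add_sum_erase _ _ (Finset.mem_univ (⟨a, hac⟩ : {i // i ≠ c}))]
      ring
    rw [hD, Finset.card_filter, hsum, hsum fun j => if G.Adj a j ∧ G.Adj c j then 1 else 0,
      Finset.sum_add_distrib, if_neg (by simp), if_neg (by simp)]
    ring
  rw [hD'] at he' ⊢
  refine MultiArrangement.addition (hx.sub_ne_zero hac) hH₀ (B := ∏ j ∈ t, ℓ j ^ b j)
    (R := R) (A' := A.deletion H₀) ?_ (fun φ => h.mem_derivations_iff hx hA hH₀)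
    (fun η => h.mem_derivations_of_smul_mem hx hA hH₀)
    (fun φ hφ ρ hρ => h.mem_derivations_restriction hx hA hH₀ hR hφ hρ) ?_ ?_ ?_ he' he''
  · intro φ hφ
    subst hH₀
    rw [← h.graphMult_eq]
    exact (h.deletion hx hA).mem_derivations_iff.1 hφ a c hac
  · exact prod_mem_homogeneousPart t _ b fun j _ => linForm_pow_mem_homogeneousPart _ _
  · exact Finset.prod_ne_zero_iff.2 fun j hj => pow_ne_zero _ (hℓ j hj).ne_zero
  · intro φ hφ u hu
    refine prod_pow_dvd_of_prime t hℓ (fun i hi j hj hij hdvd => ?_) (fun j hj => ?_)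
    · have hker := linForm_dvd_linForm_iff.1 hdvd
      rw [map_sub, map_sub] at hker
      have := hy.pair_subset_of_ker_le (i := ⟨a, hac⟩) (j := i) (s := ⟨a, hac⟩) (t := j)
        (hta j hj) hker
      have h1 := hta i hi
      grind
    · obtain ⟨p, q, hpair, hp, hq, -, hb⟩ := h.exists_local hx hA (hta j hj) (hta' j hj)
      have hjc := j.2
      have hja := hta' j hj
      have hdel := h.deletion hx hA
      rw [hH₀] at hdel
      rw [hdel.mem_derivations_iff] at hφ
      have := hpair.pow_dvd_restrict_cofactor
        (hx.linearIndependent_pair hja.symm hac (by simp; tauto)) hH₀ (φ := φ) ?_ ?_ hu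
      · rw [hb rfl] at this
        exact this
      · rw [← hp, hA.mult_eq a j hja.symm, h.graphMult_of_ne (by tauto)]
        exact hφ a j hja.symm
      · have hsub : x a - x c - (x a - x j) = x j - x c := by abel
        simp only at hq ⊢
        rw [hsub] at hq ⊢
        rw [← hq, hA.mult_eq j c hjc, h.graphMult_of_ne (by tauto)]
        exact hφ j c hjc

end IsMergeStep

end MergeAddition

/-! ### Inductive freeness of graph multiplicities: merge steps and the empty case. -/

section GraphicFreeness

universe u v w

/-- Every multiarrangement with the graph multiplicity of `n` and `G`, with respect to any frame
indexed by `ι`, is inductively free, and free with exponents `e`. -/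
def IsFreeGraphMult (K : Type u) [Field K] {ι : Type w} (n : ι → ℕ) (G : SimpleGraph ι)
    (e : Multiset ℕ) : Prop :=
  ∀ (V : Type v) [AddCommGroup V] [Module K V] (x : ι → Dual K V), IsBraidFrame x →
    ∀ A : MultiArrangement K V, A.IsGraphic x (graphMult n G) →
      IsInductivelyFree A ∧ A.IsFreeWithExponents e

variable {K : Type u} [Field K] {ι : Type w}

/-- Only the multiplicities matter, not the weights and the graph that present them. The passage
from a full star to an edgeless graph of larger weight rests on this. -/
theorem IsFreeGraphMult.congr {n n' : ι → ℕ} {G G' : SimpleGraph ι} {e : Multiset ℕ}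
    (h : IsFreeGraphMult.{u, v} K n G e)
    (hn : ∀ i j, i ≠ j → graphMult n' G' i j = graphMult n G i j) :
    IsFreeGraphMult.{u, v} K n' G' e :=
  fun V _ _ x hx A hA => h V x hx A (hA.congr hn)

open Classical in
theorem IsMergeStep.isFreeGraphMult [CharZero K] [Fintype ι] {n : ι → ℕ} {G G' : SimpleGraph ι}
    {a c : ι} {n'' : {i // i ≠ c} → ℕ} {G'' : SimpleGraph {i // i ≠ c}}
    (h : IsMergeStep n G G' a c n'' G'') {D : ℕ} {e : Multiset ℕ}
    (hD : D = ∑ i, n i + (Finset.univ.filter fun j => G.Adj a j ∧ G.Adj c j).card)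
    (h' : IsFreeGraphMult.{u, v} K n G (D ::ₘ e)) (h'' : IsFreeGraphMult.{u, v} K n'' G'' e) :
    IsFreeGraphMult.{u, v} K n G' ((D + 1) ::ₘ e) := by
  intro V _ _ x hx A hA
  have : Nonempty ι := ⟨a⟩
  have := hx.finiteDimensional
  obtain ⟨R, hR⟩ := MultiArrangement.exists_isGraphic (hx.restrict h.ne) (graphMult_comm n'' G'')
  obtain ⟨hdel, he'⟩ := h' V x hx _ (h.deletion hx hA)
  obtain ⟨hres, he''⟩ := h'' _ _ (hx.restrict h.ne) R hR
  refine ⟨IsInductivelyFree.step A _ ?_ R (h.isRestriction hx hA rfl hR) hdel hres _ _ he' he''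
    (Multiset.le_cons_self _ _), h.isFreeWithExponents hx hA rfl hR hD he' he''⟩
  rw [MultiArrangement.hyperplanes, Finsupp.mem_support_iff, hA.mult_eq a c h.ne,
    h.graphMult_self]
  exact Nat.succ_ne_zero _

theorem MultiArrangement.isFreeWithExponents_empty {V : Type v} [AddCommGroup V] [Module K V]
    {σ : Type*} [Fintype σ] (v : Basis σ K V) :
    (MultiArrangement.empty K V).IsFreeWithExponents (Multiset.replicate (Fintype.card σ) 0) := by
  classical
  have hdir : ∀ w : V, ∃ θ : Der K V, IsDirectional θ w := fun w =>
    Der.exists_of_linearMap ((Algebra.linearMap K (PolyRing K V)) ∘ₗ Dual.eval K V w)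
  choose θ hθ using hdir
  have hcoord : ∀ i j, θ (v i) (linForm (v.coord j)) = if i = j then 1 else 0 := by
    intro i j
    rw [hθ, Basis.coord_apply, Basis.repr_self, Finsupp.single_apply]
    split_ifs <;> simp
  refine isFreeWithExponents_of_family (fun i => θ (v i)) (fun i H hH => ?_) ?_ ?_ (d := fun _ => 0)
    (fun i α => ?_) ?_
  · simp [hyperplanes, empty] at hH
  · rw [Fintype.linearIndependent_iff]
    intro g hg j
    have := congrArg (fun η : Der K V => η (linForm (v.coord j))) hg
    simpa [Der.sum_smul_apply, hcoord] using this
  · intro η _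
    have : η = ∑ i, η (linForm (v.coord i)) • θ (v i) := by
      refine Der.ext_basis v fun j => ?_
      rw [Der.sum_smul_apply]
      simp [hcoord]
    rw [this]
    exact Submodule.sum_mem _ fun i _ => Submodule.smul_mem _ _ (Submodule.subset_span ⟨i, rfl⟩)
  · rw [hθ]
    exact algebraMap_mem_homogeneousPart _
  · simp [Finset.card_univ]

theorem isFreeGraphMult_zero [Fintype ι] [Nonempty ι] :
    IsFreeGraphMult.{u, v} K (0 : ι → ℕ) ⊥ (Multiset.replicate (Fintype.card ι - 1) 0) := by
  classical
  intro V _ _ x hx A hA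
  have := hx.finiteDimensional
  have hA0 : A = MultiArrangement.empty K V := by
    have hm : A.mult = 0 := by
      ext H
      by_contra hH
      obtain ⟨i, j, hij, rfl⟩ := hA.exists_pair H (Finsupp.mem_support_iff.2 hH)
      rw [hA.mult_eq i j hij] at hH
      simp [graphMult] at hH
    obtain ⟨m, hc⟩ := A
    simp only at hm
    subst hm
    rfl
  subst hA0
  refine ⟨IsInductivelyFree.empty, ?_⟩
  have := MultiArrangement.isFreeWithExponents_empty (hx.basis (Classical.arbitrary ι))
  rwa [Fintype.card_subtype_compl, Fintype.card_subtype_eq] at this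

open Classical in
/-- The weights obtained from `n` by merging `c` into `a`. -/
noncomputable def mergeWeight (n : ι → ℕ) (a c : ι) (i : {i // i ≠ c}) : ℕ :=
  if (i : ι) = a then n a + n c else n i

theorem sum_mergeWeight [Fintype ι] [DecidableEq ι] (n : ι → ℕ) {a c : ι} (hac : a ≠ c) :
    ∑ i, mergeWeight n a c i = ∑ i, n i := by
  have hsum : ∀ f : ι → ℕ, ∑ i, f i = f c + ∑ i : {i // i ≠ c}, f i := by
    intro f
    rw [← Finset.add_sum_erase _ _ (Finset.mem_univ c), ← Finset.sum_subtype
      (Finset.univ.erase c) (p := fun i => i ≠ c) (by simp) f]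
  rw [hsum n, ← Finset.add_sum_erase _ _ (Finset.mem_univ (⟨a, hac⟩ : {i // i ≠ c})),
    ← Finset.add_sum_erase _ (fun i : {i // i ≠ c} => n i)
      (Finset.mem_univ (⟨a, hac⟩ : {i // i ≠ c}))]
  have : ∑ i ∈ Finset.univ.erase (⟨a, hac⟩ : {i // i ≠ c}), mergeWeight n a c i =
      ∑ i ∈ Finset.univ.erase (⟨a, hac⟩ : {i // i ≠ c}), n i := by
    refine Finset.sum_congr rfl fun i hi => if_neg fun h => ?_
    exact Finset.ne_of_mem_erase hi (Subtype.ext h)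
  rw [this]
  simp only [mergeWeight, if_true]
  ring

/-- The star with center `a` and leaves `T`. -/
def starGraphOn (a : ι) (T : Finset ι) : SimpleGraph ι :=
  SimpleGraph.fromRel fun i j => i = a ∧ j ∈ T

/-- The complete graph on `U`, together with edges from `a` to the vertices in `T`. -/
def coneGraph (U : Finset ι) (a : ι) (T : Finset ι) : SimpleGraph ι :=
  SimpleGraph.fromRel fun i j => (i ∈ U ∧ j ∈ U) ∨ (i = a ∧ j ∈ T)

/-- The complete graph on `U`. -/
def cliqueGraph (U : Finset ι) : SimpleGraph ι :=
  SimpleGraph.fromRel fun i j => i ∈ U ∧ j ∈ U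

open Classical in
-- The new leaf c is isolated in the smaller star, so merging it into the center leaves the star on
-- T.
theorem isMergeStep_star (n : ι → ℕ) {a c : ι} {T : Finset ι} (ha : a ∉ T) (hc : c ∉ T)
    (hac : a ≠ c) : IsMergeStep n (starGraphOn a T) (starGraphOn a (insert c T)) a c
      (mergeWeight n a c) (starGraphOn ⟨a, hac⟩ (T.subtype (· ≠ c))) where
  ne := hac
  not_adj := by simp [starGraphOn]; tauto
  adj_iff i j := by
    simp only [starGraphOn, SimpleGraph.fromRel_adj, Finset.mem_insert]
    grind
  merge_self := if_pos rfl
  merge_of_ne i hi := if_neg hi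
  merge_adj_self j hj := by
    simp only [starGraphOn, SimpleGraph.fromRel_adj, Finset.mem_subtype, Subtype.ext_iff, ne_eq]
    grind
  merge_adj_of_ne i j hi hj := by
    simp only [starGraphOn, SimpleGraph.fromRel_adj, Finset.mem_subtype, Subtype.ext_iff, ne_eq]

open Classical in
-- The cone vertex a is absorbed by c, which is already adjacent to all of U; the edges of a become
-- redundant and the clique on U remains.
theorem isMergeStep_cone (n : ι → ℕ) {a c : ι} {U T : Finset ι} (ha : a ∉ U) (hT : T ⊆ U)
    (hcU : c ∈ U) (hc : c ∉ T) (hca : c ≠ a) :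
    IsMergeStep n (coneGraph U a T) (coneGraph U a (insert c T)) c a
      (mergeWeight n c a) (cliqueGraph (U.subtype (· ≠ a))) where
  ne := hca
  not_adj := by simp [coneGraph]; grind
  adj_iff i j := by
    simp only [coneGraph, SimpleGraph.fromRel_adj, Finset.mem_insert]
    grind
  merge_self := if_pos rfl
  merge_of_ne i hi := if_neg hi
  merge_adj_self j hj := by
    simp only [coneGraph, cliqueGraph, SimpleGraph.fromRel_adj, Finset.mem_subtype,
      Subtype.ext_iff, ne_eq]
    grind
  merge_adj_of_ne i j hi hj := by
    have := i.2
    have := j.2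
    simp only [coneGraph, cliqueGraph, SimpleGraph.fromRel_adj, Finset.mem_subtype,
      Subtype.ext_iff, ne_eq]
    grind

end GraphicFreeness

/-! ### Exponents of stars and cliques. -/

section StarAndClique

universe u v w

variable {K : Type u} [Field K] [CharZero K]

open Classical in
theorem card_subtype_ne_of_notMem {ι : Type w} {T : Finset ι} {c : ι} (hc : c ∉ T) :
    (T.subtype (· ≠ c)).card = T.card := by
  rw [Finset.card_subtype, Finset.filter_true_of_mem]
  rintro i hi rfl
  exact hc hi

/-- The exponents of the graph multiplicity of a star. -/
theorem isFreeGraphMult_star {ι : Type w} [Fintype ι] (n : ι → ℕ) {a : ι} {T : Finset ι}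
    (ha : a ∉ T) : IsFreeGraphMult.{u, v} K n (starGraphOn a T)
      (Multiset.replicate T.card (∑ i, n i + 1) +
        Multiset.replicate (Fintype.card ι - 1 - T.card) (∑ i, n i)) := by
  classical
  induction hN : Fintype.card ι generalizing ι with
  | zero => exact absurd hN (Fintype.card_pos_iff.2 ⟨a⟩).ne'
  | succ N ihN =>
    -- Leaves are added one at a time. The restriction has one vertex less, so it is covered by the
    -- outer induction, and the absence of common neighbours makes an exponent ∑ n rise to ∑ n + 1.
    have hgrow : ∀ (n : ι → ℕ) (a : ι),
        IsFreeGraphMult.{u, v} K n (starGraphOn a ∅) (Multiset.replicate N (∑ i, n i)) →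
        ∀ T : Finset ι, a ∉ T → IsFreeGraphMult.{u, v} K n (starGraphOn a T)
          (Multiset.replicate T.card (∑ i, n i + 1) +
            Multiset.replicate (N - T.card) (∑ i, n i)) := by
      intro n a h0 T ha
      induction T using Finset.induction_on with
      | empty => simpa using h0
      | insert c T hc ih =>
        rw [Finset.mem_insert, not_or] at ha
        have hcard : T.card + 1 ≤ N := by
          have h1 : (insert c T).card ≤ (Finset.univ.erase a).card := by
            refine Finset.card_le_card fun i hi => Finset.mem_erase.2 ⟨?_, Finset.mem_univ _⟩
            rintro rfl
            rcases Finset.mem_insert.1 hi with h | h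
            exacts [ha.1 h, ha.2 h]
          rwa [Finset.card_insert_of_notMem hc, Finset.card_erase_of_mem (Finset.mem_univ _),
            Finset.card_univ, hN, Nat.add_sub_cancel] at h1
        obtain ⟨k, rfl⟩ := Nat.exists_eq_add_of_le' hcard
        have hsub : Fintype.card {i // i ≠ c} = k + (T.card + 1) := by
          rw [Fintype.card_subtype_compl, Fintype.card_subtype_eq, hN, Nat.add_sub_cancel]
        have hr := ihN (mergeWeight n a c) (a := ⟨a, ha.1⟩) (T := T.subtype (· ≠ c))
          (by simpa using ha.2) hsub
        rw [card_subtype_ne_of_notMem hc, sum_mergeWeight n ha.1,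
          show k + (T.card + 1) - 1 - T.card = k by omega] at hr
        have hd := ih ha.2
        rw [show k + (T.card + 1) - T.card = k + 1 by omega, Multiset.replicate_succ,
          Multiset.add_cons] at hd
        have := (isMergeStep_star n ha.2 hc ha.1).isFreeGraphMult ?_ hd hr
        · rw [Finset.card_insert_of_notMem hc, Multiset.replicate_succ, Multiset.cons_add,
            show k + (T.card + 1) - (T.card + 1) = k by omega]
          exact this
        · rw [Finset.card_eq_zero.2, add_zero]
          refine Finset.filter_eq_empty_iff.2 fun j _ => ?_
          simp only [starGraphOn, SimpleGraph.fromRel_adj]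
          grind
    -- Induction on the total weight: lower a positive weight n b by one and join b to all other
    -- vertices. The multiplicities are unchanged, and the full star has all exponents equal to M +
    -- 1.
    have hempty : ∀ (M : ℕ) (n : ι → ℕ) (a : ι), ∑ i, n i = M →
        IsFreeGraphMult.{u, v} K n (starGraphOn a ∅) (Multiset.replicate N M) := by
      intro M
      induction M with
      | zero =>
        intro n a hn
        have : Nonempty ι := ⟨a⟩
        have h0 := isFreeGraphMult_zero.{u, v} (K := K) (ι := ι)
        rw [hN, Nat.add_sub_cancel] at h0
        refine h0.congr fun i j _ => ?_
        have hn0 : ∀ i, n i = 0 := by simpa using hn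
        exact graphMult_congr (hn0 i) (hn0 j) (by simp [starGraphOn])
      | succ M ih =>
        intro n a hn
        obtain ⟨b, -, hb⟩ := Finset.exists_ne_zero_of_sum_ne_zero
          (f := n) (s := Finset.univ) (by rw [hn]; exact Nat.succ_ne_zero M)
        let n₀ := Function.update n b (n b - 1)
        have hn₀ : ∑ i, n₀ i = M := by
          rw [← Finset.add_sum_erase _ _ (Finset.mem_univ b)] at hn ⊢
          rw [Finset.sum_congr rfl (g := fun i => n i) fun i hi => Function.update_of_ne
            (Finset.ne_of_mem_erase hi) _ _]
          simp only [n₀, Function.update_self]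
          omega
        have hcard : (Finset.univ.erase b).card = N := by
          rw [Finset.card_erase_of_mem (Finset.mem_univ _), Finset.card_univ, hN,
            Nat.add_sub_cancel]
        have := hgrow n₀ b (hn₀ ▸ ih n₀ b hn₀) (Finset.univ.erase b) (Finset.notMem_erase _ _)
        rw [hcard, hn₀, Nat.sub_self, Multiset.replicate_zero, add_zero] at this
        refine this.congr fun i j hij => ?_
        simp only [graphMult, starGraphOn, SimpleGraph.fromRel_adj, n₀, Function.update_apply]
        by_cases hi : i = b
        · subst hi
          have := hij.symm
          simp [this, hij]
          omega
        · by_cases hj : j = b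
          · subst hj
            simp [hij]
            omega
          · simp [hi, hj]
    rw [Nat.add_sub_cancel]
    exact hgrow n a (hempty _ n a rfl) T ha

/-- The exponents of the graph multiplicity of a clique. -/
theorem isFreeGraphMult_clique {ι : Type w} [Fintype ι] (n : ι → ℕ) {k : ℕ} {U : Finset ι}
    (hU : U.card = k + 1) : IsFreeGraphMult.{u, v} K n (cliqueGraph U)
      ((Multiset.range k).map (fun i => ∑ i, n i + (i + 1)) +
        Multiset.replicate (Fintype.card ι - (k + 1)) (∑ i, n i)) := by
  classical
  induction k generalizing ι with
  | zero =>
    obtain ⟨a, rfl⟩ := Finset.card_eq_one.1 hU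
    have := isFreeGraphMult_star.{u, v} (K := K) n (Finset.notMem_empty a)
    rw [Finset.card_empty, Multiset.replicate_zero, zero_add, Nat.sub_zero] at this
    rw [Multiset.range_zero, Multiset.map_zero, zero_add]
    refine this.congr fun i j hij => graphMult_congr rfl rfl ?_
    simp only [cliqueGraph, starGraphOn, SimpleGraph.fromRel_adj]
    grind
  | succ k ih =>
    obtain ⟨a, U, ha, rfl, hk⟩ := Finset.card_eq_succ.1 hU
    have hcard : k + 2 ≤ Fintype.card ι := by
      rw [← Finset.card_univ, ← hU]
      exact Finset.card_le_univ _
    -- When c is joined to a, the common neighbours of the two are exactly T, so the distinguished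
    -- exponent climbs from ∑ n + |T| by one. All the restrictions are cliques on U with the same
    -- total weight and hence share the remaining exponents.
    have hcone : ∀ T ⊆ U, IsFreeGraphMult.{u, v} K n (coneGraph U a T)
        ((∑ i, n i + T.card) ::ₘ ((Multiset.range k).map (fun i => ∑ i, n i + (i + 1)) +
          Multiset.replicate (Fintype.card ι - (k + 2)) (∑ i, n i))) := by
      intro T hT
      induction T using Finset.induction_on with
      | empty =>
        have := ih n hk
        rw [show Fintype.card ι - (k + 1) = Fintype.card ι - (k + 2) + 1 by omega,
          Multiset.replicate_succ, Multiset.add_cons] at this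
        rw [Finset.card_empty, add_zero]
        refine this.congr fun i j _ => graphMult_congr rfl rfl ?_
        simp [coneGraph, cliqueGraph]
      | insert c T hc ihT =>
        have hcU := hT (Finset.mem_insert_self c T)
        have hTU := (Finset.subset_insert c T).trans hT
        have hca : c ≠ a := fun h => ha (h ▸ hcU)
        have hr := ih (mergeWeight n c a) ((card_subtype_ne_of_notMem ha).trans hk)
        rw [sum_mergeWeight n hca, Fintype.card_subtype_compl, Fintype.card_subtype_eq,
          show Fintype.card ι - 1 - (k + 1) = Fintype.card ι - (k + 2) by omega] at hr
        have := (isMergeStep_cone n ha hTU hcU hc hca).isFreeGraphMult ?_ (ihT hTU) hr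
        · rwa [Finset.card_insert_of_notMem hc, ← add_assoc]
        · congr 2
          ext j
          simp only [coneGraph, SimpleGraph.fromRel_adj, Finset.mem_filter, Finset.mem_univ,
            true_and]
          grind
    have := hcone U subset_rfl
    rw [hk, ← Multiset.cons_add, ← Multiset.map_cons (fun i => ∑ i, n i + (i + 1)) k,
      ← Multiset.range_succ] at this
    refine this.congr fun i j _ => graphMult_congr rfl rfl ?_
    simp only [coneGraph, cliqueGraph, SimpleGraph.fromRel_adj, Finset.mem_insert]
    grind

end StarAndClique

/-! ### The multiarrangements of the theorem as graph multiplicities. -/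

section MixedBraid

variable {K : Type*} [Field K] [CharZero K]

/-- The coordinate functions on the reflection representation. -/
def reflCoord (K : Type*) [Field K] {ℓ : ℕ} (i : Fin ℓ) : Dual K (ReflSpace K ℓ) :=
  (LinearMap.proj i : (Fin ℓ → K) →ₗ[K] K) ∘ₗ (ReflSpace K ℓ).subtype

/-- Subtracting the mean, for which ℓ must be invertible in K, makes the coordinate sum zero without
changing differences of coordinates. -/
theorem isBraidFrame_reflCoord {ℓ : ℕ} (hℓ : 1 ≤ ℓ) :
    IsBraidFrame (fun i : Fin ℓ => reflCoord K i) := by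
  have hℓ0 : (ℓ : K) ≠ 0 := Nat.cast_ne_zero.2 (by omega)
  constructor
  · intro c
    refine ⟨⟨fun i => c i - (∑ j, c j) / ℓ, ?_⟩, fun i j => ?_⟩
    · simp [ReflSpace, Finset.sum_sub_distrib]
      field_simp
      simp
    · simp [reflCoord]
  · rintro ⟨v, hv⟩ h
    have h1 : ∀ i j, v i = v j := fun i j => sub_eq_zero.1 (h i j)
    refine Subtype.ext (funext fun i => ?_)
    have h2 : ∑ j, v j = 0 := by simpa [ReflSpace] using hv
    rw [Finset.sum_congr rfl fun j _ => h1 j i] at h2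
    simpa [hℓ0] using h2

theorem isGraphic_mixedBraid {ℓ m q : ℕ} (hℓ : 1 ≤ ℓ) :
    (mixedBraid K ℓ m q).IsGraphic (fun i : Fin ℓ => reflCoord K i)
      fun i j => if (i : ℕ) = 0 ∨ (j : ℕ) = 0 then m + q else m := by
  classical
  have hx := isBraidFrame_reflCoord (K := K) hℓ
  have hlt : ∀ i j : Fin ℓ, i < j →
      (mixedBraid K ℓ m q).mult (LinearMap.ker (reflCoord K i - reflCoord K j)) =
        if (i : ℕ) = 0 ∨ (j : ℕ) = 0 then m + q else m := by
    intro i j hij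
    simp only [mixedBraid, MultiArrangement.ofForms]
    rw [Finsupp.finsetSum_apply, Finset.sum_eq_single ⟨(i, j), hij⟩]
    · change Finsupp.single (LinearMap.ker (reflCoord K i - reflCoord K j)) _ _ = _
      rw [Finsupp.single_eq_same]
      have : (j : ℕ) ≠ 0 := by have : (i : ℕ) < j := hij; omega
      simp [this]
    · rintro ⟨⟨s, t⟩, hst⟩ - hne
      refine Finsupp.single_eq_of_ne fun h => hne ?_
      have h2 := hx.pair_subset_of_ker_le hst.ne h.le
      rcases h2 with ⟨rfl, rfl⟩ | ⟨rfl, rfl⟩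
      · rfl
      · exact absurd hij hst.asymm
    · simp
  constructor
  · intro i j hij
    rcases lt_or_gt_of_ne hij with h | h
    · exact hlt i j h
    · rw [MultiArrangement.ker_sub_comm (fun i : Fin ℓ => reflCoord K i), hlt j i h]
      simp only [or_comm]
  · intro H hH
    rw [MultiArrangement.hyperplanes, Finsupp.mem_support_iff] at hH
    simp only [mixedBraid, MultiArrangement.ofForms] at hH
    rw [Finsupp.finsetSum_apply] at hH
    obtain ⟨⟨⟨i, j⟩, hij⟩, -, hp⟩ := Finset.exists_ne_zero_of_sum_ne_zero hH
    refine ⟨i, j, hij.ne, ?_⟩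
    by_contra hne
    exact hp (Finsupp.single_eq_of_ne (Ne.symm hne))

/-- The weight `k`, increased by `q` on the first coordinate. -/
def pointedWeight (ℓ k q : ℕ) (i : Fin ℓ) : ℕ :=
  k + if (i : ℕ) = 0 then q else 0

theorem sum_pointedWeight {ℓ : ℕ} (hℓ : 1 ≤ ℓ) (k q : ℕ) :
    ∑ i, pointedWeight ℓ k q i = k * ℓ + q := by
  obtain ⟨N, rfl⟩ := Nat.exists_eq_add_of_le' hℓ
  simp [pointedWeight, Finset.sum_add_distrib, mul_comm]

/-- The weights k, with q added at the first index, already give 2k or 2k + q on each pair, so the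
star without leaves applies. -/
theorem mixedBraid_even {ℓ : ℕ} (hℓ : 1 ≤ ℓ) (k q : ℕ) :
    IsInductivelyFree (mixedBraid K ℓ (k + k) q) ∧
      (mixedBraid K ℓ (k + k) q).IsFreeWithExponents
        (Multiset.replicate (ℓ - 1) (k * ℓ + q)) := by
  have h := isFreeGraphMult_star (K := K) (pointedWeight ℓ k q)
    (Finset.notMem_empty (⟨0, hℓ⟩ : Fin ℓ)) _ _ (isBraidFrame_reflCoord hℓ)
    (mixedBraid K ℓ (k + k) q) ((isGraphic_mixedBraid hℓ).congr fun i j hij => ?_)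
  · simpa [sum_pointedWeight hℓ] using h
  · have : (i : ℕ) ≠ j := Fin.val_ne_of_ne hij
    simp only [graphMult, pointedWeight, starGraphOn, SimpleGraph.fromRel_adj,
      Finset.notMem_empty, and_false, or_false, if_false]
    split_ifs <;> omega

/-- The complete graph supplies the odd unit on every pair, so the clique on all indices applies. -/
theorem mixedBraid_odd {ℓ : ℕ} (hℓ : 1 ≤ ℓ) (k q : ℕ) :
    IsInductivelyFree (mixedBraid K ℓ (2 * k + 1) q) ∧
      (mixedBraid K ℓ (2 * k + 1) q).IsFreeWithExponents
        ((Multiset.range (ℓ - 1)).map fun i => k * ℓ + q + (i + 1)) := by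
  have h := isFreeGraphMult_clique (K := K) (pointedWeight ℓ k q) (k := ℓ - 1)
    (U := Finset.univ) (by simp; omega) _ _ (isBraidFrame_reflCoord hℓ)
    (mixedBraid K ℓ (2 * k + 1) q) ((isGraphic_mixedBraid hℓ).congr fun i j hij => ?_)
  · simpa [sum_pointedWeight hℓ, show ℓ - (ℓ - 1 + 1) = 0 by omega] using h
  · have : (i : ℕ) ≠ j := Fin.val_ne_of_ne hij
    simp only [graphMult, pointedWeight, cliqueGraph, SimpleGraph.fromRel_adj,
      Finset.mem_univ, and_self, or_self, and_true]
    rw [if_pos hij]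
    split_ifs <;> omega

end MixedBraid

theorem corollary1p2 {K : Type*} [Field K] [CharZero K] (ℓ m q : ℕ)
    (hℓ : 1 ≤ ℓ) (hm : 1 ≤ m) (hq : 1 ≤ q) :
    IsInductivelyFree (mixedBraid K ℓ m q) ∧
    (Even m → (mixedBraid K ℓ m q).IsFreeWithExponents
      (Multiset.replicate (ℓ - 1) (m * ℓ / 2 + q))) ∧
    (Odd m → (mixedBraid K ℓ m q).IsFreeWithExponents
      ((Finset.Icc 1 (ℓ - 1)).val.map fun i => (m - 1) * ℓ / 2 + i + q)) := by
  rcases Nat.even_or_odd m with h | h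
  · obtain ⟨k, rfl⟩ := h
    have hk := mixedBraid_even (K := K) hℓ k q
    refine ⟨hk.1, fun _ => ?_, fun h => absurd h (by simp)⟩
    rw [← two_mul, mul_assoc, Nat.mul_div_cancel_left _ two_pos, two_mul]
    exact hk.2
  · obtain ⟨k, rfl⟩ := h
    have hk := mixedBraid_odd (K := K) hℓ k q
    refine ⟨hk.1, fun h => absurd h (by simp), fun _ => ?_⟩
    have he : (Finset.Icc 1 (ℓ - 1)).val.map (fun i => (2 * k + 1 - 1) * ℓ / 2 + i + q) =
        (Multiset.range (ℓ - 1)).map fun i => k * ℓ + q + (i + 1) := by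
      have himg : Finset.Icc 1 (ℓ - 1) = (Finset.range (ℓ - 1)).map (addRightEmbedding 1) := by
        ext i
        simp only [Finset.mem_Icc, Finset.mem_map, Finset.mem_range, addRightEmbedding_apply]
        exact ⟨fun h => ⟨i - 1, by omega, by omega⟩, by rintro ⟨j, hj, rfl⟩; omega⟩
      rw [himg, Finset.map_val, Multiset.map_map, Finset.range_val]
      refine Multiset.map_congr rfl fun i _ => ?_
      rw [Function.comp_apply, addRightEmbedding_apply, Nat.add_sub_cancel, mul_assoc,
        Nat.mul_div_cancel_left _ two_pos]
      ring
    rw [he]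
    exact hk.2
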